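/- Let $g$ be a smooth Riemannian metric (smooth up to the boundary) on the closed disk $D^2$ such that $\partial D^2$ is strictly convex, i.e. its geodesic curvature $\kappa$ with respect to the inward unit normal is positive. Let $\gamma:[0,L]\to D^2$ be a free boundary embedded geodesic parametrized by arclength, that is, $\gamma$ is embedded, meets $\partial D^2$ exactly at its end points $p_1=\gamma(0)$, $p_2=\gamma(L)$, and is orthogonal to $\partial D^2$ there. Let $K$ be the Gaussian curvature of $g$ and $\nu$ a unit normal field along $\gamma$. Suppose that $\gamma$ is strictly stable, i.e. $$Q(f,f)=\int_\gamma \big((f')^2-Kf^2\big)\,ds-\kappa(p_1)f(p_1)^2-\kappa(p_2)f(p_2)^2>0$$ for every smooth function $f\not\equiv 0$ on $\gamma$, and that $K<0$ along $\gamma$ (for instance, $K<0$ on $D^2$). Then there is a positive first eigenfunction $\phi_1$ of the Robin problem $$\phi''+K\phi+\lambda\phi=0\ \text{ on }\gamma,\qquad \frac{\partial\phi}{\partial\eta}-\kappa\phi=0\ \text{ on }\partial\gamma,$$ where $\eta$ is the outward unit conormal, normalized by $\int_\gamma\phi_1^2\,ds=1$. Moreover, for any such $\phi_1$, the first eigenvalue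 $\lambda_1$ is positive and, with the Harnack constant $C_\gamma=\max_\gamma\phi_1/\min_\gamma\phi_1$, there are $\epsilon>0$ and a smooth embedding $F:[-\epsilon,\epsilon]\times[0,L]\to D^2$, with leaves $\gamma_t=F(t,\cdot)$, such that: 1. the image of $F$ contains $N_h(\gamma)=\{x\in D^2: d(x,\gamma)<h\}$ for some $h>0$ (so the $\gamma_t$ foliate a neighborhood of $\gamma$), and each $\gamma_t$ meets $\partial D^2$ exactly at its two end points, and orthogonally there; 2. $F(0,s)=\gamma(s)$ and $\partial_tF(0,s)=\phi_1(s)\,\nu(s)$ for all $s\in[0,L]$; 3. for $0<|t|\le\epsilon$, the curvature vector of $\gamma_t$ is nowhere zero and points to the side of $\gamma_t$ that contains $\gamma=\gamma_0$; 4. for $0<|t|\le\epsilon$, $\min_{x\in\gamma_t}d(x,\gamma)>0$ and $$\frac{\max_{x\in\gamma_t}d(x,\gamma)}{\min_{x\in\gamma_t}d(x,\gamma)}\le 2C_\gamma .$$ -/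

import Mathlib

open Set
open scoped ContDiff

noncomputable section

namespace FreeBoundary

/-- The plane `ℝ²` with its Euclidean structure; it only serves as the coordinate space. -/
abbrev Plane : Type := EuclideanSpace ℝ (Fin 2)

/-- The closed unit disk `D²`. -/
def disk : Set Plane := Metric.closedBall 0 1

/-- The boundary circle `∂D²`. -/
def circle : Set Plane := Metric.sphere 0 1

/-- A map is smooth on a set if it is smooth on some open neighbourhood of that set. -/
def SmoothOn {E F : Type*} [NormedAddCommGroup E] [NormedSpace ℝ E]
    [NormedAddCommGroup F] [NormedSpace ℝ F] (f : E → F) (S : Set E) : Prop :=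
  ∃ U : Set E, IsOpen U ∧ S ⊆ U ∧ ContDiffOn ℝ ∞ f U

/-- A smooth Riemannian metric on the closed disk `D²`, smooth up to the boundary: a smooth field of
symmetric bilinear forms, positive definite on the disk. (A tensor field that is smooth up to the
boundary is the restriction of a smooth one on the plane; nothing below depends on the values of
the extension off the disk.) -/
structure DiskMetric where
  form : Plane → Plane →L[ℝ] Plane →L[ℝ] ℝ
  smooth : ContDiff ℝ ∞ form
  symm : ∀ x u v, form x u v = form x v u
  pos : ∀ x ∈ disk, ∀ v, v ≠ 0 → 0 < form x v v

/-- The coordinate vector `∂ᵢ`. -/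
def coordVec (i : Fin 2) : Plane := EuclideanSpace.single i 1

/-- The partial derivative `∂ᵢ f`. -/
def pderiv (i : Fin 2) (f : Plane → ℝ) (x : Plane) : ℝ := fderiv ℝ f x (coordVec i)

/-- The counterclockwise coordinate tangent vector of the circle at `p = (p₀, p₁)`,
namely `(-p₁, p₀)`. -/
def circleTangent (p : Plane) : Plane := !₂[-p 1, p 0]

namespace DiskMetric

variable (g : DiskMetric)

/-- The matrix `gᵢⱼ` of the metric in the standard coordinates. -/
def gram (x : Plane) : Matrix (Fin 2) (Fin 2) ℝ :=
  Matrix.of fun i j => g.form x (coordVec i) (coordVec j)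

/-- The `g`-norm of a tangent vector `v` at `x`. -/
def norm (x v : Plane) : ℝ := Real.sqrt (g.form x v v)

/-- Christoffel symbols
`Γᵏᵢⱼ = ½ gᵏˡ (∂ᵢ gⱼₗ + ∂ⱼ gᵢₗ - ∂ₗ gᵢⱼ)` of the Levi-Civita connection. -/
def christoffel (k i j : Fin 2) (x : Plane) : ℝ :=
  (1 / 2) * ∑ l, (g.gram x)⁻¹ k l *
    (pderiv i (fun y => g.gram y j l) x + pderiv j (fun y => g.gram y i l) x
      - pderiv l (fun y => g.gram y i j) x)

/-- The `l`-th component of the curvature tensor `R(∂ᵢ, ∂ⱼ) ∂ₖ`. -/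
def curvatureTensor (l i j k : Fin 2) (x : Plane) : ℝ :=
  pderiv i (g.christoffel l j k) x - pderiv j (g.christoffel l i k) x
    + ∑ m, (g.christoffel m j k x * g.christoffel l i m x
      - g.christoffel m i k x * g.christoffel l j m x)

/-- The Gaussian curvature `K = g(R(∂₀, ∂₁) ∂₁, ∂₀) / det g`. -/
def gaussCurvature (x : Plane) : ℝ :=
  (∑ l, g.gram x l 0 * g.curvatureTensor l 0 1 1 x) / (g.gram x).det

/-- Rotation by `π/2` counterclockwise in the tangent plane at `x`, with respect to `g`. -/
def rot (x v : Plane) : Plane :=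
  (Real.sqrt (g.gram x).det)⁻¹ •
    !₂[-(g.gram x 1 0 * v 0 + g.gram x 1 1 * v 1), g.gram x 0 0 * v 0 + g.gram x 0 1 * v 1]

/-- The covariant acceleration `∇_{c'} c'` of a curve `c`. -/
def acceleration (c : ℝ → Plane) (s : ℝ) : Plane :=
  deriv (deriv c) s +
    WithLp.toLp 2 (fun k => ∑ i, ∑ j, g.christoffel k i j (c s) * deriv c s i * deriv c s j)

/-- The curvature vector of a regular curve `c` (in any regular parametrization): the component of
`∇_{c'} c'` that is `g`-normal to `c'`, divided by `|c'|²`. -/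
def curvatureVector (c : ℝ → Plane) (s : ℝ) : Plane :=
  (g.form (c s) (deriv c s) (deriv c s))⁻¹ •
    (g.acceleration c s -
      (g.form (c s) (g.acceleration c s) (deriv c s) / g.form (c s) (deriv c s) (deriv c s)) •
        deriv c s)

/-- The inward `g`-unit normal of `∂D²` at `p`. -/
def inwardNormal (p : Plane) : Plane :=
  (g.norm p (circleTangent p))⁻¹ • g.rot p (circleTangent p)

/-- The geodesic curvature `κ` of `∂D²` at `p` with respect to the inward unit normal; the circle is
parametrized near `p` by `θ ↦ cos θ • p + sin θ • circleTangent p`. -/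
def boundaryCurvature (p : Plane) : ℝ :=
  g.form p
    (g.curvatureVector (fun θ => Real.cos θ • p + Real.sin θ • circleTangent p) 0)
    (g.inwardNormal p)

/-- `∂D²` is strictly convex. -/
def StrictlyConvexBoundary : Prop := ∀ p ∈ circle, 0 < g.boundaryCurvature p

/-- The set of `g`-lengths of `C¹` curves in the disk from `x` to `y`. -/
def pathLengths (x y : Plane) : Set ℝ :=
  {l | ∃ c : ℝ → Plane, ContDiffOn ℝ 1 c (Icc 0 1) ∧ MapsTo c (Icc 0 1) disk ∧ c 0 = x ∧ c 1 = y ∧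
    l = ∫ s in (0 : ℝ)..1, g.norm (c s) (deriv c s)}

/-- The Riemannian distance `d(x, y)` in `(D², g)`. -/
def rdist (x y : Plane) : ℝ := sInf (g.pathLengths x y)

/-- The distance `d(x, S)` from a point to a set. -/
def rdistTo (x : Plane) (S : Set Plane) : ℝ := sInf (g.rdist x '' S)

/-- `γ : [0, L] → D²` is a free boundary embedded geodesic, parametrized by arclength: it meets `∂D²`
exactly at its two end points, and orthogonally there. -/
structure IsFreeBoundaryGeodesic (γ : ℝ → Plane) (L : ℝ) : Prop where
  length_pos : 0 < L
  smooth : SmoothOn γ (Icc 0 L)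
  injOn : InjOn γ (Icc 0 L)
  unit_speed : ∀ s ∈ Icc 0 L, g.form (γ s) (deriv γ s) (deriv γ s) = 1
  geodesic : ∀ s ∈ Icc 0 L, g.acceleration γ s = 0
  interior : ∀ s ∈ Ioo 0 L, γ s ∈ Metric.ball (0 : Plane) 1
  start_mem : γ 0 ∈ circle
  end_mem : γ L ∈ circle
  start_orthogonal : g.form (γ 0) (deriv γ 0) (circleTangent (γ 0)) = 0
  end_orthogonal : g.form (γ L) (deriv γ L) (circleTangent (γ L)) = 0

/-- The unit normal `ν` of an arclength parametrized curve, with the convention `γ' = J ν`. -/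
def unitNormal (γ : ℝ → Plane) (s : ℝ) : Plane := -g.rot (γ s) (deriv γ s)

/-- The second variation of length
`Q(f, f) = ∫_γ ((f')² - K f²) ds - (κ(p₁) f(p₁)² + κ(p₂) f(p₂)²)`. -/
def secondVariation (γ : ℝ → Plane) (L : ℝ) (f : ℝ → ℝ) : ℝ :=
  (∫ s in (0 : ℝ)..L, ((deriv f s) ^ 2 - g.gaussCurvature (γ s) * f s ^ 2))
    - (g.boundaryCurvature (γ 0) * f 0 ^ 2 + g.boundaryCurvature (γ L) * f L ^ 2)

/-- `γ` is strictly stable: `Q` is positive definite on smooth functions on `γ`. -/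
def IsStrictlyStable (γ : ℝ → Plane) (L : ℝ) : Prop :=
  ∀ f : ℝ → ℝ, SmoothOn f (Icc 0 L) → (∃ s ∈ Icc 0 L, f s ≠ 0) → 0 < g.secondVariation γ L f

/-- `φ` is an eigenfunction for the eigenvalue `lam` of the stability operator with Robin condition:
`φ'' + K φ + lam φ = 0` on `γ` and `∂φ/∂η = κ φ` at both ends, `η` the outward unit conormal. -/
structure IsRobinEigenfunction (γ : ℝ → Plane) (L lam : ℝ) (φ : ℝ → ℝ) : Prop where
  smooth : SmoothOn φ (Icc 0 L)
  nontrivial : ∃ s ∈ Icc 0 L, φ s ≠ 0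
  equation : ∀ s ∈ Icc 0 L,
    deriv (deriv φ) s + g.gaussCurvature (γ s) * φ s + lam * φ s = 0
  robin_start : -deriv φ 0 - g.boundaryCurvature (γ 0) * φ 0 = 0
  robin_end : deriv φ L - g.boundaryCurvature (γ L) * φ L = 0

/-- `lam` is the first (least) Robin eigenvalue and `φ` is a positive eigenfunction for it with
`∫_γ φ² ds = 1`. -/
structure IsPositiveFirstEigenfunction (γ : ℝ → Plane) (L lam : ℝ) (φ : ℝ → ℝ) : Prop where
  eigen : g.IsRobinEigenfunction γ L lam φ
  least : ∀ mu ψ, g.IsRobinEigenfunction γ L mu ψ → lam ≤ mu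
  pos : ∀ s ∈ Icc 0 L, 0 < φ s
  normalized : ∫ s in (0 : ℝ)..L, φ s ^ 2 = 1

/-- A smooth foliation of a neighbourhood of `γ` by free boundary curves `γ_t = F(t, ·)`,
`t ∈ [-ε, ε]`, with `γ_0 = γ`: a smooth embedding of `[-ε, ε] × [0, L]` in the disk whose image
contains a tubular neighbourhood `N_h(γ) = {x | d(x, γ) < h}`, such that every `γ_t` meets `∂D²`
exactly at its two end points, and orthogonally there. -/
structure IsFreeBoundaryFoliation (γ : ℝ → Plane) (L ε : ℝ) (F : ℝ × ℝ → Plane) : Prop where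
  smooth : SmoothOn F (Icc (-ε) ε ×ˢ Icc 0 L)
  mapsTo : MapsTo F (Icc (-ε) ε ×ˢ Icc 0 L) disk
  injOn : InjOn F (Icc (-ε) ε ×ˢ Icc 0 L)
  immersion : ∀ p ∈ Icc (-ε) ε ×ˢ Icc 0 L, Function.Injective (fderiv ℝ F p)
  central : ∀ s ∈ Icc 0 L, F (0, s) = γ s
  covers : ∃ h > 0, ∀ x ∈ disk, g.rdistTo x (γ '' Icc 0 L) < h → x ∈ F '' (Icc (-ε) ε ×ˢ Icc 0 L)
  interior : ∀ t ∈ Icc (-ε) ε, ∀ s ∈ Ioo 0 L, F (t, s) ∈ Metric.ball (0 : Plane) 1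
  free_boundary : ∀ t ∈ Icc (-ε) ε, ∀ s, s = 0 ∨ s = L → F (t, s) ∈ circle ∧
    g.form (F (t, s)) (deriv (fun σ => F (t, σ)) s) (circleTangent (F (t, s))) = 0

/-- For `t ≠ 0` the curvature vector of the leaf `γ_t = F(t, ·)` is nonzero everywhere and points to
the side of `γ_t` on which `γ_0` lies, that is, against `∂F/∂t` for `t > 0` and along `∂F/∂t` for
`t < 0`. -/
def CurvatureTowardsCenter (L ε : ℝ) (F : ℝ × ℝ → Plane) : Prop :=
  ∀ t ∈ Icc (-ε) ε, t ≠ 0 → ∀ s ∈ Icc 0 L,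
    t * g.form (F (t, s)) (g.curvatureVector (fun σ => F (t, σ)) s)
      (deriv (fun τ => F (τ, s)) t) < 0

/-- The maximum of `d(·, γ)` over the leaf is at most `B` times its minimum, which is positive. -/
def DistanceRatioLE (γ : ℝ → Plane) (L : ℝ) (leaf : Set Plane) (B : ℝ) : Prop :=
  ∃ M m : ℝ, IsGreatest ((fun x => g.rdistTo x (γ '' Icc 0 L)) '' leaf) M ∧
    IsLeast ((fun x => g.rdistTo x (γ '' Icc 0 L)) '' leaf) m ∧ 0 < m ∧ M / m ≤ B

end DiskMetric

/-- The Harnack constant `max φ / min φ` of a positive function on `[0, L]`. -/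
def harnackConstant (L : ℝ) (φ : ℝ → ℝ) : ℝ := sSup (φ '' Icc 0 L) / sInf (φ '' Icc 0 L)

end FreeBoundary

end

noncomputable section

namespace FreeBoundary

open Filter Topology

/-! Write κ₀, κ₁ for the boundary curvature at γ(0), γ(L). A positive first eigenfunction φ comes
from shooting: solve y'' + (K + λ)y = 0 with y(0) = 1, y'(0) = -κ₀, and let λ be the supremum of the
parameters for which y > 0 on [0, L] and y'(L) ≥ κ₁ y(L). At the supremum the solution is still
positive and the end condition is an equality (`exists_positive_robin_solution`). Picone's identity
shows that a positive eigenfunction belongs to the least eigenvalue. Integrating by parts, Q(φ, φ) =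
λ∫φ² = λ, so strict stability gives λ > 0.

The foliation is an explicit family, not the solution of a curvature equation. Start from γ + tφν.
Differentiated at t = 0, orthogonality to the circle at the end points is exactly the Robin
condition (`hasDerivAt_form_circleTangent`). Hence corrections of order t² at the ends, carried
inwards by cubic Hermite polynomials, make every leaf meet the circle orthogonally without changing
the variation field φν (`exists_boundary_correction`). The normal part of the linearized geodesic
operator is the Jacobi operator, so the product of the leaf's curvature with ∂F/∂t has t-derivative
φ(φ'' + Kφ) = -λφ² < 0 at t = 0. It vanishes at t = 0, hence has the sign of -t for small t,
uniformly on [0, L] by compactness (`hasDerivAt_leafCurvature`, `eventually_leafCurvature_sign`).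

Along γ the metric pulled back by F is φ²dt² + ds². Since φ > 0, F is an immersion there, and
injective near the segment t = 0 because γ is. With m = min φ and M = max φ, nearby each bound on
the metric is lost by at most a factor √2 in length (`exists_isFoliationChart`). A path from the
leaf t to γ has length at least |t|m/√2 (`IsFoliationChart.le_length`), while the transverse curve s
= const has length at most √2 M|t|. The quotient of the two bounds is 2M/m. The lower bound also
shows that the leaves cover a neighbourhood of γ. -/

lemma plane_ext {u v : Plane} (h0 : u 0 = v 0) (h1 : u 1 = v 1) : u = v := by
  ext i
  fin_cases i
  · exact h0
  · exact h1

lemma eq_coord_sum (v : Plane) : v = v 0 • coordVec 0 + v 1 • coordVec 1 := by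
  apply plane_ext <;> simp [coordVec]

lemma fderiv_apply_eq_pderiv (f : Plane → ℝ) (x v : Plane) :
    fderiv ℝ f x v = v 0 * pderiv 0 f x + v 1 * pderiv 1 f x := by
  conv_lhs => rw [eq_coord_sum v]
  simp [pderiv]

/-! ### Gram matrix, Christoffel symbols and curvature in coordinates -/

namespace DiskMetric

variable (g : DiskMetric)

lemma form_eq_gram (x u v : Plane) :
    g.form x u v = g.gram x 0 0 * (u 0 * v 0) + g.gram x 0 1 * (u 0 * v 1)
      + g.gram x 1 0 * (u 1 * v 0) + g.gram x 1 1 * (u 1 * v 1) := by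
  conv_lhs => rw [eq_coord_sum u, eq_coord_sum v]
  simp [gram]
  ring

lemma gram_symm (x : Plane) (i j : Fin 2) : g.gram x i j = g.gram x j i := by
  simp only [gram, Matrix.of_apply]
  exact g.symm x _ _

lemma gram_det (x : Plane) :
    (g.gram x).det = g.gram x 0 0 * g.gram x 1 1 - g.gram x 0 1 * g.gram x 0 1 := by
  rw [Matrix.det_fin_two, g.gram_symm x 1 0]

lemma gram_zero_zero_pos {x : Plane} (hx : x ∈ disk) : 0 < g.gram x 0 0 := by
  simp only [gram, Matrix.of_apply]
  refine g.pos x hx _ fun h => ?_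
  have := congrArg (fun v : Plane => v 0) h
  simp [coordVec] at this

/-- The vector (-g₀₁, g₀₀) has squared length g₀₀ · det g, and g₀₀ > 0. -/
lemma gram_det_pos {x : Plane} (hx : x ∈ disk) : 0 < (g.gram x).det := by
  have h0 := g.gram_zero_zero_pos hx
  have h := g.pos x hx (!₂[-g.gram x 0 1, g.gram x 0 0]) (fun h => by
    have := congrArg (fun v : Plane => v 1) h
    simp at this
    exact h0.ne' this)
  rw [form_eq_gram, g.gram_symm x 1 0] at h
  simp at h
  rw [gram_det]
  have : 0 < g.gram x 0 0 * (g.gram x 0 0 * g.gram x 1 1 - g.gram x 0 1 * g.gram x 0 1) := by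
    nlinarith
  exact pos_of_mul_pos_right this h0.le

lemma contDiff_gram (i j : Fin 2) : ContDiff ℝ ∞ (fun x => g.gram x i j) := by
  simp only [gram, Matrix.of_apply]
  exact (g.smooth.clm_apply contDiff_const).clm_apply contDiff_const

lemma contDiff_gram_det : ContDiff ℝ ∞ (fun x => (g.gram x).det) := by
  simp only [gram_det]
  exact ((g.contDiff_gram 0 0).mul (g.contDiff_gram 1 1)).sub
    ((g.contDiff_gram 0 1).mul (g.contDiff_gram 0 1))

end DiskMetric

lemma ContDiffAt.pderiv {f : Plane → ℝ} {x : Plane} (h : ContDiffAt ℝ ∞ f x) (i : Fin 2) :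
    ContDiffAt ℝ ∞ (pderiv i f) x :=
  (h.fderiv_right (m := ∞) (by simp)).clm_apply contDiffAt_const

lemma pderiv_comm {f : Plane → ℝ} {x : Plane} (h : ContDiffAt ℝ ∞ f x) (i j : Fin 2) :
    pderiv i (pderiv j f) x = pderiv j (pderiv i f) x := by
  have hd : DifferentiableAt ℝ (fderiv ℝ f) x :=
    (h.fderiv_right (m := ∞) (by simp)).differentiableAt (by simp)
  have key : ∀ k l : Fin 2, FreeBoundary.pderiv k (FreeBoundary.pderiv l f) x
      = fderiv ℝ (fderiv ℝ f) x (coordVec k) (coordVec l) := by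
    intro k l
    unfold FreeBoundary.pderiv
    rw [fderiv_clm_apply hd (by fun_prop)]
    simp
  rw [key, key]
  exact (h.isSymmSndFDerivAt (by
    rw [minSmoothness_of_isRCLikeNormedField]; exact WithTop.coe_mono (le_top : (2 : ℕ∞) ≤ ⊤))).eq _ _

lemma pderiv_mul {f h : Plane → ℝ} {x : Plane} (hf : DifferentiableAt ℝ f x)
    (hh : DifferentiableAt ℝ h x) (i : Fin 2) :
    pderiv i (fun y => f y * h y) x = f x * pderiv i h x + h x * pderiv i f x := by
  unfold pderiv
  rw [fderiv_fun_mul hf hh]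
  simp

lemma pderiv_add {f h : Plane → ℝ} {x : Plane} (hf : DifferentiableAt ℝ f x)
    (hh : DifferentiableAt ℝ h x) (i : Fin 2) :
    pderiv i (fun y => f y + h y) x = pderiv i f x + pderiv i h x := by
  unfold pderiv
  rw [fderiv_fun_add hf hh]
  simp

namespace DiskMetric

variable (g : DiskMetric)

lemma contDiffAt_gram_inv {x : Plane} (hx : (g.gram x).det ≠ 0) (i j : Fin 2) :
    ContDiffAt ℝ ∞ (fun y => (g.gram y)⁻¹ i j) x := by
  have : (fun y => (g.gram y)⁻¹ i j) = fun y => (g.gram y).det⁻¹ * (g.gram y).adjugate i j := by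
    ext y
    simp [Matrix.inv_def]
  rw [this]
  refine (g.contDiff_gram_det.contDiffAt.inv hx).mul ?_
  have h := fun a b => (g.contDiff_gram a b).contDiffAt (x := x)
  fin_cases i <;> fin_cases j <;> simp [Matrix.adjugate_fin_two]
  · exact h 1 1
  · exact (h 0 1).neg
  · exact (h 1 0).neg
  · exact h 0 0

lemma contDiffAt_christoffel {x : Plane} (hx : (g.gram x).det ≠ 0) (k i j : Fin 2) :
    ContDiffAt ℝ ∞ (g.christoffel k i j) x := by
  unfold christoffel
  have h := fun a b => (g.contDiff_gram a b).contDiffAt (x := x)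
  refine contDiffAt_const.mul (ContDiffAt.sum fun l _ => (g.contDiffAt_gram_inv hx k l).mul ?_)
  exact ((ContDiffAt.pderiv (h _ _) _).add (ContDiffAt.pderiv (h _ _) _)).sub
    (ContDiffAt.pderiv (h _ _) _)

lemma contDiffAt_gaussCurvature {x : Plane} (hx : (g.gram x).det ≠ 0) :
    ContDiffAt ℝ ∞ g.gaussCurvature x := by
  have hc := fun k i j => g.contDiffAt_christoffel hx k i j
  unfold gaussCurvature curvatureTensor
  refine ContDiffAt.div (ContDiffAt.sum fun l _ => (g.contDiff_gram _ _).contDiffAt.mul ?_)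
    g.contDiff_gram_det.contDiffAt hx
  refine ((ContDiffAt.pderiv (hc _ _ _) _).sub (ContDiffAt.pderiv (hc _ _ _) _)).add
    (ContDiffAt.sum fun m _ => ((hc _ _ _).mul (hc _ _ _)).sub ((hc _ _ _).mul (hc _ _ _)))

lemma christoffel_symm (k i j : Fin 2) (x : Plane) :
    g.christoffel k i j x = g.christoffel k j i x := by
  unfold christoffel
  have : (fun y => g.gram y i j) = fun y => g.gram y j i := funext fun y => g.gram_symm y i j
  congr 1
  refine Finset.sum_congr rfl fun l _ => ?_
  rw [this]
  ring

/-- Lowering the index of the Christoffel symbols. -/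
lemma gram_mul_christoffel {x : Plane} (hx : (g.gram x).det ≠ 0) (m i j : Fin 2) :
    g.gram x m 0 * g.christoffel 0 i j x + g.gram x m 1 * g.christoffel 1 i j x
      = (1 / 2) * (pderiv i (fun y => g.gram y j m) x + pderiv j (fun y => g.gram y i m) x
          - pderiv m (fun y => g.gram y i j) x) := by
  have h : g.gram x * (g.gram x)⁻¹ = 1 := Matrix.mul_nonsing_inv _ (isUnit_iff_ne_zero.mpr hx)
  have h' : ∀ a b, g.gram x a 0 * (g.gram x)⁻¹ 0 b + g.gram x a 1 * (g.gram x)⁻¹ 1 b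
      = (1 : Matrix (Fin 2) (Fin 2) ℝ) a b := by
    intro a b
    rw [← h, Matrix.mul_apply, Fin.sum_univ_two]
  unfold christoffel
  simp only [Fin.sum_univ_two]
  fin_cases m
  · have h0 := h' 0 0
    have h1 := h' 0 1
    simp at h0 h1 ⊢
    linear_combination (1 / 2) * (pderiv i (fun y => g.gram y j 0) x
      + pderiv j (fun y => g.gram y i 0) x - pderiv 0 (fun y => g.gram y i j) x) * h0
      + (1 / 2) * (pderiv i (fun y => g.gram y j 1) x
      + pderiv j (fun y => g.gram y i 1) x - pderiv 1 (fun y => g.gram y i j) x) * h1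
  · have h0 := h' 1 0
    have h1 := h' 1 1
    simp at h0 h1 ⊢
    linear_combination (1 / 2) * (pderiv i (fun y => g.gram y j 0) x
      + pderiv j (fun y => g.gram y i 0) x - pderiv 0 (fun y => g.gram y i j) x) * h0
      + (1 / 2) * (pderiv i (fun y => g.gram y j 1) x
      + pderiv j (fun y => g.gram y i 1) x - pderiv 1 (fun y => g.gram y i j) x) * h1

/-- The Levi-Civita connection is compatible with the metric. -/
lemma pderiv_gram {x : Plane} (hx : (g.gram x).det ≠ 0) (l i j : Fin 2) :
    pderiv l (fun y => g.gram y i j) x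
      = g.christoffel 0 l i x * g.gram x 0 j + g.christoffel 1 l i x * g.gram x 1 j
        + (g.christoffel 0 l j x * g.gram x 0 i + g.christoffel 1 l j x * g.gram x 1 i) := by
  have h1 := g.gram_mul_christoffel hx j l i
  have h2 := g.gram_mul_christoffel hx i l j
  have e : (fun y => g.gram y j i) = fun y => g.gram y i j :=
    funext fun y => g.gram_symm y j i
  rw [e] at h2
  rw [g.gram_symm x 0 j, g.gram_symm x 1 j, g.gram_symm x 0 i, g.gram_symm x 1 i]
  linear_combination -h1 - h2

/-- The curvature `R(∂₀, ∂₁)` is skew with respect to the metric. -/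
lemma curvatureTensor_skew {x : Plane} (hx : (g.gram x).det ≠ 0) (i j : Fin 2) :
    (g.curvatureTensor 0 0 1 i x * g.gram x 0 j + g.curvatureTensor 1 0 1 i x * g.gram x 1 j)
      + (g.curvatureTensor 0 0 1 j x * g.gram x 0 i + g.curvatureTensor 1 0 1 j x * g.gram x 1 i)
      = 0 := by
  have hev : ∀ᶠ y in 𝓝 x, (g.gram y).det ≠ 0 :=
    g.contDiff_gram_det.continuous.continuousAt.eventually_ne hx
  have hd : ∀ k a b, DifferentiableAt ℝ (g.christoffel k a b) x :=
    fun k a b => (g.contDiffAt_christoffel hx k a b).differentiableAt (by simp)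
  have hg : ∀ a b, DifferentiableAt ℝ (fun y => g.gram y a b) x :=
    fun a b => (g.contDiff_gram a b).contDiffAt.differentiableAt (by simp)
  have hm : ∀ k a b c d, DifferentiableAt ℝ (fun y => g.christoffel k a b y * g.gram y c d) x :=
    fun k a b c d => (hd k a b).mul (hg c d)
  have hm' : ∀ k a b c d k' a' b' c' d', DifferentiableAt ℝ (fun y =>
      g.christoffel k a b y * g.gram y c d + g.christoffel k' a' b' y * g.gram y c' d') x :=
    fun k a b c d k' a' b' c' d' => (hm k a b c d).fun_add (hm k' a' b' c' d')
  -- Metric compatibility holds in a neighbourhood of x and may be differentiated. Equality of the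
  -- mixed partials of gᵢⱼ then becomes skewness, once compatibility is substituted for the
  -- remaining first derivatives of g.
  have second : ∀ k l, pderiv k (pderiv l (fun y => g.gram y i j)) x
      = (g.christoffel 0 l i x * pderiv k (fun y => g.gram y 0 j) x
          + g.gram x 0 j * pderiv k (g.christoffel 0 l i) x
          + (g.christoffel 1 l i x * pderiv k (fun y => g.gram y 1 j) x
          + g.gram x 1 j * pderiv k (g.christoffel 1 l i) x))
        + (g.christoffel 0 l j x * pderiv k (fun y => g.gram y 0 i) x
          + g.gram x 0 i * pderiv k (g.christoffel 0 l j) x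
          + (g.christoffel 1 l j x * pderiv k (fun y => g.gram y 1 i) x
          + g.gram x 1 i * pderiv k (g.christoffel 1 l j) x)) := by
    intro k l
    have e : pderiv l (fun y => g.gram y i j) =ᶠ[𝓝 x] fun y =>
        g.christoffel 0 l i y * g.gram y 0 j + g.christoffel 1 l i y * g.gram y 1 j
        + (g.christoffel 0 l j y * g.gram y 0 i + g.christoffel 1 l j y * g.gram y 1 i) :=
      hev.mono fun y hy => g.pderiv_gram hy l i j
    have e' : pderiv k (pderiv l (fun y => g.gram y i j)) x = pderiv k (fun y =>
        g.christoffel 0 l i y * g.gram y 0 j + g.christoffel 1 l i y * g.gram y 1 j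
        + (g.christoffel 0 l j y * g.gram y 0 i + g.christoffel 1 l j y * g.gram y 1 i)) x := by
      conv_lhs => unfold pderiv
      conv_rhs => unfold pderiv
      exact congrArg (fun A : Plane →L[ℝ] ℝ => A (coordVec k)) e.fderiv_eq
    rw [e', pderiv_add (hm' _ _ _ _ _ _ _ _ _ _) (hm' _ _ _ _ _ _ _ _ _ _),
      pderiv_add (hm _ _ _ _ _) (hm _ _ _ _ _), pderiv_add (hm _ _ _ _ _) (hm _ _ _ _ _),
      pderiv_mul (hd _ _ _) (hg _ _), pderiv_mul (hd _ _ _) (hg _ _),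
      pderiv_mul (hd _ _ _) (hg _ _), pderiv_mul (hd _ _ _) (hg _ _)]
  have hc := pderiv_comm (g.contDiff_gram i j).contDiffAt (x := x) 0 1
  rw [second, second] at hc
  simp only [g.pderiv_gram hx, g.gram_symm x 1 0] at hc
  simp only [curvatureTensor, Fin.sum_univ_two]
  linear_combination hc

/-- In dimension two the curvature operator `R(∂₀, ∂₁)` is determined by the Gaussian curvature. -/
lemma form_curvatureTensor {x : Plane} (hx : (g.gram x).det ≠ 0) (v n : Plane) :
    (g.curvatureTensor 0 0 1 0 x * v 0 + g.curvatureTensor 0 0 1 1 x * v 1)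
        * (g.gram x 0 0 * n 0 + g.gram x 0 1 * n 1)
      + (g.curvatureTensor 1 0 1 0 x * v 0 + g.curvatureTensor 1 0 1 1 x * v 1)
        * (g.gram x 1 0 * n 0 + g.gram x 1 1 * n 1)
      = (n 0 * v 1 - n 1 * v 0) * (g.gaussCurvature x * (g.gram x).det) := by
  have h00 := g.curvatureTensor_skew hx 0 0
  have h01 := g.curvatureTensor_skew hx 0 1
  have h11 := g.curvatureTensor_skew hx 1 1
  have hK : g.gaussCurvature x * (g.gram x).det
      = g.gram x 0 0 * g.curvatureTensor 0 0 1 1 x + g.gram x 1 0 * g.curvatureTensor 1 0 1 1 x := by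
    unfold gaussCurvature
    rw [div_mul_cancel₀ _ hx, Fin.sum_univ_two]
  rw [hK]
  -- After lowering an index, a skew 2 × 2 matrix has one independent entry, and that entry is K ·
  -- det g.
  linear_combination (1 / 2) * v 0 * n 0 * h00 + n 1 * v 0 * h01 + (1 / 2) * v 1 * n 1 * h11

end DiskMetric

/-! ### Covariant differentiation along curves, rotation and the boundary normal -/

lemma hasDerivAt_plane {f : ℝ → Plane} {f' : Plane} {s : ℝ} :
    HasDerivAt f f' s ↔ ∀ i, HasDerivAt (fun x => f x i) (f' i) s := by
  have key : HasDerivAt (fun x => (f x).ofLp) f'.ofLp s ↔ ∀ i, HasDerivAt (fun x => f x i) (f' i) s :=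
    hasDerivAt_pi
  rw [← key]
  constructor
  · exact fun h => (EuclideanSpace.equiv (Fin 2) ℝ).toContinuousLinearMap.hasFDerivAt.comp_hasDerivAt s h
  · exact fun h => (EuclideanSpace.equiv (Fin 2) ℝ).symm.toContinuousLinearMap.hasFDerivAt.comp_hasDerivAt s h

lemma contDiff_deriv {E : Type*} [NormedAddCommGroup E] [NormedSpace ℝ E] {f : ℝ → E}
    (h : ContDiff ℝ ∞ f) : ContDiff ℝ ∞ (deriv f) :=
  (contDiff_infty_iff_deriv.mp h).2

/-- One-sided derivatives on a nondegenerate interval are unique. Identities known only on [0, L]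
can thus be differentiated at its end points too. -/
lemma HasDerivAt.eq_of_eqOn_Icc {E : Type*} [NormedAddCommGroup E] [NormedSpace ℝ E]
    {f h : ℝ → E} {f' h' : E} {a b s : ℝ} (hab : a < b) (hs : s ∈ Icc a b)
    (hf : HasDerivAt f f' s) (hh : HasDerivAt h h' s) (e : EqOn f h (Icc a b)) : f' = h' :=
  (uniqueDiffOn_Icc hab s hs).eq_deriv _ hf.hasDerivWithinAt
    (hh.hasDerivWithinAt.congr e (e hs))

namespace DiskMetric

variable (g : DiskMetric)

/-- The quadratic part `Γ(u, v)` of the covariant derivative. -/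
def christoffelForm (x u v : Plane) : Plane :=
  WithLp.toLp 2 (fun k => ∑ i, ∑ j, g.christoffel k i j x * u i * v j)

lemma acceleration_eq (c : ℝ → Plane) (s : ℝ) :
    g.acceleration c s = deriv (deriv c) s + g.christoffelForm (c s) (deriv c s) (deriv c s) := rfl

lemma christoffelForm_apply (x u v : Plane) (k : Fin 2) :
    g.christoffelForm x u v k = g.christoffel k 0 0 x * u 0 * v 0 + g.christoffel k 0 1 x * u 0 * v 1
      + (g.christoffel k 0 1 x * u 1 * v 0 + g.christoffel k 1 1 x * u 1 * v 1) := by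
  simp [christoffelForm, Fin.sum_univ_two, g.christoffel_symm k 1 0]

lemma christoffelForm_comm (x u v : Plane) : g.christoffelForm x u v = g.christoffelForm x v u := by
  ext k
  simp only [christoffelForm_apply]
  ring

/-- The derivative of `christoffelForm x u v` in the point `x` in the direction `w`. -/
def christoffelFormDeriv (x w u v : Plane) : Plane :=
  WithLp.toLp 2 (fun k => ∑ i, ∑ j, fderiv ℝ (g.christoffel k i j) x w * u i * v j)

lemma hasDerivAt_christoffelForm {c U V : ℝ → Plane} {c' U' V' : Plane} {s : ℝ}
    (hc : HasDerivAt c c' s) (hU : HasDerivAt U U' s) (hV : HasDerivAt V V' s)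
    (hx : (g.gram (c s)).det ≠ 0) :
    HasDerivAt (fun t => g.christoffelForm (c t) (U t) (V t))
      (g.christoffelFormDeriv (c s) c' (U s) (V s) + g.christoffelForm (c s) U' (V s)
        + g.christoffelForm (c s) (U s) V') s := by
  rw [hasDerivAt_plane] at hU hV ⊢
  intro k
  have hΓ : ∀ i j, HasDerivAt (fun t => g.christoffel k i j (c t))
      (fderiv ℝ (g.christoffel k i j) (c s) c') s := fun i j =>
    ((g.contDiffAt_christoffel hx k i j).differentiableAt (by simp)).hasFDerivAt.comp_hasDerivAt s hc
  have : HasDerivAt (fun t => ∑ i, ∑ j, g.christoffel k i j (c t) * U t i * V t j)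
      (∑ i, ∑ j, ((fderiv ℝ (g.christoffel k i j) (c s) c' * U s i
        + g.christoffel k i j (c s) * U' i) * V s j
        + g.christoffel k i j (c s) * U s i * V' j)) s :=
    HasDerivAt.fun_sum fun i _ => HasDerivAt.fun_sum fun j _ =>
      ((hΓ i j).mul (hU i)).mul (hV j)
  have e : (g.christoffelFormDeriv (c s) c' (U s) (V s) + g.christoffelForm (c s) U' (V s)
        + g.christoffelForm (c s) (U s) V') k
      = ∑ i, ∑ j, ((fderiv ℝ (g.christoffel k i j) (c s) c' * U s i
        + g.christoffel k i j (c s) * U' i) * V s j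
        + g.christoffel k i j (c s) * U s i * V' j) := by
    simp [christoffelForm, christoffelFormDeriv, Fin.sum_univ_two]
    ring
  rw [e]
  exact this

/-- Metric compatibility along a curve. -/
lemma hasDerivAt_form {c U V : ℝ → Plane} {c' U' V' : Plane} {s : ℝ}
    (hc : HasDerivAt c c' s) (hU : HasDerivAt U U' s) (hV : HasDerivAt V V' s)
    (hx : (g.gram (c s)).det ≠ 0) :
    HasDerivAt (fun t => g.form (c t) (U t) (V t))
      (g.form (c s) (U' + g.christoffelForm (c s) c' (U s)) (V s)
        + g.form (c s) (U s) (V' + g.christoffelForm (c s) c' (V s))) s := by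
  rw [hasDerivAt_plane] at hU hV
  have hg : ∀ i j, HasDerivAt (fun t => g.gram (c t) i j)
      (fderiv ℝ (fun y => g.gram y i j) (c s) c') s := fun i j =>
    ((g.contDiff_gram i j).differentiable (by simp)).differentiableAt.hasFDerivAt.comp_hasDerivAt s hc
  have key := (((hg 0 0).fun_mul ((hU 0).fun_mul (hV 0))).fun_add
    ((hg 0 1).fun_mul ((hU 0).fun_mul (hV 1)))).fun_add
    ((hg 1 0).fun_mul ((hU 1).fun_mul (hV 0))) |>.fun_add
    ((hg 1 1).fun_mul ((hU 1).fun_mul (hV 1)))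
  have e : (fun t => g.form (c t) (U t) (V t)) = fun t => g.gram (c t) 0 0 * (U t 0 * V t 0)
      + g.gram (c t) 0 1 * (U t 0 * V t 1) + g.gram (c t) 1 0 * (U t 1 * V t 0)
      + g.gram (c t) 1 1 * (U t 1 * V t 1) := funext fun t => g.form_eq_gram _ _ _
  rw [e]
  refine key.congr_deriv ?_
  simp only [fderiv_apply_eq_pderiv, g.pderiv_gram hx, form_eq_gram, PiLp.add_apply,
    christoffelForm_apply, g.gram_symm (c s) 1 0, g.christoffel_symm _ 1 0]
  ring

lemma form_rot_self (x v : Plane) :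
    g.form x (g.rot x v) v = 0 := by
  rw [form_eq_gram]
  simp [rot]
  rw [g.gram_symm x 1 0]
  ring

lemma form_rot_rot {x : Plane} (hx : 0 < (g.gram x).det) (v : Plane) :
    g.form x (g.rot x v) (g.rot x v) = g.form x v v := by
  have h := Real.sq_sqrt hx.le
  have h0 : Real.sqrt (g.gram x).det ≠ 0 := (Real.sqrt_pos.mpr hx).ne'
  have h1 : ((Real.sqrt (g.gram x).det)⁻¹) ^ 2 * (g.gram x).det = 1 := by
    rw [inv_pow, h, inv_mul_cancel₀ hx.ne']
  rw [gram_det] at h1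
  rw [form_eq_gram, form_eq_gram]
  simp [rot]
  rw [gram_det] at *
  rw [g.gram_symm x 1 0] at *
  linear_combination (g.gram x 0 0 * (v 0 * v 0) + g.gram x 0 1 * (v 0 * v 1)
      + g.gram x 0 1 * (v 1 * v 0) + g.gram x 1 1 * (v 1 * v 1)) * h1

/-- The Gram determinant of two vectors. -/
lemma form_gram_det (x u v : Plane) :
    g.form x u u * g.form x v v - g.form x u v ^ 2
      = (g.gram x).det * (u 0 * v 1 - u 1 * v 0) ^ 2 := by
  simp only [form_eq_gram, gram_det, g.gram_symm x 1 0]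
  ring

/-- A vector is determined by its products with an orthonormal frame. -/
lemma eq_zero_of_form_eq_zero {x n v w : Plane} (hx : x ∈ disk) (hn : g.form x n n = 1)
    (hv : g.form x v v = 1) (hnv : g.form x n v = 0) (h1 : g.form x w n = 0)
    (h2 : g.form x w v = 0) : w = 0 := by
  have hd := g.form_gram_det x n v
  rw [hn, hv, hnv] at hd
  set D := n 0 * v 1 - n 1 * v 0 with hD
  have hD0 : D ≠ 0 := by
    rintro h
    rw [h] at hd
    norm_num at hd
  -- Cramer's rule; D ≠ 0 because the Gram determinant of the frame is 1.
  have e : w = ((w 0 * v 1 - w 1 * v 0) / D) • n + ((w 1 * n 0 - w 0 * n 1) / D) • v := by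
    apply plane_ext <;> simp <;> field_simp <;> rw [hD] <;> ring
  by_contra hw
  have := g.pos x hx w hw
  conv at this => rhs; arg 2; rw [e]
  simp [h1, h2] at this

/-- The Ricci identity for the curvature `R(n, v) v`. -/
lemma curvatureTensor_eq (x n v : Plane) :
    g.christoffelFormDeriv x n v v - g.christoffelFormDeriv x v v n
      + g.christoffelForm x n (g.christoffelForm x v v)
      - g.christoffelForm x v (g.christoffelForm x v n)
      = (n 0 * v 1 - n 1 * v 0) • (WithLp.toLp 2 fun k =>
          g.curvatureTensor k 0 1 0 x * v 0 + g.curvatureTensor k 0 1 1 x * v 1 : Plane) := by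
  have e : ∀ k, g.christoffel k 1 0 = g.christoffel k 0 1 :=
    fun k => funext fun y => g.christoffel_symm k 1 0 y
  ext k
  simp only [PiLp.add_apply, PiLp.sub_apply, christoffelForm_apply, christoffelFormDeriv,
    Fin.sum_univ_two, fderiv_apply_eq_pderiv, curvatureTensor, PiLp.smul_apply, smul_eq_mul, e]
  ring

/-- The bracket is R(n, v)v. It contributes the factor n₀v₁ - n₁v₀ twice, and for an orthonormal
pair the square of this factor is 1 / det g. -/
lemma form_curvature_eq_gaussCurvature {x n v : Plane} (hx : (g.gram x).det ≠ 0)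
    (hn : g.form x n n = 1) (hv : g.form x v v = 1) (hnv : g.form x n v = 0) :
    g.form x (g.christoffelFormDeriv x n v v - g.christoffelFormDeriv x v v n
      + g.christoffelForm x n (g.christoffelForm x v v)
      - g.christoffelForm x v (g.christoffelForm x v n)) n = g.gaussCurvature x := by
  have hd := g.form_gram_det x n v
  rw [hn, hv, hnv] at hd
  have hR := g.form_curvatureTensor hx v n
  rw [curvatureTensor_eq, form_eq_gram]
  simp only [PiLp.smul_apply, smul_eq_mul]
  rw [g.gram_symm x 1 0] at *
  linear_combination (n 0 * v 1 - n 1 * v 0) * hR - g.gaussCurvature x * hd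

/-- The normal part of the linearized geodesic equation. -/
lemma form_jacobi {x n v : Plane} (hx : (g.gram x).det ≠ 0)
    (hn : g.form x n n = 1) (hv : g.form x v v = 1) (hnv : g.form x n v = 0) (a a' a'' : ℝ) :
    g.form x (a'' • n - (2 * a') • g.christoffelForm x v n
        - a • (g.christoffelFormDeriv x v v n - g.christoffelForm x (g.christoffelForm x v v) n
          - g.christoffelForm x v (g.christoffelForm x v n))
        + (g.christoffelFormDeriv x (a • n) v v
          + g.christoffelForm x (a' • n - a • g.christoffelForm x v n) v
          + g.christoffelForm x v (a' • n - a • g.christoffelForm x v n))) n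
      = a'' + g.gaussCurvature x * a := by
  -- The terms in a' cancel, and the coefficient of a collects to R(n, v)v.
  have e : a'' • n - (2 * a') • g.christoffelForm x v n
        - a • (g.christoffelFormDeriv x v v n - g.christoffelForm x (g.christoffelForm x v v) n
          - g.christoffelForm x v (g.christoffelForm x v n))
        + (g.christoffelFormDeriv x (a • n) v v
          + g.christoffelForm x (a' • n - a • g.christoffelForm x v n) v
          + g.christoffelForm x v (a' • n - a • g.christoffelForm x v n))
      = a'' • n + a • (g.christoffelFormDeriv x n v v - g.christoffelFormDeriv x v v n
      + g.christoffelForm x n (g.christoffelForm x v v)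
      - g.christoffelForm x v (g.christoffelForm x v n)) := by
    ext k
    simp only [PiLp.add_apply, PiLp.sub_apply, PiLp.smul_apply, smul_eq_mul, christoffelForm_apply,
      christoffelFormDeriv, map_smul]
    simp only [Fin.sum_univ_two]
    ring
  rw [e]
  simp only [map_add, map_smul, add_apply, smul_apply,
    smul_eq_mul]
  rw [g.form_curvature_eq_gaussCurvature hx hn hv hnv, hn]
  ring

lemma rot_rot {x : Plane} (hx : 0 < (g.gram x).det) (v : Plane) : g.rot x (g.rot x v) = -v := by
  have h1 : ((Real.sqrt (g.gram x).det)⁻¹) ^ 2 * (g.gram x).det = 1 := by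
    rw [inv_pow, Real.sq_sqrt hx.le, inv_mul_cancel₀ hx.ne']
  apply plane_ext
  · simp [rot]
    rw [gram_det] at *
    rw [g.gram_symm x 1 0] at *
    linear_combination (-v 0) * h1
  · simp [rot]
    rw [gram_det] at *
    rw [g.gram_symm x 1 0] at *
    linear_combination (-v 1) * h1

lemma rot_smul (x : Plane) (a : ℝ) (v : Plane) : g.rot x (a • v) = a • g.rot x v := by
  apply plane_ext <;> simp [rot] <;> ring

lemma circleTangent_ne_zero {p : Plane} (hp : p ∈ circle) : circleTangent p ≠ 0 := by
  intro h
  have h0 : p 1 = 0 := by simpa [circleTangent] using congrArg (fun v : Plane => v 0) h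
  have h1 : p 0 = 0 := by simpa [circleTangent] using congrArg (fun v : Plane => v 1) h
  have : p = 0 := plane_ext h1 h0
  rw [this] at hp
  simp [circle] at hp

lemma circle_subset_disk {p : Plane} (hp : p ∈ circle) : p ∈ disk :=
  Metric.sphere_subset_closedBall hp

lemma norm_circleTangent_pos {p : Plane} (hp : p ∈ circle) : 0 < g.norm p (circleTangent p) :=
  Real.sqrt_pos.mpr (g.pos p (circle_subset_disk hp) _ (circleTangent_ne_zero hp))

lemma norm_circleTangent_sq {p : Plane} (hp : p ∈ circle) :
    g.norm p (circleTangent p) ^ 2 = g.form p (circleTangent p) (circleTangent p) :=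
  Real.sq_sqrt (g.pos p (circle_subset_disk hp) _ (circleTangent_ne_zero hp)).le

lemma form_inwardNormal_circleTangent (p : Plane) :
    g.form p (g.inwardNormal p) (circleTangent p) = 0 := by
  simp [inwardNormal, form_rot_self]

lemma form_inwardNormal_self {p : Plane} (hp : p ∈ circle) :
    g.form p (g.inwardNormal p) (g.inwardNormal p) = 1 := by
  simp only [inwardNormal, map_smul, smul_apply, smul_eq_mul,
    g.form_rot_rot (g.gram_det_pos (circle_subset_disk hp)), ← g.norm_circleTangent_sq hp]
  field_simp [(g.norm_circleTangent_pos hp).ne']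

/-- A unit vector normal to the circle is the inward or the outward normal, which is decided by its
Euclidean product with the position vector. -/
lemma exists_eq_smul_inwardNormal {p v : Plane} (hp : p ∈ circle) (hv : g.form p v v = 1)
    (hT : g.form p v (circleTangent p) = 0) :
    ∃ σ c : ℝ, σ ^ 2 = 1 ∧ 0 < c ∧ v = σ • g.inwardNormal p ∧
      -g.rot p v = (σ / g.norm p (circleTangent p)) • circleTangent p ∧
      inner ℝ p v = -(σ * c) := by
  have hT0 := g.norm_circleTangent_pos hp
  have hdet := g.gram_det_pos (circle_subset_disk hp)
  set N := g.norm p (circleTangent p) with hN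
  set n := g.inwardNormal p with hn
  have hnn : g.form p n n = 1 := g.form_inwardNormal_self hp
  have hnT : g.form p n (circleTangent p) = 0 := g.form_inwardNormal_circleTangent p
  have hTT : g.form p (N⁻¹ • circleTangent p) (N⁻¹ • circleTangent p) = 1 := by
    simp only [map_smul, smul_apply, smul_eq_mul, ← g.norm_circleTangent_sq hp, ← hN]
    field_simp
  have hv' : v = g.form p v n • n := by
    rw [← sub_eq_zero]
    refine g.eq_zero_of_form_eq_zero (circle_subset_disk hp) hnn hTT ?_ ?_ ?_
    · simp [hnT]
    · simp [hnn]
    · simp [hnT, hT]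
  obtain ⟨σ, hσ⟩ : ∃ σ : ℝ, v = σ • n := ⟨_, hv'⟩
  have hTp := g.pos p (circle_subset_disk hp) _ (circleTangent_ne_zero hp)
  have hdet' := Real.sqrt_pos.mpr hdet
  -- With T the tangent of the circle at p, the Euclidean product of p with `g.rot p T` is -g(T,
  -- T)/√det g. Divided by N = |T|, this is -c.
  refine ⟨σ, (N⁻¹ * (Real.sqrt (g.gram p).det)⁻¹)
    * g.form p (circleTangent p) (circleTangent p), ?_, by positivity, hσ, ?_, ?_⟩
  · rw [hσ] at hv
    simpa [hnn, sq] using hv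
  · rw [hσ, hn, inwardNormal, rot_smul, rot_smul, g.rot_rot hdet, ← hN]
    module
  · have hn' : n = N⁻¹ • g.rot p (circleTangent p) := rfl
    rw [hσ, hn', EuclideanSpace.inner_eq_star_dotProduct, form_eq_gram]
    simp [rot, circleTangent, dotProduct, Fin.sum_univ_two]
    ring

/-- At θ = 0 the rotating parametrization has velocity T and second derivative -p. The tangential
part removed in `curvatureVector` is invisible to the normal, and multiplying by g(T, T) clears the
denominator. -/
lemma boundaryCurvature_eq {p : Plane} (hp : p ∈ circle) :
    g.boundaryCurvature p * g.form p (circleTangent p) (circleTangent p)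
      = g.form p (-p + g.christoffelForm p (circleTangent p) (circleTangent p))
          (g.inwardNormal p) := by
  have hT := (g.pos p (circle_subset_disk hp) _ (circleTangent_ne_zero hp)).ne'
  have hd : ∀ θ : ℝ, HasDerivAt (fun θ => Real.cos θ • p + Real.sin θ • circleTangent p)
      (-Real.sin θ • p + Real.cos θ • circleTangent p) θ := fun θ =>
    ((Real.hasDerivAt_cos θ).smul_const p).add ((Real.hasDerivAt_sin θ).smul_const _)
  have hd1 : deriv (fun θ => Real.cos θ • p + Real.sin θ • circleTangent p)
      = fun θ => -Real.sin θ • p + Real.cos θ • circleTangent p := funext fun θ => (hd θ).deriv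
  have hd2 : HasDerivAt (fun θ => -Real.sin θ • p + Real.cos θ • circleTangent p)
      (-Real.cos 0 • p + -Real.sin 0 • circleTangent p) 0 :=
    ((Real.hasDerivAt_sin 0).neg.smul_const p).add ((Real.hasDerivAt_cos 0).smul_const _)
  have hnT : g.form p (circleTangent p) (g.inwardNormal p) = 0 := by
    rw [g.symm, form_inwardNormal_circleTangent]
  unfold boundaryCurvature curvatureVector
  rw [acceleration_eq, hd1, hd2.deriv]
  simp [hnT]
  field_simp

/-! ### The normal field of the geodesic: Jacobi operator and Robin condition -/

section Curve

variable {g} {γ : ℝ → Plane} {L : ℝ}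

lemma IsFreeBoundaryGeodesic.mem_disk (h : g.IsFreeBoundaryGeodesic γ L) {s : ℝ}
    (hs : s ∈ Icc 0 L) : γ s ∈ disk := by
  rcases eq_or_lt_of_le hs.1 with h0 | h0
  · rw [← h0]
    exact Metric.sphere_subset_closedBall h.start_mem
  rcases eq_or_lt_of_le hs.2 with h1 | h1
  · rw [h1]
    exact Metric.sphere_subset_closedBall h.end_mem
  · exact Metric.ball_subset_closedBall (h.interior s ⟨h0, h1⟩)

lemma IsFreeBoundaryGeodesic.det_pos (h : g.IsFreeBoundaryGeodesic γ L) {s : ℝ}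
    (hs : s ∈ Icc 0 L) : 0 < (g.gram (γ s)).det := g.gram_det_pos (h.mem_disk hs)

lemma IsFreeBoundaryGeodesic.form_unitNormal_self (h : g.IsFreeBoundaryGeodesic γ L) {s : ℝ}
    (hs : s ∈ Icc 0 L) : g.form (γ s) (g.unitNormal γ s) (g.unitNormal γ s) = 1 := by
  simp [unitNormal, g.form_rot_rot (h.det_pos hs), h.unit_speed s hs]

lemma form_unitNormal_deriv (γ : ℝ → Plane) (s : ℝ) :
    g.form (γ s) (g.unitNormal γ s) (deriv γ s) = 0 := by
  simp [unitNormal, g.form_rot_self]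

lemma contDiffAt_unitNormal (hγ : ContDiff ℝ ∞ γ) {s : ℝ} (hs : 0 < (g.gram (γ s)).det) :
    ContDiffAt ℝ ∞ (g.unitNormal γ) s := by
  have hd : ContDiff ℝ ∞ (deriv γ) := contDiff_deriv hγ
  have hdi : ∀ i, ContDiffAt ℝ ∞ (fun t => deriv γ t i) s :=
    fun i => (contDiff_euclidean.mp hd i).contDiffAt
  have hg : ∀ i j, ContDiffAt ℝ ∞ (fun t => g.gram (γ t) i j) s :=
    fun i j => ((g.contDiff_gram i j).comp hγ).contDiffAt
  have hdet : ContDiffAt ℝ ∞ (fun t => (g.gram (γ t)).det) s :=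
    (g.contDiff_gram_det.comp hγ).contDiffAt
  unfold unitNormal rot
  refine ContDiffAt.neg (ContDiffAt.smul ((hdet.sqrt hs.ne').inv (Real.sqrt_pos.mpr hs).ne') ?_)
  rw [contDiffAt_euclidean]
  intro i
  fin_cases i <;> simp
  · exact (((hg 1 1).mul (hdi 1)).neg).add ((hg 1 0).mul (hdi 0)).neg
  · exact ((hg 0 0).mul (hdi 0)).add ((hg 0 1).mul (hdi 1))

lemma hasDerivAt_of_contDiff {E : Type*} [NormedAddCommGroup E] [NormedSpace ℝ E] {f : ℝ → E}
    (h : ContDiff ℝ ∞ f) (s : ℝ) : HasDerivAt f (deriv f s) s :=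
  (h.differentiable (by simp)).differentiableAt.hasDerivAt

lemma deriv_deriv_geodesic (h : g.IsFreeBoundaryGeodesic γ L) {s : ℝ} (hs : s ∈ Icc 0 L) :
    deriv (deriv γ) s = -g.christoffelForm (γ s) (deriv γ s) (deriv γ s) :=
  eq_neg_of_add_eq_zero_left (h.geodesic s hs)

/-- The unit normal of a geodesic is parallel. -/
lemma hasDerivAt_unitNormal (h : g.IsFreeBoundaryGeodesic γ L) (hγ : ContDiff ℝ ∞ γ) {s : ℝ}
    (hs : s ∈ Icc 0 L) :
    HasDerivAt (g.unitNormal γ) (-g.christoffelForm (γ s) (deriv γ s) (g.unitNormal γ s)) s := by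
  have hdet := (h.det_pos hs).ne'
  have hν : HasDerivAt (g.unitNormal γ) (deriv (g.unitNormal γ) s) s :=
    ((contDiffAt_unitNormal hγ (h.det_pos hs)).differentiableAt (by simp)).hasDerivAt
  have hd : HasDerivAt (deriv γ) (deriv (deriv γ) s) s :=
    hasDerivAt_of_contDiff (contDiff_deriv hγ) s
  have hc := hasDerivAt_of_contDiff hγ s
  -- Differentiating g(ν, ν) = 1 and g(ν, γ') = 0 shows that the covariant derivative of ν is
  -- orthogonal to both vectors of the frame, the second because γ' is parallel.
  have h1 := HasDerivAt.eq_of_eqOn_Icc h.length_pos hs (g.hasDerivAt_form hc hν hν hdet)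
    (hasDerivAt_const s 1) fun t ht => h.form_unitNormal_self ht
  have h2 := HasDerivAt.eq_of_eqOn_Icc h.length_pos hs (g.hasDerivAt_form hc hν hd hdet)
    (hasDerivAt_const s 0) fun t ht => form_unitNormal_deriv γ t
  rw [deriv_deriv_geodesic h hs, neg_add_cancel, map_zero, add_zero] at h2
  rw [g.symm (γ s) (g.unitNormal γ s)] at h1
  have h3 : deriv (g.unitNormal γ) s + g.christoffelForm (γ s) (deriv γ s) (g.unitNormal γ s) = 0 :=
    g.eq_zero_of_form_eq_zero (h.mem_disk hs) (h.form_unitNormal_self hs) (h.unit_speed s hs)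
      (form_unitNormal_deriv γ s) (by linarith) h2
  rwa [← eq_neg_of_add_eq_zero_left h3]

variable {φ : ℝ → ℝ} {X : ℝ → Plane}

/-- As ν is parallel, the covariant derivative of φν is φ'ν. The field X is smooth on the whole line
but is required to equal φν only on [0, L]. -/
lemma deriv_normal_field (h : g.IsFreeBoundaryGeodesic γ L) (hγ : ContDiff ℝ ∞ γ)
    (hφ : ContDiff ℝ ∞ φ) (hX : ContDiff ℝ ∞ X)
    (e : ∀ s ∈ Icc 0 L, X s = φ s • g.unitNormal γ s) {s : ℝ} (hs : s ∈ Icc 0 L) :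
    deriv X s = deriv φ s • g.unitNormal γ s
      - φ s • g.christoffelForm (γ s) (deriv γ s) (g.unitNormal γ s) := by
  have := HasDerivAt.eq_of_eqOn_Icc h.length_pos hs (hasDerivAt_of_contDiff hX s)
    ((hasDerivAt_of_contDiff hφ s).smul (hasDerivAt_unitNormal h hγ hs)) e
  rw [this, smul_neg, neg_add_eq_sub]

lemma deriv_deriv_normal_field (h : g.IsFreeBoundaryGeodesic γ L) (hγ : ContDiff ℝ ∞ γ)
    (hφ : ContDiff ℝ ∞ φ) (hX : ContDiff ℝ ∞ X)
    (e : ∀ s ∈ Icc 0 L, X s = φ s • g.unitNormal γ s) {s : ℝ} (hs : s ∈ Icc 0 L) :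
    deriv (deriv X) s = deriv (deriv φ) s • g.unitNormal γ s
      - (2 * deriv φ s) • g.christoffelForm (γ s) (deriv γ s) (g.unitNormal γ s)
      - φ s • (g.christoffelFormDeriv (γ s) (deriv γ s) (deriv γ s) (g.unitNormal γ s)
        - g.christoffelForm (γ s) (g.christoffelForm (γ s) (deriv γ s) (deriv γ s))
            (g.unitNormal γ s)
        - g.christoffelForm (γ s) (deriv γ s)
            (g.christoffelForm (γ s) (deriv γ s) (g.unitNormal γ s))) := by
  have hν := hasDerivAt_unitNormal h hγ hs
  have hd : HasDerivAt (deriv γ) (deriv (deriv γ) s) s :=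
    hasDerivAt_of_contDiff (contDiff_deriv hγ) s
  have hφ' : HasDerivAt (deriv φ) (deriv (deriv φ) s) s :=
    hasDerivAt_of_contDiff (contDiff_deriv hφ) s
  have hΓ := g.hasDerivAt_christoffelForm (hasDerivAt_of_contDiff hγ s) hd hν (h.det_pos hs).ne'
  have := HasDerivAt.eq_of_eqOn_Icc h.length_pos hs
    (hasDerivAt_of_contDiff (contDiff_deriv hX) s)
    ((hφ'.fun_smul hν).fun_sub ((hasDerivAt_of_contDiff hφ s).fun_smul hΓ))
    fun t ht => deriv_normal_field h hγ hφ hX e ht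
  rw [this, deriv_deriv_geodesic h hs]
  ext k
  simp only [PiLp.add_apply, PiLp.sub_apply, PiLp.smul_apply, smul_eq_mul, christoffelForm_apply,
      PiLp.neg_apply]
  ring

/-- The linearization of the geodesic equation along `X = φ ν` has normal part `φ'' + K φ`. -/
lemma form_linearized_acceleration (h : g.IsFreeBoundaryGeodesic γ L) (hγ : ContDiff ℝ ∞ γ)
    (hφ : ContDiff ℝ ∞ φ) (hX : ContDiff ℝ ∞ X)
    (e : ∀ s ∈ Icc 0 L, X s = φ s • g.unitNormal γ s) {s : ℝ} (hs : s ∈ Icc 0 L) :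
    g.form (γ s) (deriv (deriv X) s + (g.christoffelFormDeriv (γ s) (X s) (deriv γ s) (deriv γ s)
      + g.christoffelForm (γ s) (deriv X s) (deriv γ s)
      + g.christoffelForm (γ s) (deriv γ s) (deriv X s))) (g.unitNormal γ s)
      = deriv (deriv φ) s + g.gaussCurvature (γ s) * φ s := by
  rw [deriv_deriv_normal_field h hγ hφ hX e hs, deriv_normal_field h hγ hφ hX e hs, e s hs]
  exact g.form_jacobi (h.det_pos hs).ne' (h.form_unitNormal_self hs) (h.unit_speed s hs)
    (form_unitNormal_deriv γ s) _ _ _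

/-- Linearized orthogonality to the boundary circle is the Robin condition. -/
lemma hasDerivAt_form_circleTangent (h : g.IsFreeBoundaryGeodesic γ L) (hγ : ContDiff ℝ ∞ γ)
    (hφ : ContDiff ℝ ∞ φ) (hX : ContDiff ℝ ∞ X)
    (e : ∀ s ∈ Icc 0 L, X s = φ s • g.unitNormal γ s) {s σ θ : ℝ} (hs : s ∈ Icc 0 L)
    (hp : γ s ∈ circle) (hn : deriv γ s = σ • g.inwardNormal (γ s))
    (hν : g.unitNormal γ s = (σ / g.norm (γ s) (circleTangent (γ s))) • circleTangent (γ s))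
    (hθ : θ = φ s * (σ / g.norm (γ s) (circleTangent (γ s))))
    (hR : deriv φ s + σ * g.boundaryCurvature (γ s) * φ s = 0) :
    HasDerivAt (fun t => g.form (Real.cos (θ * t) • γ s + Real.sin (θ * t) • circleTangent (γ s))
      (deriv γ s + t • deriv X s)
      (Real.cos (θ * t) • circleTangent (γ s) - Real.sin (θ * t) • γ s)) 0 0 := by
  set p := γ s with hpdef
  set T := circleTangent p with hT
  set N := g.norm p T with hN
  have hN0 : 0 < N := g.norm_circleTangent_pos hp
  have hNT : N ^ 2 = g.form p T T := g.norm_circleTangent_sq hp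
  have hlin : HasDerivAt (fun t : ℝ => θ * t) θ 0 := by simpa using (hasDerivAt_id (0 : ℝ)).const_mul θ
  have hcos : HasDerivAt (fun t => Real.cos (θ * t)) 0 0 := by simpa using hlin.cos
  have hsin : HasDerivAt (fun t => Real.sin (θ * t)) θ 0 := by simpa using hlin.sin
  have hP : HasDerivAt (fun t => Real.cos (θ * t) • p + Real.sin (θ * t) • T) (θ • T) 0 := by
    simpa using (hcos.smul_const p).fun_add (hsin.smul_const T)
  have hU : HasDerivAt (fun t => Real.cos (θ * t) • T - Real.sin (θ * t) • p) (-(θ • p)) 0 := by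
    simpa using (hcos.smul_const T).fun_sub (hsin.smul_const p)
  have hV : HasDerivAt (fun t : ℝ => deriv γ s + t • deriv X s) (deriv X s) 0 := by
    simpa using ((hasDerivAt_id (0 : ℝ)).smul_const (deriv X s)).const_add (deriv γ s)
  have key := g.hasDerivAt_form hP hV hU (by simpa using (h.det_pos hs).ne')
  refine key.congr_deriv ?_
  simp only [mul_zero, Real.cos_zero, Real.sin_zero, one_smul, zero_smul, add_zero, sub_zero]
  -- The angle θt moves p along the circle with initial velocity φν. The covariant derivative of the
  -- leaf's velocity is then φ'ν, a multiple of T, and that of the rotating tangent is θ∇_T T, whose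
  -- normal part is κ. The two contributions add up to σN(φ' + σκφ) = 0.
  have hθT : θ • T = φ s • g.unitNormal γ s := by rw [hθ, hν, smul_smul]
  have e1 : deriv X s + g.christoffelForm p (θ • T) (deriv γ s)
      = (deriv φ s * (σ / N)) • T := by
    rw [deriv_normal_field h hγ hφ hX e hs, ← hpdef, hθT, g.christoffelForm_comm p (φ s • _),
      mul_smul, ← hν]
    ext k
    simp only [PiLp.add_apply, PiLp.sub_apply, PiLp.smul_apply, smul_eq_mul, christoffelForm_apply]
    ring
  have e2 : -(θ • p) + g.christoffelForm p (θ • T) T = θ • (-p + g.christoffelForm p T T) := by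
    ext k
    simp only [PiLp.add_apply, PiLp.neg_apply, PiLp.smul_apply, smul_eq_mul, christoffelForm_apply]
    ring
  have hκ := g.boundaryCurvature_eq hp
  rw [e1, e2, hn, g.symm p (σ • g.inwardNormal p)]
  simp only [map_smul, smul_apply, smul_eq_mul]
  rw [← hκ, ← hT, ← hNT, hθ]
  field_simp
  linear_combination σ * N * hR

end Curve

end DiskMetric

/-! ### Linear second order equations on an interval -/

/-- The growth of a planar system `|y'| ≤ |z|`, `|z'| ≤ Q |y|`. -/
lemma energy_le {a b t₀ Q : ℝ} {y z y' z' : ℝ → ℝ} (ht₀ : t₀ ∈ Ioo a b) (hQ : 0 ≤ Q)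
    (hy : ∀ t ∈ Ioo a b, HasDerivAt y (y' t) t) (hz : ∀ t ∈ Ioo a b, HasDerivAt z (z' t) t)
    (hy' : ∀ t ∈ Ioo a b, |y' t| ≤ |z t|) (hz' : ∀ t ∈ Ioo a b, |z' t| ≤ Q * |y t|)
    {t : ℝ} (ht : t ∈ Ioo a b) :
    y t ^ 2 + z t ^ 2 ≤ (y t₀ ^ 2 + z t₀ ^ 2) * Real.exp ((1 + Q) * |t - t₀|) := by
  have hE : ∀ s ∈ Ioo a b, HasDerivAt (fun t => y t ^ 2 + z t ^ 2)
      (2 * y s * y' s + 2 * z s * z' s) s := fun s hs => by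
    simpa using ((hy s hs).fun_pow 2).fun_add ((hz s hs).fun_pow 2)
  -- The energy E = y² + z² satisfies |E'| ≤ (1 + Q)E, so E times a decaying exponential decreases
  -- to the right of t₀, and E times a growing one increases to its left.
  have hB : ∀ s ∈ Ioo a b, |2 * y s * y' s + 2 * z s * z' s| ≤ (1 + Q) * (y s ^ 2 + z s ^ 2) := by
    intro s hs
    calc |2 * y s * y' s + 2 * z s * z' s| ≤ |2 * y s * y' s| + |2 * z s * z' s| := abs_add_le _ _
      _ = 2 * |y s| * |y' s| + 2 * |z s| * |z' s| := by simp [abs_mul]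
      _ ≤ 2 * |y s| * |z s| + 2 * |z s| * (Q * |y s|) := by
          have h1 := mul_le_mul_of_nonneg_left (hy' s hs) (show 0 ≤ 2 * |y s| by positivity)
          have h2 := mul_le_mul_of_nonneg_left (hz' s hs) (show 0 ≤ 2 * |z s| by positivity)
          exact add_le_add h1 h2
      _ = (1 + Q) * (2 * |y s| * |z s|) := by ring
      _ ≤ (1 + Q) * (y s ^ 2 + z s ^ 2) := by
          gcongr
          rw [← sq_abs (y s), ← sq_abs (z s)]
          exact two_mul_le_add_sq _ _
  have hexp : ∀ c s : ℝ, HasDerivAt (fun t => Real.exp (c * (t - t₀)))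
      (Real.exp (c * (s - t₀)) * c) s := fun c s => by
    simpa using (((hasDerivAt_id s).sub_const t₀).const_mul c).exp
  rcases le_total t₀ t with h | h
  · rw [abs_of_nonneg (sub_nonneg.mpr h)]
    have hsub : Icc t₀ t ⊆ Ioo a b := fun s hs => ⟨ht₀.1.trans_le hs.1, hs.2.trans_lt ht.2⟩
    have hd : ∀ s ∈ Icc t₀ t, HasDerivAt
        (fun t => (y t ^ 2 + z t ^ 2) * Real.exp (-(1 + Q) * (t - t₀))) _ s :=
      fun s hs => (hE s (hsub hs)).fun_mul (hexp (-(1 + Q)) s)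
    have hanti : AntitoneOn (fun t => (y t ^ 2 + z t ^ 2) * Real.exp (-(1 + Q) * (t - t₀)))
        (Icc t₀ t) := by
      refine antitoneOn_of_deriv_nonpos (convex_Icc _ _)
        (fun s hs => (hd s hs).continuousAt.continuousWithinAt)
        (fun s hs => (hd s (interior_subset hs)).differentiableAt.differentiableWithinAt)
        fun s hs => ?_
      rw [(hd s (interior_subset hs)).deriv]
      have := (abs_le.mp (hB s (hsub (interior_subset hs)))).2
      have he := Real.exp_pos (-(1 + Q) * (s - t₀))
      nlinarith
    have := hanti (left_mem_Icc.mpr h) (right_mem_Icc.mpr h) h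
    simp only [sub_self, mul_zero, Real.exp_zero, mul_one] at this
    calc y t ^ 2 + z t ^ 2 = (y t ^ 2 + z t ^ 2) * Real.exp (-(1 + Q) * (t - t₀))
          * Real.exp ((1 + Q) * (t - t₀)) := by
          rw [mul_assoc, ← Real.exp_add,
            show -(1 + Q) * (t - t₀) + (1 + Q) * (t - t₀) = 0 by ring, Real.exp_zero, mul_one]
      _ ≤ _ := by gcongr
  · rw [abs_of_nonpos (sub_nonpos.mpr h)]
    have hsub : Icc t t₀ ⊆ Ioo a b := fun s hs => ⟨ht.1.trans_le hs.1, hs.2.trans_lt ht₀.2⟩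
    have hd : ∀ s ∈ Icc t t₀, HasDerivAt
        (fun t => (y t ^ 2 + z t ^ 2) * Real.exp ((1 + Q) * (t - t₀))) _ s :=
      fun s hs => (hE s (hsub hs)).fun_mul (hexp (1 + Q) s)
    have hmono : MonotoneOn (fun t => (y t ^ 2 + z t ^ 2) * Real.exp ((1 + Q) * (t - t₀)))
        (Icc t t₀) := by
      refine monotoneOn_of_deriv_nonneg (convex_Icc _ _)
        (fun s hs => (hd s hs).continuousAt.continuousWithinAt)
        (fun s hs => (hd s (interior_subset hs)).differentiableAt.differentiableWithinAt)
        fun s hs => ?_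
      rw [(hd s (interior_subset hs)).deriv]
      have := (abs_le.mp (hB s (hsub (interior_subset hs)))).1
      have he := Real.exp_pos ((1 + Q) * (s - t₀))
      nlinarith
    have := hmono (left_mem_Icc.mpr h) (right_mem_Icc.mpr h) h
    simp only [sub_self, mul_zero, Real.exp_zero, mul_one] at this
    calc y t ^ 2 + z t ^ 2 = (y t ^ 2 + z t ^ 2) * Real.exp ((1 + Q) * (t - t₀))
          * Real.exp ((1 + Q) * -(t - t₀)) := by
          rw [mul_assoc, ← Real.exp_add,
            show (1 + Q) * (t - t₀) + (1 + Q) * -(t - t₀) = 0 by ring, Real.exp_zero, mul_one]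
      _ ≤ _ := by gcongr

/-- Global existence for the linear equation `y'' = -q y`. -/
lemma exists_linear_ode_solution {a b t₀ : ℝ} (ht₀ : t₀ ∈ Ioo a b) {q : ℝ → ℝ}
    (hq : Continuous q) (y₀ z₀ : ℝ) :
    ∃ y z : ℝ → ℝ, y t₀ = y₀ ∧ z t₀ = z₀ ∧
      ∀ t ∈ Ioo a b, HasDerivAt y (z t) t ∧ HasDerivAt z (-q t * y t) t := by
  obtain ⟨Q, hQ⟩ : ∃ Q, ∀ t ∈ Icc a b, |q t| ≤ Q :=
    isCompact_Icc.exists_bound_of_continuousOn hq.continuousOn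
  have hQ0 : 0 ≤ Q := (abs_nonneg _).trans (hQ t₀ (Ioo_subset_Icc_self ht₀))
  -- Truncating both coordinates at height R makes the field bounded and Lipschitz, so
  -- Picard-Lindelöf applies on all of [a, b] at once. Truncation does not increase absolute values,
  -- so the energy estimate holds for the truncated system. It keeps the solution below R, where
  -- nothing was truncated.
  set R : ℝ := Real.sqrt ((y₀ ^ 2 + z₀ ^ 2) * Real.exp ((1 + Q) * (b - a))) + 1 with hR
  have hR0 : 0 < R := by positivity
  have hRR : -R ≤ R := by linarith
  let cl : ℝ → ℝ := fun x => projIcc (-R) R hRR x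
  have hcl_lip : ∀ x x', |cl x - cl x'| ≤ |x - x'| := fun x x' => abs_projIcc_sub_projIcc hRR
  have hcl_bd : ∀ x, |cl x| ≤ R := fun x => abs_le.mpr (projIcc (-R) R hRR x).2
  have hcl_zero : cl 0 = 0 := by
    simp only [cl]
    rw [projIcc_of_mem hRR (show (0 : ℝ) ∈ Icc (-R) R from ⟨by linarith, hR0.le⟩)]
  have hcl_abs : ∀ x, |cl x| ≤ |x| := fun x => by simpa [hcl_zero] using hcl_lip x 0
  have hcl_eq : ∀ x, |x| ≤ R → cl x = x := fun x hx => by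
    simp only [cl]
    rw [projIcc_of_mem hRR (abs_le.mp hx)]
  let f : ℝ → ℝ × ℝ → ℝ × ℝ := fun t x => (cl x.2, -q t * cl x.1)
  have hfcont : ∀ x, Continuous fun t => f t x := fun x => by fun_prop
  have hf : IsPicardLindelof f (tmin := a) (tmax := b) ⟨t₀, Ioo_subset_Icc_self ht₀⟩ (y₀, z₀)
      (Real.toNNReal ((1 + Q) * R * (b - a))) 0 (Real.toNNReal ((1 + Q) * R))
      (Real.toNNReal (1 + Q)) := by
    have hab : a < b := ht₀.1.trans ht₀.2
    refine ⟨fun t ht => ?_, fun x _ => (hfcont x).continuousOn, fun t ht x _ => ?_, ?_⟩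
    · refine LipschitzWith.lipschitzOnWith (LipschitzWith.of_dist_le_mul fun x x' => ?_)
      rw [Real.coe_toNNReal _ (by positivity), Prod.dist_eq, Prod.dist_eq]
      simp only [f, Real.dist_eq]
      have h1 := hcl_lip x.1 x'.1
      have h2 := hcl_lip x.2 x'.2
      have h3 : |-q t * cl x.1 - -q t * cl x'.1| ≤ Q * |x.1 - x'.1| := by
        rw [← mul_sub, abs_mul, abs_neg]
        exact mul_le_mul (hQ t ht) h1 (abs_nonneg _) hQ0
      set m := max |x.1 - x'.1| |x.2 - x'.2| with hm
      have hm1 : |x.1 - x'.1| ≤ m := le_max_left _ _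
      have hm2 : |x.2 - x'.2| ≤ m := le_max_right _ _
      have hm0 : 0 ≤ m := (abs_nonneg _).trans hm1
      refine max_le ?_ ?_ <;> nlinarith
    · rw [Real.coe_toNNReal _ (by positivity), Prod.norm_def]
      simp only [f, Real.norm_eq_abs, abs_mul, abs_neg]
      have h3 : |q t| * |cl x.1| ≤ Q * R := mul_le_mul (hQ t ht) (hcl_bd _) (abs_nonneg _) hQ0
      refine max_le ((hcl_bd _).trans ?_) ?_ <;> nlinarith
    · rw [Real.coe_toNNReal _ (by positivity),
        Real.coe_toNNReal _ (mul_nonneg (by positivity) (by linarith))]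
      simp only [NNReal.coe_zero, sub_zero]
      have := ht₀.1
      have := ht₀.2
      gcongr
      exact max_le (by linarith) (by linarith)
  obtain ⟨α, hα0, hα⟩ := hf.exists_eq_forall_mem_Icc_hasDerivWithinAt₀
  have hα' : ∀ t ∈ Ioo a b, HasDerivAt α (f t (α t)) t := fun t ht =>
    (hα t (Ioo_subset_Icc_self ht)).hasDerivAt (Icc_mem_nhds ht.1 ht.2)
  have hy : ∀ t ∈ Ioo a b, HasDerivAt (fun t => (α t).1) (cl (α t).2) t := fun t ht =>
    (hasFDerivAt_fst (𝕜 := ℝ) (p := α t)).comp_hasDerivAt t (hα' t ht)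
  have hz : ∀ t ∈ Ioo a b, HasDerivAt (fun t => (α t).2) (-q t * cl (α t).1) t := fun t ht =>
    (hasFDerivAt_snd (𝕜 := ℝ) (p := α t)).comp_hasDerivAt t (hα' t ht)
  simp only at hα0
  have hbd : ∀ t ∈ Ioo a b, |(α t).1| ≤ R ∧ |(α t).2| ≤ R := by
    intro t ht
    have h := energy_le ht₀ hQ0 hy hz (fun t _ => hcl_abs _) (fun s hs => by
      rw [abs_mul, abs_neg]
      exact mul_le_mul (hQ s (Ioo_subset_Icc_self hs)) (hcl_abs _) (abs_nonneg _) hQ0) ht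
    rw [hα0] at h
    have habs : |t - t₀| ≤ b - a := abs_le.mpr
      ⟨by linarith [ht.1, ht.2, ht₀.1, ht₀.2], by linarith [ht.1, ht.2, ht₀.1, ht₀.2]⟩
    have h2 : (α t).1 ^ 2 + (α t).2 ^ 2
        ≤ (y₀ ^ 2 + z₀ ^ 2) * Real.exp ((1 + Q) * (b - a)) := by
      refine h.trans ?_
      gcongr
    constructor
    · refine (Real.abs_le_sqrt ?_).trans (by rw [hR]; linarith)
      nlinarith [sq_nonneg (α t).2]
    · refine (Real.abs_le_sqrt ?_).trans (by rw [hR]; linarith)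
      nlinarith [sq_nonneg (α t).1]
  refine ⟨fun t => (α t).1, fun t => (α t).2, by simp [hα0], by simp [hα0], fun t ht => ⟨?_, ?_⟩⟩
  · simpa only [hcl_eq _ (hbd t ht).2] using hy t ht
  · simpa only [hcl_eq _ (hbd t ht).1] using hz t ht

/-! ### Shooting for a positive Robin solution -/

/-- `(y, y') = (y, z)` solves `y'' + (p + lam) y = 0` on `(-1, L + 1)`. -/
def IsSolution (p : ℝ → ℝ) (L lam : ℝ) (y z : ℝ → ℝ) : Prop :=
  ∀ t ∈ Ioo (-1) (L + 1), HasDerivAt y (z t) t ∧ HasDerivAt z (-(p t + lam) * y t) t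

section Shooting

variable {p : ℝ → ℝ} {L : ℝ}

/-- Solutions live on a larger open interval so that their derivatives at 0 and L are two-sided. -/
lemma Icc_subset_Ioo_enlarged (L : ℝ) : Icc 0 L ⊆ Ioo (-1) (L + 1) :=
  fun s hs => ⟨by linarith [hs.1], by linarith [hs.2]⟩

/-- The bound is uniform for mu within 1 of lam, so the Grönwall constant does not depend on the
nearby parameter. -/
lemma exists_bound_add (hp : Continuous p) (L lam : ℝ) :
    ∃ Q, 0 ≤ Q ∧ ∀ mu, |mu - lam| ≤ 1 → ∀ t ∈ Icc (-1) (L + 1), |p t + mu| ≤ Q := by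
  obtain ⟨P, hP⟩ := isCompact_Icc.exists_bound_of_continuousOn
    (s := Icc (-1) (L + 1)) hp.continuousOn
  refine ⟨|P| + |lam| + 1, by positivity, fun mu hmu t ht => ?_⟩
  have h1 := (Real.norm_eq_abs _ ▸ hP t ht).trans (le_abs_self P)
  calc |p t + mu| ≤ |p t| + |mu| := abs_add_le _ _
    _ ≤ |P| + |lam| + 1 := by
      have : |mu| ≤ |lam| + |mu - lam| := by simpa using abs_add_le lam (mu - lam)
      linarith

lemma IsSolution.energy_le {lam Q t₀ t : ℝ} {y z : ℝ → ℝ} (h : IsSolution p L lam y z)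
    (hQ : 0 ≤ Q) (hpQ : ∀ t ∈ Icc (-1) (L + 1), |p t + lam| ≤ Q)
    (ht₀ : t₀ ∈ Icc 0 L) (ht : t ∈ Icc 0 L) :
    y t ^ 2 + z t ^ 2 ≤ (y t₀ ^ 2 + z t₀ ^ 2) * Real.exp ((1 + Q) * L) := by
  refine (FreeBoundary.energy_le (Icc_subset_Ioo_enlarged L ht₀) hQ (fun t ht => (h t ht).1)
    (fun t ht => (h t ht).2) (fun t _ => le_rfl) (fun t ht => ?_)
    (Icc_subset_Ioo_enlarged L ht)).trans ?_
  · rw [abs_mul, abs_neg]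
    exact mul_le_mul_of_nonneg_right (hpQ t (Ioo_subset_Icc_self ht)) (abs_nonneg _)
  · have : |t - t₀| ≤ L := abs_le.mpr
      ⟨by linarith [ht.1, ht.2, ht₀.1, ht₀.2], by linarith [ht.1, ht.2, ht₀.1, ht₀.2]⟩
    gcongr

/-- Continuous dependence of the solution on the eigenvalue parameter. -/
lemma continuous_dependence (hL : 0 < L) (hp : Continuous p) {y₀ z₀ : ℝ} {Y Z : ℝ → ℝ → ℝ}
    (hY0 : ∀ mu, Y mu 0 = y₀) (hZ0 : ∀ mu, Z mu 0 = z₀)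
    (h : ∀ mu, IsSolution p L mu (Y mu) (Z mu)) (lam : ℝ) {ε : ℝ} (hε : 0 < ε) :
    ∃ δ > 0, ∀ mu, |mu - lam| < δ →
      ∀ t ∈ Icc 0 L, |Y mu t - Y lam t| ≤ ε ∧ |Z mu t - Z lam t| ≤ ε := by
  obtain ⟨Q, hQ, hpQ⟩ := exists_bound_add hp L lam
  set R : ℝ := Real.sqrt ((y₀ ^ 2 + z₀ ^ 2) * Real.exp ((1 + Q) * L)) + 1 with hR
  have hR0 : 0 < R := by positivity
  have hK : 0 < 1 + Q := by linarith
  -- The difference of the two solutions starts at 0 and solves the equation for lam with forcing of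
  -- size at most |mu - lam| R. Grönwall's inequality bounds it by |mu - lam| C.
  set C : ℝ := R / (1 + Q) * Real.exp ((1 + Q) * L) with hC
  have hC0 : 0 < C := by positivity
  refine ⟨min 1 (ε / C), by positivity, fun mu hmu => ?_⟩
  have hmu1 : |mu - lam| ≤ 1 := (hmu.trans_le (min_le_left _ _)).le
  have hmuC : |mu - lam| * C ≤ ε := by
    rw [← le_div_iff₀ hC0]
    exact (hmu.trans_le (min_le_right _ _)).le
  have hbd : ∀ t ∈ Icc 0 L, |Y mu t| ≤ R := by
    intro t ht
    have := (h mu).energy_le hQ (hpQ mu hmu1) (left_mem_Icc.mpr hL.le) ht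
    rw [hY0, hZ0] at this
    refine (Real.abs_le_sqrt ?_).trans (show _ ≤ R by rw [hR]; linarith)
    nlinarith [sq_nonneg (Z mu t)]
  set D : ℝ → ℝ × ℝ := fun t => (Y mu t - Y lam t, Z mu t - Z lam t) with hD
  set D' : ℝ → ℝ × ℝ := fun t =>
    (Z mu t - Z lam t, -(p t + mu) * Y mu t - -(p t + lam) * Y lam t) with hD'
  have hder : ∀ t ∈ Icc 0 L, HasDerivAt D (D' t) t := fun t ht => by
    have hmem := Icc_subset_Ioo_enlarged L ht
    exact ((h mu t hmem).1.sub (h lam t hmem).1).prodMk ((h mu t hmem).2.sub (h lam t hmem).2)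
  have key := norm_le_gronwallBound_of_norm_deriv_right_le (f := D) (f' := D') (δ := 0) (K := 1 + Q)
    (ε := |mu - lam| * R) (a := 0) (b := L)
    (fun t ht => (hder t ht).continuousAt.continuousWithinAt)
    (fun t ht => (hder t (Ico_subset_Icc_self ht)).hasDerivWithinAt)
    (by simp [hD, hY0, hZ0]) (fun t ht => by
      have ht' := Ico_subset_Icc_self ht
      rw [Prod.norm_def, Prod.norm_def]
      simp only [hD', hD, Real.norm_eq_abs]
      set m := max |Y mu t - Y lam t| |Z mu t - Z lam t|
      have hm1 : |Y mu t - Y lam t| ≤ m := le_max_left _ _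
      have hm2 : |Z mu t - Z lam t| ≤ m := le_max_right _ _
      have hm0 : 0 ≤ m := (abs_nonneg _).trans hm1
      have h1 : |-(p t + mu) * Y mu t - -(p t + lam) * Y lam t| ≤ Q * m + |mu - lam| * R := by
        have e : -(p t + mu) * Y mu t - -(p t + lam) * Y lam t
            = -(p t + lam) * (Y mu t - Y lam t) + -(mu - lam) * Y mu t := by ring
        rw [e]
        refine (abs_add_le _ _).trans ?_
        rw [abs_mul, abs_mul, abs_neg, abs_neg]
        have h2 := hpQ lam (by simp) t
          (Ioo_subset_Icc_self (Icc_subset_Ioo_enlarged L ht'))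
        exact add_le_add (mul_le_mul h2 hm1 (abs_nonneg _) hQ)
          (mul_le_mul_of_nonneg_left (hbd t ht') (abs_nonneg _))
      have h3 : 0 ≤ |mu - lam| * R := by positivity
      have h4 : 0 ≤ Q * m := by positivity
      exact max_le (by linarith) (by linarith))
  intro t ht
  have hn := key t ht
  rw [gronwallBound_of_K_ne_0 hK.ne', Prod.norm_def] at hn
  simp only [zero_mul, zero_add, sub_zero, hD, Real.norm_eq_abs] at hn
  have hfin : |mu - lam| * R / (1 + Q) * (Real.exp ((1 + Q) * t) - 1) ≤ ε := by
    refine le_trans ?_ hmuC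
    rw [hC, mul_div_assoc, mul_assoc]
    have : Real.exp ((1 + Q) * t) - 1 ≤ Real.exp ((1 + Q) * L) := by
      have : Real.exp ((1 + Q) * t) ≤ Real.exp ((1 + Q) * L) :=
        Real.exp_le_exp.mpr (mul_le_mul_of_nonneg_left ht.2 hK.le)
      linarith
    gcongr
  exact ⟨(le_max_left _ _).trans (hn.trans hfin), (le_max_right _ _).trans (hn.trans hfin)⟩

lemma IsSolution.continuousOn {lam : ℝ} {y z : ℝ → ℝ} (h : IsSolution p L lam y z) :
    ContinuousOn y (Icc 0 L) := fun t ht =>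
  (h t (Icc_subset_Ioo_enlarged L ht)).1.continuousAt.continuousWithinAt

/-- For very negative `lam` the solution stays positive and reaches the Robin slope at the end. -/
lemma exists_supersolution (hL : 0 < L) (hp : Continuous p) (k₀ k₁ : ℝ) :
    ∃ lam : ℝ, ∀ y z : ℝ → ℝ, IsSolution p L lam y z → y 0 = 1 → z 0 = -k₀ →
      (∀ t ∈ Icc 0 L, 0 < y t) ∧ k₁ * y L ≤ z L := by
  obtain ⟨P, hP⟩ := isCompact_Icc.exists_bound_of_continuousOn (s := Icc 0 L) hp.continuousOn
  -- θ is the affine function with θ(0) = -k₀ and θ(L) = k₁, so exp Θ, with Θ' = θ, has the two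
  -- Robin slopes. The solution is compared with it.
  set c : ℝ := (k₁ + k₀) / L with hc
  set θ : ℝ → ℝ := fun t => -k₀ + c * t with hθ
  have hθd : ∀ t, HasDerivAt θ c t := fun t => by
    simpa only [id, mul_one] using ((hasDerivAt_id t).const_mul c).const_add (-k₀)
  obtain ⟨B, hB⟩ := isCompact_Icc.exists_bound_of_continuousOn (s := Icc 0 L) (f := θ)
    (fun t _ => (hθd t).continuousAt.continuousWithinAt)
  set Θ : ℝ → ℝ := fun t => -k₀ * t + c * t ^ 2 / 2 with hΘ
  have hΘd : ∀ t, HasDerivAt Θ (θ t) t := fun t => by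
    have := ((hasDerivAt_id t).const_mul (-k₀)).fun_add
      ((((hasDerivAt_id t).fun_pow 2).const_mul c).div_const 2)
    refine this.congr_deriv ?_
    simp [hθ]
    ring
  -- This value makes -(p + lam) - θ' - θ² ≥ 0. That expression times y exp Θ is the derivative of
  -- (z - θy) exp Θ.
  refine ⟨-(P + |c| + B ^ 2), fun y z h hy0 hz0 => ?_⟩
  have hy : ∀ t ∈ Icc 0 L, HasDerivAt y (z t) t := fun t ht => (h t (Icc_subset_Ioo_enlarged L ht)).1
  have hz : ∀ t ∈ Icc 0 L, HasDerivAt z _ t := fun t ht => (h t (Icc_subset_Ioo_enlarged L ht)).2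
  -- `v = z - θ y` and `y` stay nonnegative as long as `y` does
  have step : ∀ T ∈ Icc 0 L, (∀ t ∈ Ioo 0 T, 0 ≤ y t) → θ T * y T ≤ z T ∧ 0 < y T := by
    intro T hT hpos
    have hsub : Icc 0 T ⊆ Icc 0 L := Icc_subset_Icc_right hT.2
    have hv : ∀ t ∈ Icc 0 T, HasDerivAt (fun t => (z t - θ t * y t) * Real.exp (Θ t))
        ((-(p t + -(P + |c| + B ^ 2)) * y t - (c * y t + θ t * z t)) * Real.exp (Θ t)
          + (z t - θ t * y t) * (Real.exp (Θ t) * θ t)) t := fun t ht =>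
      ((hz t (hsub ht)).fun_sub ((hθd t).fun_mul (hy t (hsub ht)))).fun_mul (hΘd t).exp
    have hvm : MonotoneOn (fun t => (z t - θ t * y t) * Real.exp (Θ t)) (Icc 0 T) := by
      refine monotoneOn_of_deriv_nonneg (convex_Icc _ _)
        (fun s hs => (hv s hs).continuousAt.continuousWithinAt)
        (fun s hs => (hv s (interior_subset hs)).differentiableAt.differentiableWithinAt)
        fun s hs => ?_
      have hs' := interior_subset hs
      rw [interior_Icc] at hs
      rw [(hv s hs').deriv]
      have h1 : p s ≤ P := (le_abs_self _).trans (hP s (hsub hs'))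
      have h2 : c ≤ |c| := le_abs_self c
      have h3 : θ s ^ 2 ≤ B ^ 2 := sq_le_sq' (abs_le.mp (hB s (hsub hs'))).1
        (abs_le.mp (hB s (hsub hs'))).2
      have e : (-(p s + -(P + |c| + B ^ 2)) * y s - (c * y s + θ s * z s)) * Real.exp (Θ s)
          + (z s - θ s * y s) * (Real.exp (Θ s) * θ s)
          = ((P - p s) + (|c| - c) + (B ^ 2 - θ s ^ 2)) * y s * Real.exp (Θ s) := by ring
      rw [e]
      exact mul_nonneg (mul_nonneg (by linarith) (hpos s hs)) (Real.exp_pos _).le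
    have hv0 : ∀ t ∈ Icc 0 T, θ t * y t ≤ z t := by
      intro t ht
      have := hvm (left_mem_Icc.mpr hT.1) ht ht.1
      simp only [hy0, hz0, hθ, mul_zero, add_zero, mul_one, sub_self, zero_mul] at this
      have h2 := nonneg_of_mul_nonneg_left this (Real.exp_pos _)
      simp only [hθ]
      linarith
    have hu : ∀ t ∈ Icc 0 T, HasDerivAt (fun t => y t * Real.exp (-Θ t))
        (z t * Real.exp (-Θ t) + y t * (Real.exp (-Θ t) * -θ t)) t := fun t ht =>
      (hy t (hsub ht)).fun_mul (hΘd t).fun_neg.exp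
    have hum : MonotoneOn (fun t => y t * Real.exp (-Θ t)) (Icc 0 T) := by
      refine monotoneOn_of_deriv_nonneg (convex_Icc _ _)
        (fun s hs => (hu s hs).continuousAt.continuousWithinAt)
        (fun s hs => (hu s (interior_subset hs)).differentiableAt.differentiableWithinAt)
        fun s hs => ?_
      rw [(hu s (interior_subset hs)).deriv]
      have := hv0 s (interior_subset hs)
      have he := Real.exp_pos (-Θ s)
      nlinarith
    have := hum (left_mem_Icc.mpr hT.1) (right_mem_Icc.mpr hT.1) hT.1
    simp [hy0, hΘ] at this
    exact ⟨hv0 T (right_mem_Icc.mpr hT.1), pos_of_mul_pos_left (one_pos.trans_le this) (Real.exp_pos _).le⟩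
  have hall : ∀ t ∈ Icc 0 L, 0 < y t := by
    by_contra! hcon
    obtain ⟨t₁, ht₁, hyt₁⟩ := hcon
    have hcomp : IsCompact (Icc 0 L ∩ y ⁻¹' Iic 0) :=
      isCompact_Icc.of_isClosed_subset
        (h.continuousOn.preimage_isClosed_of_isClosed isClosed_Icc isClosed_Iic) inter_subset_left
    -- Before the first point T with y(T) ≤ 0 the solution is positive, so `step` gives y(T) > 0.
    obtain ⟨T, hT, hTl⟩ := hcomp.exists_isLeast ⟨t₁, ht₁, hyt₁⟩
    refine (step T hT.1 fun t ht => ?_).2.not_ge hT.2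
    by_contra! hneg
    exact ht.2.not_ge (hTl ⟨⟨ht.1.le, ht.2.le.trans hT.1.2⟩, hneg.le⟩)
  refine ⟨hall, ?_⟩
  have := (step L (right_mem_Icc.mpr hL.le) fun t ht => (hall t (Ioo_subset_Icc_self ht)).le).1
  have e : θ L = k₁ := by
    simp only [hθ, hc]
    field_simp
    ring
  rwa [e] at this

/-- The quotient w = z / y solves the Riccati equation w' = -(p + lam) - w², so w' ≤ P - lam. It
starts at -k₀ and ends at k₁ or above, which bounds lam. -/
lemma bound_of_supersolution (hL : 0 < L) (hp : Continuous p) (k₀ k₁ : ℝ) :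
    ∃ B : ℝ, ∀ lam (y z : ℝ → ℝ), IsSolution p L lam y z → y 0 = 1 → z 0 = -k₀ →
      (∀ t ∈ Icc 0 L, 0 < y t) → k₁ * y L ≤ z L → lam ≤ B := by
  obtain ⟨P, hP⟩ := isCompact_Icc.exists_bound_of_continuousOn (s := Icc 0 L) hp.continuousOn
  refine ⟨P + (-k₀ - k₁) / L, fun lam y z h hy0 hz0 hpos hend => ?_⟩
  have hw : ∀ t ∈ Icc 0 L, HasDerivAt (fun t => z t / y t + (lam - P) * t)
      ((-(p t + lam) * y t * y t - z t * z t) / y t ^ 2 + (lam - P)) t := fun t ht => by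
    have hs := h t (Icc_subset_Ioo_enlarged L ht)
    simpa using (hs.2.fun_div hs.1 (hpos t ht).ne').fun_add
      ((hasDerivAt_id t).const_mul (lam - P))
  have hanti : AntitoneOn (fun t => z t / y t + (lam - P) * t) (Icc 0 L) := by
    refine antitoneOn_of_deriv_nonpos (convex_Icc _ _)
      (fun s hs => (hw s hs).continuousAt.continuousWithinAt)
      (fun s hs => (hw s (interior_subset hs)).differentiableAt.differentiableWithinAt)
      fun s hs => ?_
    have hs' := interior_subset hs
    rw [(hw s hs').deriv]
    have hy := hpos s hs'
    have h1 : -P ≤ p s := (abs_le.mp (hP s hs')).1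
    have e : (-(p s + lam) * y s * y s - z s * z s) / y s ^ 2 + (lam - P)
        = -(p s + P) - (z s / y s) ^ 2 := by
      field_simp
      ring
    rw [e]
    nlinarith [sq_nonneg (z s / y s)]
  have h0 := hanti (left_mem_Icc.mpr hL.le) (right_mem_Icc.mpr hL.le) hL.le
  have hyL := hpos L (right_mem_Icc.mpr hL.le)
  have h1 : k₁ ≤ z L / y L := (le_div_iff₀ hyL).mpr hend
  simp [hy0, hz0] at h0
  have : (lam - P) * L ≤ -k₀ - k₁ := by linarith
  have := (le_div_iff₀ hL).mpr this
  linarith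

/-- Existence of a positive Robin eigenfunction. -/
theorem exists_positive_robin_solution (hL : 0 < L) (hp : Continuous p) (k₀ k₁ : ℝ) :
    ∃ (lam : ℝ) (y z : ℝ → ℝ), IsSolution p L lam y z ∧ (∀ t ∈ Icc 0 L, 0 < y t) ∧
      z 0 = -k₀ * y 0 ∧ z L = k₁ * y L := by
  have hex : ∀ lam, ∃ y z : ℝ → ℝ, y 0 = 1 ∧ z 0 = -k₀ ∧ IsSolution p L lam y z := fun lam =>
    exists_linear_ode_solution (a := -1) (b := L + 1) ⟨by linarith, by linarith⟩
      (q := fun t => p t + lam) (by fun_prop) 1 (-k₀)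
  choose Y Z hY0 hZ0 hs using hex
  -- The end condition is an inequality, so that very negative parameters belong to S. Equality is
  -- recovered at the supremum.
  set S : Set ℝ := {lam | (∀ t ∈ Icc 0 L, 0 < Y lam t) ∧ k₁ * Y lam L ≤ Z lam L} with hS
  have hne : S.Nonempty := by
    obtain ⟨lam, h⟩ := exists_supersolution hL hp k₀ k₁
    exact ⟨lam, h _ _ (hs lam) (hY0 lam) (hZ0 lam)⟩
  have hbdd : BddAbove S := by
    obtain ⟨B, hB⟩ := bound_of_supersolution hL hp k₀ k₁
    exact ⟨B, fun lam h => hB lam _ _ (hs lam) (hY0 lam) (hZ0 lam) h.1 h.2⟩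
  set lam := sSup S with hlam
  have h0 : (0 : ℝ) ∈ Icc 0 L := left_mem_Icc.mpr hL.le
  have hLm : L ∈ Icc 0 L := right_mem_Icc.mpr hL.le
  have happ : ∀ ε > 0, ∃ mu ∈ S, ∀ t ∈ Icc 0 L,
      |Y mu t - Y lam t| ≤ ε ∧ |Z mu t - Z lam t| ≤ ε := by
    intro ε hε
    obtain ⟨δ, hδ, h⟩ := continuous_dependence hL hp hY0 hZ0 hs lam hε
    obtain ⟨mu, hmu, hlt⟩ := exists_lt_of_lt_csSup hne (show lam - δ < sSup S by linarith)
    refine ⟨mu, hmu, h mu ?_⟩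
    have := le_csSup hbdd hmu
    rw [abs_lt]
    constructor <;> linarith
  have hnonneg : ∀ t ∈ Icc 0 L, 0 ≤ Y lam t := by
    intro t ht
    refine le_of_forall_pos_le_add fun ε hε => ?_
    obtain ⟨mu, hmu, h⟩ := happ ε hε
    have := (abs_le.mp (h t ht).1).2
    have := hmu.1 t ht
    linarith
  have hend : k₁ * Y lam L ≤ Z lam L := by
    refine le_of_forall_pos_le_add fun ε hε => ?_
    obtain ⟨mu, hmu, h⟩ := happ (ε / (1 + |k₁|)) (by positivity)
    have h1 := (abs_le.mp (h L hLm).2).2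
    have h3 : |k₁ * (Y mu L - Y lam L)| ≤ |k₁| * (ε / (1 + |k₁|)) := by
      rw [abs_mul]
      exact mul_le_mul_of_nonneg_left (h L hLm).1 (abs_nonneg _)
    have h4 := (abs_le.mp h3).1
    have h5 := hmu.2
    have h6 : ε / (1 + |k₁|) + |k₁| * (ε / (1 + |k₁|)) = ε := by
      field_simp
    nlinarith
  -- At a common zero of y and y' the energy vanishes. The energy estimate carries this back to 0,
  -- where y = 1.
  have hno : ∀ t ∈ Icc 0 L, Y lam t = 0 → Z lam t ≠ 0 := by
    intro t ht hy hz
    obtain ⟨Q, hQ, hpQ⟩ := exists_bound_add hp L lam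
    have := (hs lam).energy_le hQ (hpQ lam (by simp)) ht h0
    rw [hy, hz, hY0] at this
    nlinarith [sq_nonneg (Z lam 0)]
  have hpos : ∀ t ∈ Icc 0 L, 0 < Y lam t := by
    intro t ht
    refine (hnonneg t ht).lt_of_ne fun hy => ?_
    have hder := (hs lam t (Icc_subset_Ioo_enlarged L ht)).1
    have ht0 : 0 < t := ht.1.lt_of_ne (by rintro rfl; rw [hY0] at hy; norm_num at hy)
    -- An interior zero of the nonnegative limit is a minimum, hence a double zero. At L the left
    -- difference quotients give z ≤ 0 and the end inequality gives z ≥ 0, again a double zero.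
    rcases ht.2.lt_or_eq with htL | htL
    · have hmin : IsLocalMin (Y lam) t := by
        filter_upwards [Icc_mem_nhds ht0 htL] with s hs'
        rw [← hy]
        exact hnonneg s hs'
      exact hno t ht hy.symm (hmin.hasDerivAt_eq_zero hder)
    · subst htL
      refine hno t ht hy.symm (le_antisymm ?_ ?_)
      · have hw := hder.hasDerivWithinAt (s := Iio t)
        refine le_of_tendsto (hasDerivWithinAt_iff_tendsto_slope' (by simp) |>.mp hw) ?_
        filter_upwards [Ioo_mem_nhdsLT ht0] with s hs'
        rw [slope_def_field, ← hy]
        exact div_nonpos_of_nonneg_of_nonpos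
          (by simpa using hnonneg s (Ioo_subset_Icc_self hs')) (by linarith [hs'.2])
      · rw [← hy] at hend
        linarith
  refine ⟨lam, Y lam, Z lam, hs lam, hpos, by rw [hY0, hZ0, mul_one], ?_⟩
  by_contra hneq
  have hlt : k₁ * Y lam L < Z lam L := hend.lt_of_ne fun h => hneq h.symm
  obtain ⟨t₁, ht₁, hmin⟩ := isCompact_Icc.exists_isMinOn ⟨0, h0⟩ (hs lam).continuousOn
  -- A perturbation of size ε preserves both positivity and the strict end inequality. A slightly
  -- larger parameter would then still lie in S.
  set ε : ℝ := min (Y lam t₁ / 2) ((Z lam L - k₁ * Y lam L) / (1 + |k₁|)) with hε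
  have hε0 : 0 < ε := by
    have := hpos t₁ ht₁
    have : 0 < Z lam L - k₁ * Y lam L := by linarith
    positivity
  obtain ⟨δ, hδ, h⟩ := continuous_dependence hL hp hY0 hZ0 hs lam hε0
  have h' := h (lam + δ / 2) (by rw [add_sub_cancel_left, abs_of_pos] <;> linarith)
  have hmem : lam + δ / 2 ∈ S := by
    refine ⟨fun t ht => ?_, ?_⟩
    · have h1 := (abs_le.mp (h' t ht).1).1
      have h2 : Y lam t₁ ≤ Y lam t := hmin ht
      have h3 : ε ≤ Y lam t₁ / 2 := min_le_left _ _
      have := hpos t₁ ht₁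
      linarith
    · have h1 := (abs_le.mp (h' L hLm).2).1
      have h3 : |k₁ * (Y (lam + δ / 2) L - Y lam L)| ≤ |k₁| * ε := by
        rw [abs_mul]
        exact mul_le_mul_of_nonneg_left (h' L hLm).1 (abs_nonneg _)
      have h4 := (abs_le.mp h3).2
      have h5 : ε * (1 + |k₁|) ≤ Z lam L - k₁ * Y lam L := by
        rw [← le_div_iff₀ (by positivity)]
        exact min_le_right _ _
      nlinarith
  have := le_csSup hbdd hmem
  linarith

end Shooting

/-! ### Smooth extension and the first Robin eigenvalue -/

lemma SmoothOn.contDiffAt {E F : Type*} [NormedAddCommGroup E] [NormedSpace ℝ E]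
    [NormedAddCommGroup F] [NormedSpace ℝ F] {f : E → F} {S : Set E} (h : SmoothOn f S) {x : E}
    (hx : x ∈ S) : ContDiffAt ℝ ∞ f x := by
  obtain ⟨U, hU, hSU, hf⟩ := h
  exact hf.contDiffAt (hU.mem_nhds (hSU hx))

/-- A function that is smooth on a compact interval agrees near it with a globally smooth one. -/
lemma exists_contDiff_extension {E : Type*} [NormedAddCommGroup E] [NormedSpace ℝ E] {f : ℝ → E}
    {L : ℝ} (hL : 0 < L) (hf : SmoothOn f (Icc 0 L)) :
    ∃ h : ℝ → E, ContDiff ℝ ∞ h ∧ ∀ s ∈ Icc 0 L, h =ᶠ[𝓝 s] f := by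
  obtain ⟨U, hU, hSU, hfU⟩ := hf
  obtain ⟨r, hr, hrU⟩ := isCompact_Icc.exists_thickening_subset_open hU hSU
  have hIcc : Icc 0 L = Metric.closedBall (L / 2) (L / 2) := by
    rw [Real.closedBall_eq_Icc]
    ring_nf
  rw [hIcc, thickening_closedBall hr (by linarith)] at hrU
  -- The bump is 1 within r/3 of [0, L] and is supported within r/2 of it, inside U, so the values
  -- of f off U do not matter.
  let χ : ContDiffBump (L / 2) := ⟨L / 2 + r / 3, L / 2 + r / 2, by linarith, by linarith⟩
  refine ⟨fun s => χ s • f s, contDiff_iff_contDiffAt.mpr fun s => ?_, fun s hs => ?_⟩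
  · by_cases hs : s ∈ Metric.ball (L / 2) (r + L / 2)
    · exact χ.contDiffAt.smul (hfU.contDiffAt (hU.mem_nhds (hrU hs)))
    · have hs' : s ∉ tsupport χ := by
        rw [χ.tsupport_eq]
        intro h
        refine hs (Metric.closedBall_subset_ball ?_ h)
        change L / 2 + r / 2 < r + L / 2
        linarith
      refine contDiffAt_const (c := (0 : E)) |>.congr_of_eventuallyEq ?_
      filter_upwards [notMem_tsupport_iff_eventuallyEq.mp hs'] with t ht
      simp [ht]
  · have hs' : s ∈ Metric.ball (L / 2) χ.rIn := by
      rw [hIcc] at hs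
      refine Metric.closedBall_subset_ball ?_ hs
      change L / 2 < L / 2 + r / 3
      linarith
    filter_upwards [χ.eventuallyEq_one_of_mem_ball hs'] with t ht
    simp [ht]

/-- Bootstrapping: y' = z and z' = -(p + lam)y give each function one more derivative than the other
already has. -/
lemma IsSolution.contDiffOn {p y z : ℝ → ℝ} {L lam : ℝ} (h : IsSolution p L lam y z)
    (hp : ContDiff ℝ ∞ p) : ContDiffOn ℝ ∞ y (Ioo (-1) (L + 1)) := by
  have key : ∀ n : ℕ, ContDiffOn ℝ n y (Ioo (-1) (L + 1)) ∧ ContDiffOn ℝ n z (Ioo (-1) (L + 1)) := by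
    intro n
    induction n with
    | zero =>
      simp only [CharP.cast_eq_zero, contDiffOn_zero]
      exact ⟨fun t ht => (h t ht).1.continuousAt.continuousWithinAt,
        fun t ht => (h t ht).2.continuousAt.continuousWithinAt⟩
    | succ n ih =>
      rw [Nat.cast_succ, contDiffOn_succ_iff_deriv_of_isOpen isOpen_Ioo,
        contDiffOn_succ_iff_deriv_of_isOpen isOpen_Ioo]
      refine ⟨⟨fun t ht => (h t ht).1.differentiableAt.differentiableWithinAt, by simp, ?_⟩,
        ⟨fun t ht => (h t ht).2.differentiableAt.differentiableWithinAt, by simp, ?_⟩⟩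
      · exact ih.2.congr fun t ht => (h t ht).1.deriv
      · refine ContDiffOn.congr ?_ fun t ht => (h t ht).2.deriv
        have hpn : ContDiff ℝ n p := hp.of_le (by exact_mod_cast le_top)
        exact ((hpn.add contDiff_const).neg.contDiffOn).mul ih.1
  exact contDiffOn_infty.mpr fun n => (key n).1

namespace DiskMetric

variable {g : DiskMetric} {γ : ℝ → Plane} {L : ℝ}

lemma hasDerivAt_of_smoothOn {E : Type*} [NormedAddCommGroup E] [NormedSpace ℝ E]
    {f : ℝ → E} {S : Set ℝ} (h : SmoothOn f S) {s : ℝ} (hs : s ∈ S) :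
    HasDerivAt f (deriv f s) s ∧ HasDerivAt (deriv f) (deriv (deriv f) s) s := by
  have h1 := h.contDiffAt hs
  have h2 : ContDiffAt ℝ ∞ (deriv f) s := by
    have := (h1.fderiv_right (m := ∞) (by simp)).clm_apply (contDiffAt_const (c := (1 : ℝ)))
    simpa only [fderiv_apply_one_eq_deriv] using this
  exact ⟨(h1.differentiableAt (by simp)).hasDerivAt, (h2.differentiableAt (by simp)).hasDerivAt⟩

/-- Picone's identity: a positive Robin eigenfunction belongs to the least eigenvalue. -/
lemma IsRobinEigenfunction.le_of_pos (hL : 0 < L) {lam mu : ℝ} {φ ψ : ℝ → ℝ}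
    (hφ : g.IsRobinEigenfunction γ L lam φ) (hpos : ∀ s ∈ Icc 0 L, 0 < φ s)
    (hψ : g.IsRobinEigenfunction γ L mu ψ) : lam ≤ mu := by
  by_contra! hlt
  -- The Robin conditions of φ and ψ make W vanish at both ends. If mu < lam, then W is also
  -- monotone, so W and its derivative vanish identically, and the term (lam - mu)ψ² forces ψ = 0.
  set W : ℝ → ℝ := fun s => ψ s * deriv ψ s - deriv φ s * ψ s ^ 2 / φ s with hW
  have hd : ∀ s ∈ Icc 0 L, HasDerivAt W
      ((deriv ψ s - deriv φ s * ψ s / φ s) ^ 2 + (lam - mu) * ψ s ^ 2) s := by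
    intro s hs
    have h0 := (hpos s hs).ne'
    obtain ⟨h1, h2⟩ := hasDerivAt_of_smoothOn hφ.smooth hs
    obtain ⟨h3, h4⟩ := hasDerivAt_of_smoothOn hψ.smooth hs
    refine ((h3.fun_mul h4).fun_sub ((h2.fun_mul (h3.fun_pow 2)).fun_div h1 h0)).congr_deriv ?_
    have e1 := hφ.equation s hs
    have e2 := hψ.equation s hs
    have e1' : deriv (deriv φ) s = -(g.gaussCurvature (γ s) * φ s + lam * φ s) := by linarith
    have e2' : deriv (deriv ψ) s = -(g.gaussCurvature (γ s) * ψ s + mu * ψ s) := by linarith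
    rw [e1', e2']
    field_simp
    push_cast
    ring
  have hnn : ∀ s, 0 ≤ (deriv ψ s - deriv φ s * ψ s / φ s) ^ 2 + (lam - mu) * ψ s ^ 2 := fun s => by
    have : 0 < lam - mu := by linarith
    positivity
  have hmono : MonotoneOn W (Icc 0 L) := by
    refine monotoneOn_of_deriv_nonneg (convex_Icc _ _)
      (fun s hs => (hd s hs).continuousAt.continuousWithinAt)
      (fun s hs => (hd s (interior_subset hs)).differentiableAt.differentiableWithinAt)
      fun s hs => ?_
    rw [(hd s (interior_subset hs)).deriv]
    exact hnn s
  have h0 : (0 : ℝ) ∈ Icc 0 L := left_mem_Icc.mpr hL.le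
  have hLm : L ∈ Icc 0 L := right_mem_Icc.mpr hL.le
  have hW0 : W 0 = 0 := by
    have e1 : deriv φ 0 = -g.boundaryCurvature (γ 0) * φ 0 := by linarith [hφ.robin_start]
    have e2 : deriv ψ 0 = -g.boundaryCurvature (γ 0) * ψ 0 := by linarith [hψ.robin_start]
    have := (hpos 0 h0).ne'
    simp only [hW, e1, e2]
    field_simp
    ring
  have hWL : W L = 0 := by
    have e1 : deriv φ L = g.boundaryCurvature (γ L) * φ L := by linarith [hφ.robin_end]
    have e2 : deriv ψ L = g.boundaryCurvature (γ L) * ψ L := by linarith [hψ.robin_end]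
    have := (hpos L hLm).ne'
    simp only [hW, e1, e2]
    field_simp
    ring
  have hWz : EqOn W (fun _ => 0) (Icc 0 L) := fun s hs =>
    le_antisymm (hWL ▸ hmono hs hLm hs.2) (hW0 ▸ hmono h0 hs hs.1)
  obtain ⟨s, hs, hne⟩ := hψ.nontrivial
  have := HasDerivAt.eq_of_eqOn_Icc hL hs (hd s hs) (hasDerivAt_const s 0) hWz
  have h1 : 0 < (lam - mu) * ψ s ^ 2 := mul_pos (by linarith) (by positivity)
  nlinarith [sq_nonneg (deriv ψ s - deriv φ s * ψ s / φ s)]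

/-- The second variation at an eigenfunction. -/
lemma IsRobinEigenfunction.secondVariation_eq (hL : 0 < L) (hγ : ContDiff ℝ ∞ γ)
    (hdet : ∀ s ∈ Icc 0 L, (g.gram (γ s)).det ≠ 0) {lam : ℝ} {φ : ℝ → ℝ}
    (hφ : g.IsRobinEigenfunction γ L lam φ) :
    g.secondVariation γ L φ = lam * ∫ s in (0 : ℝ)..L, φ s ^ 2 := by
  have huIcc : uIcc 0 L = Icc 0 L := uIcc_of_le hL.le
  have hd := fun s (hs : s ∈ uIcc 0 L) => hasDerivAt_of_smoothOn hφ.smooth (huIcc ▸ hs)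
  have hc : ContinuousOn φ (uIcc 0 L) := fun s hs => (hd s hs).1.continuousAt.continuousWithinAt
  have hc' : ContinuousOn (deriv φ) (uIcc 0 L) := fun s hs =>
    (hd s hs).2.continuousAt.continuousWithinAt
  have hK : ContinuousOn (fun s => g.gaussCurvature (γ s)) (uIcc 0 L) := fun s hs =>
    ((g.contDiffAt_gaussCurvature (hdet s (huIcc ▸ hs))).continuousAt.comp
      hγ.continuous.continuousAt).continuousWithinAt
  -- Integration by parts: by the Robin conditions the boundary values of φφ' are the boundary terms
  -- of the second variation.
  have hder : ∀ s ∈ uIcc 0 L, HasDerivAt (fun s => φ s * deriv φ s)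
      ((deriv φ s ^ 2 - g.gaussCurvature (γ s) * φ s ^ 2) - lam * φ s ^ 2) s := by
    intro s hs
    refine ((hd s hs).1.fun_mul (hd s hs).2).congr_deriv ?_
    have e := hφ.equation s (huIcc ▸ hs)
    linear_combination φ s * e
  have hi1 : IntervalIntegrable (fun s => deriv φ s ^ 2 - g.gaussCurvature (γ s) * φ s ^ 2)
      MeasureTheory.volume 0 L := ((hc'.pow 2).sub (hK.mul (hc.pow 2))).intervalIntegrable
  have hi2 : IntervalIntegrable (fun s => lam * φ s ^ 2) MeasureTheory.volume 0 L :=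
    (continuousOn_const.mul (hc.pow 2)).intervalIntegrable
  have hint := intervalIntegral.integral_eq_sub_of_hasDerivAt hder (hi1.sub hi2)
  rw [intervalIntegral.integral_sub hi1 hi2, intervalIntegral.integral_const_mul] at hint
  unfold secondVariation
  have e1 : deriv φ 0 = -g.boundaryCurvature (γ 0) * φ 0 := by linarith [hφ.robin_start]
  have e2 : deriv φ L = g.boundaryCurvature (γ L) * φ L := by linarith [hφ.robin_end]
  rw [e1, e2] at hint
  linear_combination hint

/-- With the normalization ∫φ² = 1 the eigenvalue is the value of the second variation at φ. -/
lemma IsPositiveFirstEigenfunction.eigenvalue_pos (hL : 0 < L) (hγ : ContDiff ℝ ∞ γ)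
    (hdet : ∀ s ∈ Icc 0 L, (g.gram (γ s)).det ≠ 0) (hstable : g.IsStrictlyStable γ L) {lam : ℝ}
    {φ : ℝ → ℝ} (hφ : g.IsPositiveFirstEigenfunction γ L lam φ) : 0 < lam := by
  have h := hstable φ hφ.eigen.smooth hφ.eigen.nontrivial
  rwa [hφ.eigen.secondVariation_eq hL hγ hdet, hφ.normalized, mul_one] at h

/-- Shooting is applied to a smooth extension p of the curvature along γ. Dividing by the L² norm
normalizes the solution, and positivity alone makes its eigenvalue least. -/
theorem exists_isPositiveFirstEigenfunction (hL : 0 < L) (hγ : ContDiff ℝ ∞ γ)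
    (hdet : ∀ s ∈ Icc 0 L, (g.gram (γ s)).det ≠ 0) :
    ∃ (lam : ℝ) (φ : ℝ → ℝ), g.IsPositiveFirstEigenfunction γ L lam φ := by
  have hKs : SmoothOn (fun s => g.gaussCurvature (γ s)) (Icc 0 L) := by
    refine ⟨γ ⁻¹' {x | (g.gram x).det ≠ 0}, ?_, hdet, fun s hs => ?_⟩
    · exact (isOpen_ne_fun g.contDiff_gram_det.continuous continuous_const).preimage hγ.continuous
    · exact ((g.contDiffAt_gaussCurvature hs).comp s hγ.contDiffAt).contDiffWithinAt
  obtain ⟨p, hp, hpK⟩ := exists_contDiff_extension hL hKs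
  obtain ⟨lam, y, z, hs, hpos, h0, h1⟩ := exists_positive_robin_solution hL hp.continuous
    (g.boundaryCurvature (γ 0)) (g.boundaryCurvature (γ L))
  have hsub := Icc_subset_Ioo_enlarged L
  have h0m : (0 : ℝ) ∈ Icc 0 L := left_mem_Icc.mpr hL.le
  have hLm : L ∈ Icc 0 L := right_mem_Icc.mpr hL.le
  set I : ℝ := ∫ s in (0 : ℝ)..L, y s ^ 2 with hI
  have hI0 : 0 < I := by
    refine intervalIntegral.intervalIntegral_pos_of_pos_on ?_ (fun s hs' => ?_) hL
    · refine ContinuousOn.intervalIntegrable ?_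
      rw [uIcc_of_le hL.le]
      exact hs.continuousOn.pow 2
    · have := hpos s (Ioo_subset_Icc_self hs')
      positivity
  set c : ℝ := (Real.sqrt I)⁻¹ with hc
  have hc0 : 0 < c := by positivity
  have hd1 : ∀ t ∈ Ioo (-1) (L + 1), deriv (fun s => c * y s) t = c * z t := fun t ht =>
    ((hs t ht).1.const_mul c).deriv
  have hd2 : ∀ t ∈ Ioo (-1) (L + 1), deriv (deriv (fun s => c * y s)) t
      = c * (-(p t + lam) * y t) := fun t ht => by
    have e : deriv (fun s => c * y s) =ᶠ[𝓝 t] fun t => c * z t := by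
      filter_upwards [isOpen_Ioo.mem_nhds ht] with u hu
      exact hd1 u hu
    rw [e.deriv_eq]
    exact ((hs t ht).2.const_mul c).deriv
  have heig : g.IsRobinEigenfunction γ L lam (fun s => c * y s) := by
    refine ⟨⟨Ioo (-1) (L + 1), isOpen_Ioo, hsub, contDiffOn_const.mul (hs.contDiffOn hp)⟩,
      ⟨0, h0m, (mul_pos hc0 (hpos 0 h0m)).ne'⟩, fun s hs' => ?_, ?_, ?_⟩
    · have e : p s = g.gaussCurvature (γ s) := (hpK s hs').self_of_nhds
      rw [hd2 s (hsub hs'), ← e]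
      ring
    · rw [hd1 0 (hsub h0m), h0]
      ring
    · rw [hd1 L (hsub hLm), h1]
      ring
  have hpos' : ∀ s ∈ Icc 0 L, 0 < c * y s := fun s hs' => mul_pos hc0 (hpos s hs')
  refine ⟨lam, fun s => c * y s, heig, fun mu ψ hψ => heig.le_of_pos hL hpos' hψ, hpos', ?_⟩
  simp only [mul_pow]
  rw [intervalIntegral.integral_const_mul, ← hI, hc, inv_pow, Real.sq_sqrt hI0.le,
    inv_mul_cancel₀ hI0.ne']

end DiskMetric

/-! ### Lengths of paths and the Riemannian distance -/

open MeasureTheory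

namespace DiskMetric

variable (g : DiskMetric)

lemma norm_nonneg (x v : Plane) : 0 ≤ g.norm x v := Real.sqrt_nonneg _

lemma norm_smul (x v : Plane) (a : ℝ) : g.norm x (a • v) = |a| * g.norm x v := by
  unfold norm
  simp only [map_smul, smul_apply, smul_eq_mul]
  rw [← mul_assoc, Real.sqrt_mul (mul_self_nonneg a), Real.sqrt_mul_self_eq_abs]

lemma continuousOn_norm_comp {c V : ℝ → Plane} {S : Set ℝ} (hc : ContinuousOn c S)
    (hV : ContinuousOn V S) : ContinuousOn (fun s => g.norm (c s) (V s)) S :=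
  (((g.smooth.continuous.comp_continuousOn hc).clm_apply hV).clm_apply hV).sqrt

/-- For a path that is C¹ only on a closed interval, `deriv` is uncontrolled at the two end points.
`derivWithin` has the same values inside and is continuous up to the ends, so length integrals are
evaluated with it. -/
lemma hasDerivAt_derivWithin_Icc {c : ℝ → Plane} {a b s : ℝ} (hc : ContDiffOn ℝ 1 c (Icc a b))
    (hs : s ∈ Ioo a b) : HasDerivAt c (derivWithin c (Icc a b) s) s :=
  ((hc.differentiableOn (by simp) s (Ioo_subset_Icc_self hs)).hasDerivWithinAt).hasDerivAt
    (Icc_mem_nhds hs.1 hs.2)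

lemma continuousOn_speed {c : ℝ → Plane} {a b : ℝ} (hab : a < b) (hc : ContDiffOn ℝ 1 c (Icc a b)) :
    ContinuousOn (fun s => g.norm (c s) (derivWithin c (Icc a b) s)) (Icc a b) :=
  g.continuousOn_norm_comp hc.continuousOn
    (hc.continuousOn_derivWithin (uniqueDiffOn_Icc hab) le_rfl)

lemma speed_eq {c : ℝ → Plane} {a b s : ℝ} (hc : ContDiffOn ℝ 1 c (Icc a b)) (hs : s ∈ Ioo a b) :
    g.norm (c s) (deriv c s) = g.norm (c s) (derivWithin c (Icc a b) s) := by
  rw [(hasDerivAt_derivWithin_Icc hc hs).deriv]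

lemma intervalIntegrable_speed {c : ℝ → Plane} {a b : ℝ} (hab : a < b)
    (hc : ContDiffOn ℝ 1 c (Icc a b)) :
    IntervalIntegrable (fun s => g.norm (c s) (deriv c s)) volume a b := by
  have h := (g.continuousOn_speed hab hc).integrableOn_Icc (μ := volume)
  rw [intervalIntegrable_iff_integrableOn_Ioo_of_le hab.le]
  exact (h.mono_set Ioo_subset_Icc_self).congr_fun (fun s hs => (g.speed_eq hc hs).symm)
    measurableSet_Ioo

lemma integral_speed_eq {c : ℝ → Plane} {a b : ℝ} (hab : a < b)
    (hc : ContDiffOn ℝ 1 c (Icc a b)) :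
    ∫ s in a..b, g.norm (c s) (deriv c s)
      = ∫ s in a..b, g.norm (c s) (derivWithin c (Icc a b) s) := by
  rw [intervalIntegral.integral_of_le hab.le, intervalIntegral.integral_of_le hab.le,
    integral_Ioc_eq_integral_Ioo, integral_Ioc_eq_integral_Ioo]
  exact setIntegral_congr_fun measurableSet_Ioo fun s hs => g.speed_eq hc hs

/-- Reparametrization invariance of the length. -/
lemma integral_speed_comp {c : ℝ → Plane} {σ : ℝ → ℝ} {a b : ℝ} (hab : a < b)
    (hc : ContDiffOn ℝ 1 c (Icc 0 1)) (hσ : ContDiff ℝ 1 σ) (hσm : Monotone σ)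
    (hσI : ∀ s ∈ Ioo a b, σ s ∈ Ioo 0 1) (ha : σ a = 0) (hb : σ b = 1) :
    ∫ s in a..b, g.norm (c (σ s)) (deriv (fun t => c (σ t)) s)
      = ∫ s in (0 : ℝ)..1, g.norm (c s) (deriv c s) := by
  have himg : σ '' uIcc a b ⊆ Icc 0 1 := by
    rw [uIcc_of_le hab.le]
    rintro _ ⟨s, hs, rfl⟩
    exact ⟨ha ▸ hσm hs.1, hb ▸ hσm hs.2⟩
  have hd : ∀ s, HasDerivAt σ (deriv σ s) s := fun s =>
    (hσ.differentiable (by simp)).differentiableAt.hasDerivAt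
  have key := intervalIntegral.integral_comp_mul_deriv'' (a := a) (b := b) (f := σ) (f' := deriv σ)
    (g := fun s => g.norm (c s) (derivWithin c (Icc 0 1) s)) hσ.continuous.continuousOn
    (fun s _ => (hd s).hasDerivWithinAt) (hσ.continuous_deriv le_rfl).continuousOn
    ((g.continuousOn_speed one_pos hc).mono himg)
  rw [ha, hb, ← g.integral_speed_eq one_pos hc] at key
  rw [← key, intervalIntegral.integral_of_le hab.le, intervalIntegral.integral_of_le hab.le,
    integral_Ioc_eq_integral_Ioo, integral_Ioc_eq_integral_Ioo]
  refine setIntegral_congr_fun measurableSet_Ioo fun s hs => ?_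
  have h1 := (hasDerivAt_derivWithin_Icc hc (hσI s hs)).scomp s (hd s)
  have h2 : deriv (fun t => c (σ t)) s = deriv σ s • derivWithin c (Icc 0 1) (σ s) := h1.deriv
  simp only [h2, norm_smul, Function.comp]
  rw [abs_of_nonneg hσm.deriv_nonneg, mul_comm]

lemma smoothTransition_mem_Icc (x : ℝ) : Real.smoothTransition x ∈ Icc (0 : ℝ) 1 :=
  ⟨Real.smoothTransition.nonneg x, Real.smoothTransition.le_one x⟩

lemma smoothTransition_mem_Ioo {x : ℝ} (hx : x ∈ Ioo (0 : ℝ) 1) :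
    Real.smoothTransition x ∈ Ioo (0 : ℝ) 1 :=
  ⟨Real.smoothTransition.pos_of_pos hx.1, Real.smoothTransition.lt_one_of_lt_one hx.2⟩

/-- Concatenation of paths. -/
lemma add_mem_pathLengths {x y z : Plane} {l₁ l₂ : ℝ} (h₁ : l₁ ∈ g.pathLengths x y)
    (h₂ : l₂ ∈ g.pathLengths y z) : l₁ + l₂ ∈ g.pathLengths x z := by
  obtain ⟨c₁, hc₁, hm₁, hx, hy, rfl⟩ := h₁
  obtain ⟨c₂, hc₂, hm₂, hy', hz, rfl⟩ := h₂
  set σ := Real.smoothTransition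
  have hσ : ContDiff ℝ 1 σ := Real.smoothTransition.contDiff
  have hσm : Monotone σ := Real.smoothTransition.monotone
  have hτ₁ : ContDiff ℝ 1 (fun s : ℝ => σ (2 * s)) := hσ.comp (contDiff_const.mul contDiff_id)
  have hτ₂ : ContDiff ℝ 1 (fun s : ℝ => σ (2 * s - 1)) :=
    hσ.comp ((contDiff_const.mul contDiff_id).sub contDiff_const)
  have hC : ∀ {c : ℝ → Plane} {τ : ℝ → ℝ}, ContDiffOn ℝ 1 c (Icc 0 1) → ContDiff ℝ 1 τ →
      (∀ s, τ s ∈ Icc (0 : ℝ) 1) → ContDiff ℝ 1 (fun s => c (τ s)) := fun hc hτ hm =>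
    contDiffOn_univ.mp (hc.comp hτ.contDiffOn fun s _ => hm s)
  have hC₁ := hC hc₁ hτ₁ fun s => smoothTransition_mem_Icc _
  have hC₂ := hC hc₂ hτ₂ fun s => smoothTransition_mem_Icc _
  -- Both paths are slowed down by `Real.smoothTransition`, so each rests while the other one moves.
  -- Their sum minus the common point y is C¹ across s = 1/2.
  set c : ℝ → Plane := fun s => c₁ (σ (2 * s)) + (c₂ (σ (2 * s - 1)) - y) with hcdef
  have hcC : ContDiff ℝ 1 c := hC₁.add (hC₂.sub contDiff_const)
  have hleft : ∀ s : ℝ, s ≤ 1 / 2 → c s = c₁ (σ (2 * s)) := fun s hs => by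
    simp only [hcdef, σ]
    rw [Real.smoothTransition.zero_of_nonpos (x := 2 * s - 1) (by linarith), hy', sub_self, add_zero]
  have hright : ∀ s : ℝ, 1 / 2 ≤ s → c s = c₂ (σ (2 * s - 1)) := fun s hs => by
    simp only [hcdef, σ]
    rw [Real.smoothTransition.one_of_one_le (x := 2 * s) (by linarith), hy]
    abel
  refine ⟨c, hcC.contDiffOn, fun s _ => ?_, ?_, ?_, ?_⟩
  · rcases le_total s (1 / 2) with h | h
    · rw [hleft s h]
      exact hm₁ (smoothTransition_mem_Icc _)
    · rw [hright s h]
      exact hm₂ (smoothTransition_mem_Icc _)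
  · rw [hleft 0 (by norm_num)]
    simp [σ, hx]
  · rw [hright 1 (by norm_num)]
    norm_num [σ, hz]
  · have hint : ∀ a b : ℝ, IntervalIntegrable (fun s => g.norm (c s) (deriv c s)) volume a b :=
      fun a b => ContinuousOn.intervalIntegrable (g.continuousOn_norm_comp
        hcC.continuous.continuousOn (hcC.continuous_deriv le_rfl).continuousOn)
    rw [← intervalIntegral.integral_add_adjacent_intervals (hint 0 (1 / 2)) (hint (1 / 2) 1)]
    congr 1
    · rw [← g.integral_speed_comp (a := 0) (b := 1 / 2) (by norm_num) hc₁ hτ₁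
        (hσm.comp fun a b h => by simpa using h)
        (fun s hs => smoothTransition_mem_Ioo ⟨by linarith [hs.1], by linarith [hs.2]⟩)
        (by simp [σ]) (by simp [σ]),
        intervalIntegral.integral_of_le (by norm_num), intervalIntegral.integral_of_le (by norm_num),
        integral_Ioc_eq_integral_Ioo, integral_Ioc_eq_integral_Ioo]
      refine setIntegral_congr_fun measurableSet_Ioo fun s hs => ?_
      have e : c =ᶠ[𝓝 s] fun t => c₁ (σ (2 * t)) := by
        filter_upwards [isOpen_Iio.mem_nhds hs.2] with t ht
        exact hleft t (le_of_lt ht)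
      simp only [e.deriv_eq, e.self_of_nhds]
    · rw [← g.integral_speed_comp (a := 1 / 2) (b := 1) (by norm_num) hc₂ hτ₂
        (hσm.comp fun a b h => by simpa using h)
        (fun s hs => smoothTransition_mem_Ioo ⟨by linarith [hs.1], by linarith [hs.2]⟩)
        (by simp [σ]) (by norm_num [σ]),
        intervalIntegral.integral_of_le (by norm_num), intervalIntegral.integral_of_le (by norm_num),
        integral_Ioc_eq_integral_Ioo, integral_Ioc_eq_integral_Ioo]
      refine setIntegral_congr_fun measurableSet_Ioo fun s hs => ?_
      have e : c =ᶠ[𝓝 s] fun t => c₂ (σ (2 * t - 1)) := by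
        filter_upwards [isOpen_Ioi.mem_nhds hs.1] with t ht
        exact hright t (le_of_lt ht)
      simp only [e.deriv_eq, e.self_of_nhds]

lemma pathLengths_nonneg {x y : Plane} {l : ℝ} (h : l ∈ g.pathLengths x y) : 0 ≤ l := by
  obtain ⟨c, -, -, -, -, rfl⟩ := h
  exact intervalIntegral.integral_nonneg zero_le_one fun s _ => g.norm_nonneg _ _

lemma bddBelow_pathLengths (x y : Plane) : BddBelow (g.pathLengths x y) :=
  ⟨0, fun _ h => g.pathLengths_nonneg h⟩

lemma rdist_nonneg (x y : Plane) : 0 ≤ g.rdist x y :=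
  Real.sInf_nonneg fun _ h => g.pathLengths_nonneg h

lemma exists_norm_le : ∃ C, 0 ≤ C ∧ ∀ x ∈ disk, ∀ v, g.norm x v ≤ C * ‖v‖ := by
  have hcont : Continuous fun x => ‖g.form x‖ := 
    (continuous_norm (E := Plane →L[ℝ] Plane →L[ℝ] ℝ)).comp g.smooth.continuous
  obtain ⟨B, hB⟩ := (isCompact_closedBall (0 : Plane) 1).exists_bound_of_continuousOn
    hcont.continuousOn
  refine ⟨Real.sqrt B, Real.sqrt_nonneg _, fun x hx v => ?_⟩
  have hB' : ‖g.form x‖ ≤ B := (le_abs_self _).trans (hB x hx)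
  have h0 : 0 ≤ B := (abs_nonneg _).trans (hB x hx)
  rw [norm, ← Real.sqrt_sq (_root_.norm_nonneg v), ← Real.sqrt_mul h0]
  refine Real.sqrt_le_sqrt ((le_abs_self _).trans ?_)
  calc |g.form x v v| ≤ ‖g.form x‖ * ‖v‖ * ‖v‖ := (g.form x).le_opNorm₂ v v
    _ ≤ B * ‖v‖ * ‖v‖ := by gcongr
    _ = B * ‖v‖ ^ 2 := by ring

/-- The disk is convex, so straight segments are admissible. They also show that `pathLengths` is
nonempty between points of the disk, so that its infimum is not the default value 0. -/
lemma exists_segment_length : ∃ C, 0 ≤ C ∧ ∀ x ∈ disk, ∀ y ∈ disk,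
    ∃ l ∈ g.pathLengths x y, l ≤ C * ‖x - y‖ := by
  obtain ⟨C, hC0, hC⟩ := g.exists_norm_le
  refine ⟨C, hC0, fun x hx y hy => ⟨_, ⟨fun s : ℝ => x + s • (y - x), ?_, ?_, by simp, by simp, rfl⟩, ?_⟩⟩
  · exact (contDiff_const.add (contDiff_id.smul contDiff_const)).contDiffOn
  · intro s hs
    have := (convex_closedBall (0 : Plane) 1).add_smul_sub_mem hx hy hs
    exact this
  · have hd : ∀ s : ℝ, deriv (fun s : ℝ => x + s • (y - x)) s = y - x := fun s => by
      simpa using (((hasDerivAt_id s).smul_const (y - x)).const_add x).deriv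
    have hmem : ∀ s ∈ Icc (0 : ℝ) 1, x + s • (y - x) ∈ disk := fun s hs =>
      (convex_closedBall (0 : Plane) 1).add_smul_sub_mem hx hy hs
    simp only [hd]
    have hcont : Continuous fun s : ℝ => x + s • (y - x) := by fun_prop
    calc ∫ s in (0 : ℝ)..1, g.norm (x + s • (y - x)) (y - x)
        ≤ ∫ s in (0 : ℝ)..1, C * ‖y - x‖ := by
          refine intervalIntegral.integral_mono_on zero_le_one
            (g.continuousOn_norm_comp hcont.continuousOn continuousOn_const).intervalIntegrable
            (by simp) fun s hs => hC _ (hmem s hs) _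
      _ = C * ‖x - y‖ := by simp [norm_sub_rev]

lemma rdist_le_add {x y z : Plane} {l : ℝ} (hy : y ∈ disk) (hz : z ∈ disk)
    (hl : l ∈ g.pathLengths x y) : g.rdist x z ≤ l + g.rdist y z := by
  obtain ⟨C, -, hC⟩ := g.exists_segment_length
  obtain ⟨m, hm, -⟩ := hC y hy z hz
  rw [← sub_le_iff_le_add']
  refine le_csInf ⟨m, hm⟩ fun k hk => ?_
  rw [sub_le_iff_le_add']
  exact csInf_le (g.bddBelow_pathLengths x z) (g.add_mem_pathLengths hl hk)

lemma bddBelow_rdist (x : Plane) (S : Set Plane) : BddBelow (g.rdist x '' S) :=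
  ⟨0, by rintro _ ⟨y, -, rfl⟩; exact g.rdist_nonneg x y⟩

lemma rdistTo_le {x y : Plane} {S : Set Plane} {l : ℝ} (hy : y ∈ S) (hl : l ∈ g.pathLengths x y) :
    g.rdistTo x S ≤ l :=
  (csInf_le (g.bddBelow_rdist x S) ⟨y, hy, rfl⟩).trans (csInf_le (g.bddBelow_pathLengths x y) hl)

/-- Membership in the disk guarantees that some path exists. Over an empty set of lengths the
infimum would be 0 and no lower bound could hold. -/
lemma le_rdistTo {x : Plane} {S : Set Plane} {a : ℝ} (hx : x ∈ disk) (hS : S ⊆ disk)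
    (hne : S.Nonempty) (h : ∀ y ∈ S, ∀ l ∈ g.pathLengths x y, a ≤ l) : a ≤ g.rdistTo x S := by
  obtain ⟨C, -, hC⟩ := g.exists_segment_length
  refine le_csInf (hne.image _) ?_
  rintro _ ⟨y, hy, rfl⟩
  obtain ⟨m, hm, -⟩ := hC x hx y (hS hy)
  exact le_csInf ⟨m, hm⟩ fun l hl => h y hy l hl

/-- Segments make the distance to S Lipschitz for the Euclidean norm, hence its maximum and minimum
over a compact leaf are attained. -/
lemma continuousOn_rdistTo {S : Set Plane} (hS : S ⊆ disk) (hne : S.Nonempty) :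
    ContinuousOn (fun x => g.rdistTo x S) disk := by
  obtain ⟨C, hC0, hC⟩ := g.exists_segment_length
  have key : ∀ x ∈ disk, ∀ y ∈ disk, g.rdistTo x S ≤ g.rdistTo y S + C * ‖x - y‖ := by
    intro x hx y hy
    obtain ⟨l, hl, hlC⟩ := hC x hx y hy
    rw [← sub_le_iff_le_add]
    refine le_csInf (hne.image _) ?_
    rintro _ ⟨z, hz, rfl⟩
    have h1 := g.rdist_le_add hy (hS hz) hl
    have h2 : g.rdistTo x S ≤ g.rdist x z := csInf_le (g.bddBelow_rdist x S) ⟨z, hz, rfl⟩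
    linarith
  refine LipschitzOnWith.continuousOn (K := C.toNNReal) (LipschitzOnWith.of_dist_le_mul ?_)
  intro x hx y hy
  rw [Real.coe_toNNReal _ hC0, Real.dist_eq, dist_eq_norm, abs_le]
  have h1 := key x hx y hy
  have h2 := key y hy x hx
  rw [norm_sub_rev] at h2
  constructor <;> linarith

end DiskMetric

/-! ### Foliation charts -/

/-- The open rectangle `(-ε, ε) × (-ε, L + ε)`. -/
def rectangle (L ε : ℝ) : Set (ℝ × ℝ) := Ioo (-ε) ε ×ˢ Ioo (-ε) (L + ε)

lemma isOpen_rectangle (L ε : ℝ) : IsOpen (rectangle L ε) := isOpen_Ioo.prod isOpen_Ioo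

lemma rectangle_mono {L ε ε' : ℝ} (h : ε ≤ ε') : rectangle L ε ⊆ rectangle L ε' :=
  prod_mono (Ioo_subset_Ioo (by linarith) h) (Ioo_subset_Ioo (by linarith) (by linarith))

/-- A tube lemma: in the sup distance of ℝ × ℝ the ε-thickening of {0} × [0, L] contains the
rectangle. -/
lemma exists_rectangle {L : ℝ} (hL : 0 < L) {P : ℝ × ℝ → Prop}
    (h : ∀ s ∈ Icc 0 L, ∀ᶠ p in 𝓝 ((0 : ℝ), s), P p) :
    ∃ ε > 0, ∀ p ∈ rectangle L ε, P p := by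
  have hK : IsCompact (({0} : Set ℝ) ×ˢ Icc 0 L) := isCompact_singleton.prod isCompact_Icc
  obtain ⟨ε, hε, hsub⟩ := hK.exists_thickening_subset_open (t := interior {p | P p})
    isOpen_interior (by
      rintro ⟨t, s⟩ ⟨ht, hs⟩
      rw [mem_singleton_iff] at ht
      simp only at ht hs
      subst ht
      exact mem_interior_iff_mem_nhds.mpr (h s hs))
  refine ⟨ε, hε, fun p hp => interior_subset (hsub ?_)⟩
  obtain ⟨⟨h1, h2⟩, h3, h4⟩ := hp
  rw [Metric.mem_thickening_iff]
  -- The nearest point of the segment: the second coordinate is clamped to [0, L].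
  refine ⟨(0, max 0 (min p.2 L)), ⟨rfl, le_max_left _ _, max_le hL.le (min_le_right _ _)⟩, ?_⟩
  rw [Prod.dist_eq, max_lt_iff, Real.dist_eq, Real.dist_eq, abs_lt, abs_lt]
  refine ⟨⟨by simpa using h1, by simpa using h2⟩, ?_⟩
  rcases max_cases 0 (min p.2 L) with ⟨h5, h6⟩ | ⟨h5, h6⟩ <;>
    rcases min_cases p.2 L with ⟨h7, h8⟩ | ⟨h7, h8⟩ <;>
    constructor <;> simp only [h5] <;> linarith

/-- A function with negative partial derivative changes sign along its zero set. -/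
lemma eventually_sign {N D : ℝ × ℝ → ℝ} {a e : ℝ}
    (hd : ∀ᶠ p in 𝓝 (a, e), HasDerivAt (fun σ => N (p.1, σ)) (D p) p.2)
    (hD : ContinuousAt D (a, e)) (hneg : D (a, e) < 0) :
    ∀ᶠ p in 𝓝 (a, e), N (p.1, e) = 0 → (e < p.2 → N p < 0) ∧ (p.2 < e → 0 < N p) := by
  have h := hd.and (hD.eventually_lt continuousAt_const hneg)
  obtain ⟨r, hr, hball⟩ := Metric.eventually_nhds_iff_ball.mp h
  filter_upwards [Metric.ball_mem_nhds (a, e) hr] with p hp h0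
  rw [← ball_prod_same] at hp hball
  have hd' : ∀ σ ∈ Metric.ball e r, HasDerivAt (fun σ => N (p.1, σ)) (D (p.1, σ)) σ :=
    fun σ hσ => (hball (p.1, σ) ⟨hp.1, hσ⟩).1
  have hanti : StrictAntiOn (fun σ => N (p.1, σ)) (Metric.ball e r) := by
    refine strictAntiOn_of_deriv_neg (convex_ball e r)
      (fun σ hσ => (hd' σ hσ).continuousAt.continuousWithinAt) fun σ hσ => ?_
    rw [(hd' σ (interior_subset hσ)).deriv]
    exact (hball (p.1, σ) ⟨hp.1, interior_subset hσ⟩).2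
  have he : e ∈ Metric.ball e r := Metric.mem_ball_self hr
  constructor <;> intro hlt
  · have := hanti he hp.2 hlt
    simpa [h0] using this
  · have := hanti hp.2 he hlt
    simpa [h0] using this

lemma hasDerivAt_snd_of_contDiff {F : ℝ × ℝ → Plane} (hF : ContDiff ℝ ∞ F) (p : ℝ × ℝ) :
    HasDerivAt (fun σ => F (p.1, σ)) (fderiv ℝ F p (0, 1)) p.2 :=
  ((hF.differentiable (by simp)).differentiableAt (x := p)).hasFDerivAt.comp_hasDerivAt p.2
    ((hasDerivAt_const p.2 p.1).prodMk (hasDerivAt_id p.2))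

lemma hasDerivAt_fst_of_contDiff {F : ℝ × ℝ → Plane} (hF : ContDiff ℝ ∞ F) (p : ℝ × ℝ) :
    HasDerivAt (fun τ => F (τ, p.2)) (fderiv ℝ F p (1, 0)) p.1 :=
  ((hF.differentiable (by simp)).differentiableAt (x := p)).hasFDerivAt.comp_hasDerivAt p.1
    ((hasDerivAt_id p.1).prodMk (hasDerivAt_const p.1 p.2))

lemma continuous_fderiv_apply {F : ℝ × ℝ → Plane} (hF : ContDiff ℝ ∞ F) (v : ℝ × ℝ) :
    Continuous fun p => fderiv ℝ F p v :=
  (hF.continuous_fderiv (by simp)).clm_apply continuous_const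

lemma fderiv_eq_add (F : ℝ × ℝ → Plane) (p v : ℝ × ℝ) :
    fderiv ℝ F p v = v.1 • fderiv ℝ F p (1, 0) + v.2 • fderiv ℝ F p (0, 1) := by
  rw [← map_smul, ← map_smul, ← map_add]
  simp

lemma exists_equiv_of_injective {F : ℝ × ℝ → Plane} (hF : ContDiff ℝ ∞ F) {p : ℝ × ℝ}
    (h : Function.Injective (fderiv ℝ F p)) :
    ∃ A : (ℝ × ℝ) ≃L[ℝ] Plane, (A : (ℝ × ℝ) →L[ℝ] Plane) = fderiv ℝ F p ∧
      HasStrictFDerivAt F (A : (ℝ × ℝ) →L[ℝ] Plane) p := by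
  have hfin : Module.finrank ℝ (ℝ × ℝ) = Module.finrank ℝ Plane := by simp
  let A := (LinearEquiv.ofInjectiveOfFinrankEq (fderiv ℝ F p : (ℝ × ℝ) →ₗ[ℝ] Plane)
    h hfin).toContinuousLinearEquiv
  have hA : (A : (ℝ × ℝ) →L[ℝ] Plane) = fderiv ℝ F p := by
    ext v <;> rfl
  refine ⟨A, hA, ?_⟩
  rw [hA]
  exact hF.contDiffAt.hasStrictFDerivAt (by simp)

namespace DiskMetric

variable (g : DiskMetric)

/-- A family of curves that is a chart near the curve `F(0, ·)`, with bounds on its first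
fundamental form: the distance between leaves lies between `m / √2` and `√2 M` times the parameter
distance. -/
structure IsFoliationChart (L ε m M : ℝ) (F : ℝ × ℝ → Plane) : Prop where
  smooth : ContDiff ℝ ∞ F
  injOn : InjOn F (rectangle L ε)
  mem_disk_iff : ∀ p ∈ rectangle L ε, F p ∈ disk ↔ p.2 ∈ Icc 0 L
  interior : ∀ p ∈ rectangle L ε, p.2 ∈ Ioo 0 L → F p ∈ Metric.ball (0 : Plane) 1
  speed_pos : ∀ p ∈ rectangle L ε, 0 < g.form (F p) (fderiv ℝ F p (0, 1)) (fderiv ℝ F p (0, 1))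
  lower : ∀ p ∈ rectangle L ε,
    m ^ 2 / 2 * g.form (F p) (fderiv ℝ F p (0, 1)) (fderiv ℝ F p (0, 1))
      < g.form (F p) (fderiv ℝ F p (0, 1)) (fderiv ℝ F p (0, 1))
          * g.form (F p) (fderiv ℝ F p (1, 0)) (fderiv ℝ F p (1, 0))
        - g.form (F p) (fderiv ℝ F p (1, 0)) (fderiv ℝ F p (0, 1)) ^ 2
  upper : ∀ p ∈ rectangle L ε,
    g.form (F p) (fderiv ℝ F p (1, 0)) (fderiv ℝ F p (1, 0)) < 2 * M ^ 2

variable {g} {L ε m M : ℝ} {F : ℝ × ℝ → Plane}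

lemma IsFoliationChart.mono (h : g.IsFoliationChart L ε m M F) {ε' : ℝ} (hε : ε' ≤ ε) :
    g.IsFoliationChart L ε' m M F where
  smooth := h.smooth
  injOn := h.injOn.mono (rectangle_mono hε)
  mem_disk_iff p hp := h.mem_disk_iff p (rectangle_mono hε hp)
  interior p hp := h.interior p (rectangle_mono hε hp)
  speed_pos p hp := h.speed_pos p (rectangle_mono hε hp)
  lower p hp := h.lower p (rectangle_mono hε hp)
  upper p hp := h.upper p (rectangle_mono hε hp)

/-- Let E, B, G be the coefficients of the pulled-back metric for ds², ds dt, dt². Completing the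
square, E times the right side is (v₂E + v₁B)² + (EG - B²)v₁². So only the part of ∂F/∂t normal to
the leaf counts, which is what the `lower` field bounds. -/
lemma IsFoliationChart.sq_le_form (h : g.IsFoliationChart L ε m M F) {p : ℝ × ℝ}
    (hp : p ∈ rectangle L ε) (v : ℝ × ℝ) :
    m ^ 2 / 2 * v.1 ^ 2 ≤ g.form (F p) (fderiv ℝ F p v) (fderiv ℝ F p v) := by
  have hE := h.speed_pos p hp
  have hl := h.lower p hp
  rw [fderiv_eq_add]
  have hsymm := g.symm (F p) (fderiv ℝ F p (0, 1)) (fderiv ℝ F p (1, 0))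
  simp only [map_add, map_smul, add_apply, smul_apply, smul_eq_mul, hsymm]
  set E := g.form (F p) (fderiv ℝ F p (0, 1)) (fderiv ℝ F p (0, 1))
  set G := g.form (F p) (fderiv ℝ F p (1, 0)) (fderiv ℝ F p (1, 0))
  set B := g.form (F p) (fderiv ℝ F p (1, 0)) (fderiv ℝ F p (0, 1))
  refine le_of_mul_le_mul_left ?_ hE
  nlinarith [sq_nonneg (v.2 * E + v.1 * B), mul_nonneg (sub_nonneg.mpr hl.le) (sq_nonneg v.1)]

lemma IsFoliationChart.injective_fderiv (h : g.IsFoliationChart L ε m M F) {p : ℝ × ℝ}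
    (hp : p ∈ rectangle L ε) (hm : 0 < m) : Function.Injective (fderiv ℝ F p) := by
  rw [injective_iff_map_eq_zero]
  intro v hv
  have h1 := h.sq_le_form hp v
  rw [hv] at h1
  simp only [map_zero] at h1
  have hv1 : v.1 = 0 := by
    have : v.1 ^ 2 ≤ 0 := by
      by_contra! hcon
      have : 0 < m ^ 2 / 2 * v.1 ^ 2 := by positivity
      linarith
    exact pow_eq_zero_iff two_ne_zero |>.mp (le_antisymm this (sq_nonneg _))
  have hne : fderiv ℝ F p (0, 1) ≠ 0 := fun h0 => by
    have := h.speed_pos p hp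
    simp [h0] at this
  rw [fderiv_eq_add, hv1, zero_smul, zero_add, smul_eq_zero] at hv
  exact Prod.ext hv1 (hv.resolve_right hne)

/-- The differential of a foliation chart as a linear equivalence. -/
lemma IsFoliationChart.exists_equiv (h : g.IsFoliationChart L ε m M F) {p : ℝ × ℝ}
    (hp : p ∈ rectangle L ε) (hm : 0 < m) :
    ∃ A : (ℝ × ℝ) ≃L[ℝ] Plane, (A : (ℝ × ℝ) →L[ℝ] Plane) = fderiv ℝ F p ∧
      HasStrictFDerivAt F (A : (ℝ × ℝ) →L[ℝ] Plane) p :=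
  exists_equiv_of_injective h.smooth (h.injective_fderiv hp hm)

lemma IsFoliationChart.image_mem_nhds (h : g.IsFoliationChart L ε m M F) {p : ℝ × ℝ}
    (hp : p ∈ rectangle L ε) (hm : 0 < m) {U : Set (ℝ × ℝ)} (hU : U ∈ 𝓝 p) : F '' U ∈ 𝓝 (F p) := by
  obtain ⟨A, -, hA⟩ := h.exists_equiv hp hm
  rw [← hA.map_nhds_eq_of_equiv]
  exact image_mem_map hU

/-- The inverse of a foliation chart is differentiable, and its first component has gradient at
most `√2 / m`. -/
lemma IsFoliationChart.hasFDerivAt_invFunOn (h : g.IsFoliationChart L ε m M F) {p : ℝ × ℝ}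
    (hp : p ∈ rectangle L ε) (hm : 0 < m) :
    ∃ B : Plane →L[ℝ] ℝ × ℝ, HasFDerivAt (Function.invFunOn F (rectangle L ε)) B (F p) ∧
      ∀ v, |(B v).1| ≤ Real.sqrt 2 / m * g.norm (F p) v := by
  obtain ⟨A, hAF, hA⟩ := h.exists_equiv hp hm
  refine ⟨A.symm, ?_, fun v => ?_⟩
  -- Near F(p) the local inverse takes values in the rectangle, where injectivity of F identifies it
  -- with `Function.invFunOn`.
  · refine hA.to_localInverse.hasFDerivAt.congr_of_eventuallyEq ?_
    have hW : rectangle L ε ∈ 𝓝 p := (isOpen_rectangle L ε).mem_nhds hp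
    filter_upwards [hA.eventually_right_inverse, hA.localInverse_tendsto hW] with y hy hyW
    conv_lhs => rw [← hy]
    exact h.injOn.leftInvOn_invFunOn hyW
  · have h1 := h.sq_le_form hp (A.symm v)
    rw [← hAF] at h1
    simp only [ContinuousLinearEquiv.coe_coe, ContinuousLinearEquiv.apply_symm_apply] at h1
    have h2 : |(A.symm v).1| ^ 2 ≤ (Real.sqrt 2 / m) ^ 2 * g.form (F p) v v := by
      rw [sq_abs, div_pow, Real.sq_sqrt zero_le_two, div_mul_eq_mul_div, le_div_iff₀ (by positivity)]
      linarith
    have h3 := Real.abs_le_sqrt h2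
    rwa [abs_abs, Real.sqrt_mul (sq_nonneg _), Real.sqrt_sq (by positivity)] at h3

end DiskMetric

/-! ### Distance to the central leaf -/

namespace DiskMetric

variable {g : DiskMetric} {L ε m M : ℝ} {F : ℝ × ℝ → Plane}

/-- A path in the disk that starts outside the leaves with parameter in `(-τ, τ)` and ends on the
central leaf has length at least `τ m / √2`. -/
lemma IsFoliationChart.le_length (h : g.IsFoliationChart L ε m M F) (hm : 0 < m)
    {τ : ℝ} (hτ : 0 < τ) (hτε : τ < ε) {x : Plane}
    (hx : x ∉ F '' (Ioo (-τ) τ ×ˢ Icc 0 L)) {y : Plane} (hy : y ∈ (fun s => F (0, s)) '' Icc 0 L)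
    {l : ℝ} (hl : l ∈ g.pathLengths x y) : τ * m / Real.sqrt 2 ≤ l := by
  obtain ⟨c, hc, hcd, hc0, hc1, rfl⟩ := hl
  have hε : 0 < ε := hτ.trans hτε
  set W := rectangle L ε with hW
  set O := F '' (Ioo (-τ) τ ×ˢ Icc 0 L) with hO
  -- V runs past the ends of the leaves so as to be open in the plane. Its points in the disk
  -- already lie in O.
  set V := F '' (Ioo (-τ) τ ×ˢ Ioo (-ε) (L + ε)) with hV
  have hIoo : ∀ {t s : ℝ}, t ∈ Icc (-τ) τ → s ∈ Icc 0 L → (t, s) ∈ W := fun ht hs =>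
    ⟨⟨by linarith [ht.1], by linarith [ht.2]⟩, by linarith [hs.1], by linarith [hs.2]⟩
  have hVopen : IsOpen V := by
    rw [isOpen_iff_mem_nhds]
    rintro _ ⟨p, hp, rfl⟩
    refine h.image_mem_nhds ⟨⟨?_, ?_⟩, hp.2⟩ hm ((isOpen_Ioo.prod isOpen_Ioo).mem_nhds hp)
    · linarith [hp.1.1]
    · linarith [hp.1.2]
  have hOV : ∀ z ∈ disk, z ∈ V → z ∈ O := by
    rintro _ hz ⟨p, hp, rfl⟩
    have hpW : p ∈ W := ⟨⟨by linarith [hp.1.1], by linarith [hp.1.2]⟩, hp.2⟩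
    exact ⟨p, ⟨hp.1, (h.mem_disk_iff p hpW).mp hz⟩, rfl⟩
  have hOsub : O ⊆ V := image_mono (Set.prod_mono le_rfl fun s hs =>
    ⟨by linarith [hs.1], by linarith [hs.2]⟩)
  have hcomp : IsCompact (Icc (0 : ℝ) 1 ∩ c ⁻¹' Vᶜ) :=
    isCompact_Icc.of_isClosed_subset
      (hc.continuousOn.preimage_isClosed_of_isClosed isClosed_Icc hVopen.isClosed_compl)
      inter_subset_left
  have h0mem : (0 : ℝ) ∈ Icc (0 : ℝ) 1 := ⟨le_rfl, zero_le_one⟩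
  -- The last time at which the path is outside V. From then on it stays in the chart and its leaf
  -- parameter travels from ±τ to 0.
  obtain ⟨σ₀, ⟨hσI, hσV⟩, hσmax⟩ := hcomp.exists_isGreatest
    ⟨0, h0mem, fun hmem => hx (hc0 ▸ hOV _ (hcd h0mem) hmem)⟩
  have hσ1 : σ₀ < 1 := by
    refine hσI.2.lt_of_ne fun heq => hσV ?_
    rw [heq, hc1]
    obtain ⟨s, hs, rfl⟩ := hy
    exact hOsub ⟨(0, s), ⟨⟨by simpa using hτ, hτ⟩, hs⟩, rfl⟩
  have hafter : ∀ σ ∈ Ioc σ₀ 1, c σ ∈ O := by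
    intro σ hσ
    have hσ' : σ ∈ Icc (0 : ℝ) 1 := ⟨hσI.1.trans hσ.1.le, hσ.2⟩
    refine hOV _ (hcd hσ') ?_
    by_contra hcon
    exact hσ.1.not_ge (hσmax ⟨hσ', hcon⟩)
  have hsubI : Icc σ₀ 1 ⊆ Icc (0 : ℝ) 1 := Icc_subset_Icc_left hσI.1
  -- At σ₀ the path is a limit of points of O, so it lies in the compact image of the closed strip.
  -- Being outside V, it has |t₀| = τ.
  obtain ⟨⟨t₀, s₀⟩, ⟨ht₀, hs₀⟩, hF₀⟩ : c σ₀ ∈ F '' (Icc (-τ) τ ×ˢ Icc 0 L) := by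
    have hclosed : IsClosed (F '' (Icc (-τ) τ ×ˢ Icc 0 L)) :=
      ((isCompact_Icc.prod isCompact_Icc).image h.smooth.continuous).isClosed
    rw [← hclosed.closure_eq]
    have hcw : ContinuousWithinAt c (Ioc σ₀ 1) σ₀ :=
      (hc.continuousOn σ₀ hσI).mono (Ioc_subset_Icc_self.trans hsubI)
    refine closure_mono ?_ (hcw.mem_closure_image ?_)
    · rintro _ ⟨σ, hσ, rfl⟩
      exact image_mono (Set.prod_mono Ioo_subset_Icc_self le_rfl) (hafter σ hσ)
    · rw [closure_Ioc hσ1.ne]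
      exact left_mem_Icc.mpr hσ1.le
  simp only at ht₀ hs₀
  have ht₀abs : |t₀| = τ := by
    refine le_antisymm (abs_le.mpr ht₀) ?_
    by_contra! hlt
    exact hσV (hOsub ⟨(t₀, s₀), ⟨abs_lt.mp hlt, hs₀⟩, hF₀⟩)
  set inv := Function.invFunOn F W
  have hinv : ∀ p ∈ W, inv (F p) = p := fun p hp => h.injOn.leftInvOn_invFunOn hp
  set f : ℝ → ℝ := fun σ => (inv (c σ)).1 with hf
  have hmemW : ∀ σ ∈ Icc σ₀ 1, ∃ p ∈ W, F p = c σ := by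
    intro σ hσ
    rcases hσ.1.eq_or_lt with heq | hlt
    · exact ⟨(t₀, s₀), hIoo ht₀ hs₀, heq ▸ hF₀⟩
    · obtain ⟨p, hp, hpe⟩ := hafter σ ⟨hlt, hσ.2⟩
      exact ⟨p, hIoo (Ioo_subset_Icc_self hp.1) hp.2, hpe⟩
  have hcont : ContinuousOn f (Icc σ₀ 1) := by
    intro σ hσ
    obtain ⟨p, hp, hpe⟩ := hmemW σ hσ
    obtain ⟨B, hB, -⟩ := h.hasFDerivAt_invFunOn hp hm
    rw [hpe] at hB
    exact (continuous_fst.continuousAt.comp hB.continuousAt).comp_continuousWithinAt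
      ((hc.continuousOn σ (hsubI hσ)).mono hsubI)
  have hder : ∀ σ ∈ Ioo σ₀ 1, ∃ f' : ℝ, HasDerivAt f f' σ ∧
      |f'| ≤ Real.sqrt 2 / m * g.norm (c σ) (deriv c σ) := by
    intro σ hσ
    obtain ⟨p, hp, hpe⟩ := hmemW σ (Ioo_subset_Icc_self hσ)
    obtain ⟨B, hB, hBn⟩ := h.hasFDerivAt_invFunOn hp hm
    rw [hpe] at hB hBn
    have hcσ : HasDerivAt c (deriv c σ) σ :=
      (hasDerivAt_derivWithin_Icc hc ⟨hσI.1.trans_lt hσ.1, hσ.2⟩).differentiableAt.hasDerivAt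
    have hinvd : HasDerivAt (fun σ => inv (c σ)) (B (deriv c σ)) σ := hB.comp_hasDerivAt σ hcσ
    have hfst : HasFDerivAt (Prod.fst : ℝ × ℝ → ℝ) (ContinuousLinearMap.fst ℝ ℝ ℝ) (inv (c σ)) :=
      hasFDerivAt_fst
    have hfd : HasDerivAt f (ContinuousLinearMap.fst ℝ ℝ ℝ (B (deriv c σ))) σ :=
      HasFDerivAt.comp_hasDerivAt σ hfst hinvd
    exact ⟨(B (deriv c σ)).1, hfd, hBn _⟩
  choose! f' hf' hf'n using hder
  have hint01 : IntervalIntegrable (fun σ => g.norm (c σ) (deriv c σ)) volume 0 1 :=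
    g.intervalIntegrable_speed one_pos hc
  have hint : IntegrableOn (fun σ => Real.sqrt 2 / m * g.norm (c σ) (deriv c σ)) (Icc σ₀ 1) := by
    have h1 := (intervalIntegrable_iff_integrableOn_Icc_of_le zero_le_one).mp hint01
    exact (h1.mono_set hsubI).const_mul _
  have hf0 : |f σ₀| = τ := by
    simp only [hf]
    rw [← hF₀, hinv _ (hIoo ht₀ hs₀)]
    exact ht₀abs
  have hf1 : f 1 = 0 := by
    obtain ⟨s, hs, rfl⟩ := hy
    simp only [hf]
    rw [hc1, hinv _ (hIoo ⟨by linarith, hτ.le⟩ hs)]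
  have hle : τ ≤ ∫ σ in σ₀..1, Real.sqrt 2 / m * g.norm (c σ) (deriv c σ) := by
    rw [← hf0]
    refine abs_le'.mpr ⟨?_, ?_⟩
    · have := intervalIntegral.sub_le_integral_of_hasDeriv_right_of_le hσ1.le hcont.neg
        (fun σ hσ => (hf' σ hσ).neg.hasDerivWithinAt) hint
        (fun σ hσ => (neg_le_abs _).trans (hf'n σ hσ))
      simpa [hf1] using this
    · have := intervalIntegral.sub_le_integral_of_hasDeriv_right_of_le hσ1.le hcont
        (fun σ hσ => (hf' σ hσ).hasDerivWithinAt) hint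
        (fun σ hσ => (le_abs_self _).trans (hf'n σ hσ))
      simpa [hf1] using this
  rw [intervalIntegral.integral_const_mul] at hle
  have hmono : ∫ σ in σ₀..1, g.norm (c σ) (deriv c σ) ≤ ∫ σ in (0 : ℝ)..1, g.norm (c σ) (deriv c σ) :=
    intervalIntegral.integral_mono_interval hσI.1 hσ1.le le_rfl
      (Eventually.of_forall fun _ => g.norm_nonneg _ _) hint01
  have h2 : 0 < Real.sqrt 2 := by positivity
  rw [div_le_iff₀ h2, ← le_div_iff₀ hm]
  calc τ ≤ _ := hle
    _ ≤ Real.sqrt 2 / m * ∫ σ in (0 : ℝ)..1, g.norm (c σ) (deriv c σ) := by gcongr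
    _ = _ := by ring

lemma IsFoliationChart.mem_rectangle {t s : ℝ} (ht : |t| < ε) (hs : s ∈ Icc 0 L) :
    (t, s) ∈ rectangle L ε :=
  ⟨abs_lt.mp ht, by linarith [hs.1, abs_nonneg t], by linarith [hs.2, abs_nonneg t]⟩

lemma IsFoliationChart.mem_disk (h : g.IsFoliationChart L ε m M F) {t s : ℝ} (ht : |t| < ε)
    (hs : s ∈ Icc 0 L) : F (t, s) ∈ disk :=
  (h.mem_disk_iff _ (mem_rectangle ht hs)).mpr hs

lemma IsFoliationChart.le_rdistTo (h : g.IsFoliationChart L ε m M F) (hm : 0 < m) (hL : 0 ≤ L)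
    {τ : ℝ} (hτ : 0 < τ) (hτε : τ < ε) {x : Plane} (hxd : x ∈ disk)
    (hx : x ∉ F '' (Ioo (-τ) τ ×ˢ Icc 0 L)) :
    τ * m / Real.sqrt 2 ≤ g.rdistTo x ((fun s => F (0, s)) '' Icc 0 L) := by
  refine g.le_rdistTo hxd ?_ ((nonempty_Icc.mpr hL).image _) fun y hy l hl =>
    h.le_length hm hτ hτε hx hy hl
  rintro _ ⟨s, hs, rfl⟩
  exact h.mem_disk (by simpa using hτ.trans hτε) hs

/-- The competitor is the transverse curve r ↦ F(t(1 - r), s), whose speed |t| |∂F/∂t| is at most √2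
M|t| by the `upper` field. -/
lemma IsFoliationChart.rdistTo_le (h : g.IsFoliationChart L ε m M F) (hM : 0 ≤ M) {t s : ℝ}
    (ht : |t| < ε) (hs : s ∈ Icc 0 L) :
    g.rdistTo (F (t, s)) ((fun s => F (0, s)) '' Icc 0 L) ≤ Real.sqrt 2 * M * |t| := by
  have hlt : ∀ r ∈ Icc (0 : ℝ) 1, |t * (1 - r)| < ε := fun r hr => by
    rw [abs_mul, abs_of_nonneg (by linarith [hr.2] : 0 ≤ 1 - r)]
    have : |t| * (1 - r) ≤ |t| := mul_le_of_le_one_right (abs_nonneg _) (by linarith [hr.1])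
    linarith
  have hline : ContDiff ℝ ∞ fun r : ℝ => (t * (1 - r), s) := by fun_prop
  have hC : ContDiff ℝ ∞ fun r : ℝ => F (t * (1 - r), s) := h.smooth.comp hline
  have hd : ∀ r : ℝ, deriv (fun r : ℝ => F (t * (1 - r), s)) r
      = (-t) • fderiv ℝ F (t * (1 - r), s) (1, 0) := fun r => by
    have h1 : HasDerivAt (fun r : ℝ => t * (1 - r)) (-t) r := by
      simpa using ((hasDerivAt_id r).const_sub 1).const_mul t
    exact ((hasDerivAt_fst_of_contDiff h.smooth (t * (1 - r), s)).scomp r h1).deriv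
  have hmem : F (0, s) ∈ (fun s => F (0, s)) '' Icc 0 L := ⟨s, hs, rfl⟩
  refine (g.rdistTo_le (y := F (0, s)) (l := ∫ r in (0 : ℝ)..1, g.norm (F (t * (1 - r), s))
    (deriv (fun r : ℝ => F (t * (1 - r), s)) r)) hmem
    ⟨fun r => F (t * (1 - r), s), (hC.of_le (by simp)).contDiffOn,
      fun r hr => h.mem_disk (hlt r hr) hs, by simp, by simp, rfl⟩).trans ?_
  calc _ ≤ ∫ r in (0 : ℝ)..1, Real.sqrt 2 * M * |t| := by
        refine intervalIntegral.integral_mono_on zero_le_one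
          (g.continuousOn_norm_comp hC.continuous.continuousOn
            (contDiff_deriv hC).continuous.continuousOn).intervalIntegrable
          (by simp) fun r hr => ?_
        rw [hd, norm_smul, abs_neg, mul_comm]
        refine mul_le_mul_of_nonneg_right ?_ (abs_nonneg _)
        rw [norm, ← Real.sqrt_sq hM, ← Real.sqrt_mul zero_le_two]
        exact Real.sqrt_le_sqrt (h.upper _ (mem_rectangle (hlt r hr) hs)).le
    _ = _ := by simp

/-- The leaf with parameter `t` has distance ratio at most `2 M / m`. -/
lemma IsFoliationChart.distanceRatioLE (h : g.IsFoliationChart L ε m M F) (hm : 0 < m)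
    (hM : 0 ≤ M) (hL : 0 ≤ L) {γ : ℝ → Plane} (hγ : ∀ s ∈ Icc 0 L, F (0, s) = γ s) {t : ℝ}
    (ht0 : t ≠ 0) (ht : |t| < ε) :
    g.DistanceRatioLE γ L ((fun s => F (t, s)) '' Icc 0 L) (2 * (M / m)) := by
  have himg : γ '' Icc 0 L = (fun s => F (0, s)) '' Icc 0 L :=
    image_congr fun s hs => (hγ s hs).symm
  have hτ : 0 < |t| := abs_pos.mpr ht0
  have hε : 0 < ε := hτ.trans ht
  have hne : (Icc 0 L).Nonempty := nonempty_Icc.mpr hL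
  have hleaf : IsCompact ((fun s => F (t, s)) '' Icc 0 L) :=
    isCompact_Icc.image (h.smooth.continuous.comp (by fun_prop))
  have hleafd : (fun s => F (t, s)) '' Icc 0 L ⊆ disk := by
    rintro _ ⟨s, hs, rfl⟩
    exact h.mem_disk ht hs
  have hSd : (fun s => F (0, s)) '' Icc 0 L ⊆ disk := by
    rintro _ ⟨s, hs, rfl⟩
    exact h.mem_disk (by simpa using hε) hs
  have hcomp := hleaf.image_of_continuousOn
    ((g.continuousOn_rdistTo hSd (hne.image _)).mono hleafd)
  have hlow : ∀ x ∈ (fun s => F (t, s)) '' Icc 0 L,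
      |t| * m / Real.sqrt 2 ≤ g.rdistTo x ((fun s => F (0, s)) '' Icc 0 L) := by
    rintro _ ⟨s, hs, rfl⟩
    refine h.le_rdistTo hm hL hτ ht (h.mem_disk ht hs) ?_
    rintro ⟨p, hp, hpe⟩
    have hpW : p ∈ rectangle L ε := mem_rectangle ((abs_lt.mpr hp.1).trans ht) hp.2
    have := h.injOn hpW (mem_rectangle ht hs) hpe
    rw [this] at hp
    exact (abs_lt.mpr hp.1).ne rfl
  unfold DistanceRatioLE
  rw [himg]
  obtain ⟨D, hD⟩ := hcomp.exists_isGreatest ((hne.image _).image _)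
  obtain ⟨d, hd⟩ := hcomp.exists_isLeast ((hne.image _).image _)
  have h2 : 0 < Real.sqrt 2 := by positivity
  have hdlow : |t| * m / Real.sqrt 2 ≤ d := by
    obtain ⟨x, hx, rfl⟩ := hd.1
    exact hlow x hx
  have hd0 : 0 < d := lt_of_lt_of_le (by positivity) hdlow
  have hDup : D ≤ Real.sqrt 2 * M * |t| := by
    obtain ⟨_, ⟨s, hs, rfl⟩, rfl⟩ := hD.1
    exact h.rdistTo_le hM ht hs
  refine ⟨D, d, hD, hd, hd0, ?_⟩
  rw [div_le_iff₀ hd0]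
  have hs2 : Real.sqrt 2 * Real.sqrt 2 = 2 := Real.mul_self_sqrt zero_le_two
  calc D ≤ Real.sqrt 2 * M * |t| := hDup
    _ = 2 * (M / m) * (|t| * m / Real.sqrt 2) := by
      field_simp
      linear_combination M * hs2
    _ ≤ 2 * (M / m) * d := by gcongr

end DiskMetric

/-! ### Existence of a foliation chart -/

namespace DiskMetric

variable {g : DiskMetric} {L : ℝ} {F : ℝ × ℝ → Plane} {γ : ℝ → Plane} {φ : ℝ → ℝ}

lemma fderiv_snd_eq_deriv (h : g.IsFreeBoundaryGeodesic γ L) (hγ : ContDiff ℝ ∞ γ)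
    (hF : ContDiff ℝ ∞ F) (hF0 : ∀ s ∈ Icc 0 L, F (0, s) = γ s) {s : ℝ} (hs : s ∈ Icc 0 L) :
    fderiv ℝ F (0, s) (0, 1) = deriv γ s :=
  HasDerivAt.eq_of_eqOn_Icc h.length_pos hs (hasDerivAt_snd_of_contDiff hF (0, s))
    (hasDerivAt_of_contDiff hγ s) hF0

lemma continuous_form_fderiv (hF : ContDiff ℝ ∞ F) (v w : ℝ × ℝ) :
    Continuous fun p => g.form (F p) (fderiv ℝ F p v) (fderiv ℝ F p w) :=
  ((g.smooth.continuous.comp hF.continuous).clm_apply (continuous_fderiv_apply hF v)).clm_apply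
    (continuous_fderiv_apply hF w)

/-- |x|² - 1 is a smooth defining function of the disk. Its sign along the leaves decides where they
enter and leave. -/
lemma mem_disk_iff_inner (x : Plane) : x ∈ disk ↔ inner ℝ x x - 1 ≤ 0 := by
  rw [disk, mem_closedBall_zero_iff, real_inner_self_eq_norm_sq, sub_nonpos, sq_le_one_iff₀ (_root_.norm_nonneg x)]

lemma mem_ball_iff_inner (x : Plane) : x ∈ Metric.ball (0 : Plane) 1 ↔ inner ℝ x x - 1 < 0 := by
  rw [mem_ball_zero_iff, real_inner_self_eq_norm_sq, sub_neg, sq_lt_one_iff₀ (_root_.norm_nonneg x)]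

lemma inner_self_of_mem_circle {x : Plane} (hx : x ∈ circle) : inner ℝ x x - 1 = 0 := by
  rw [circle, mem_sphere_zero_iff_norm] at hx
  rw [real_inner_self_eq_norm_sq, hx]
  norm_num

lemma hasDerivAt_inner_self (hF : ContDiff ℝ ∞ F) (p : ℝ × ℝ) :
    HasDerivAt (fun σ => inner ℝ (F (p.1, σ)) (F (p.1, σ)) - 1)
      (2 * inner ℝ (F p) (fderiv ℝ F p (0, 1))) p.2 := by
  have h := hasDerivAt_snd_of_contDiff hF p
  refine ((h.inner ℝ h).sub_const 1).congr_deriv ?_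
  rw [real_inner_comm (F (p.1, p.2))]
  ring

/-- Near the central leaf, the family stays in the disk exactly for parameters in `[0, L]`. -/
lemma eventually_mem_disk_iff (h : g.IsFreeBoundaryGeodesic γ L) (hγ : ContDiff ℝ ∞ γ)
    (hF : ContDiff ℝ ∞ F) (hF0 : ∀ s ∈ Icc 0 L, F (0, s) = γ s)
    (hFs : ∀ t, F (t, 0) ∈ circle) (hFe : ∀ t, F (t, L) ∈ circle)
    (hin : inner ℝ (γ 0) (deriv γ 0) < 0) (hout : 0 < inner ℝ (γ L) (deriv γ L))
    {s : ℝ} (hs : s ∈ Icc 0 L) :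
    ∀ᶠ p in 𝓝 ((0 : ℝ), s), (F p ∈ disk ↔ p.2 ∈ Icc 0 L) ∧
      (p.2 ∈ Ioo 0 L → F p ∈ Metric.ball (0 : Plane) 1) := by
  have hL := h.length_pos
  have h0m : (0 : ℝ) ∈ Icc 0 L := left_mem_Icc.mpr hL.le
  have hLm : L ∈ Icc 0 L := right_mem_Icc.mpr hL.le
  have hNc : Continuous fun p => inner ℝ (F p) (F p) - 1 :=
    (hF.continuous.inner hF.continuous).sub continuous_const
  have hDc : Continuous fun p => 2 * inner ℝ (F p) (fderiv ℝ F p (0, 1)) :=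
    continuous_const.mul (hF.continuous.inner (continuous_fderiv_apply hF _))
  rcases hs.1.eq_or_lt with h0 | h0
  · subst h0
    -- The defining function vanishes on s = 0 for every t. At (0, 0) its s-derivative is negative
    -- because γ points inwards, so it changes sign exactly there. At the other end the sign is
    -- reversed.
    have hev := eventually_sign (N := fun p => inner ℝ (F p) (F p) - 1) (a := 0) (e := 0)
      (Eventually.of_forall fun p => hasDerivAt_inner_self hF p) hDc.continuousAt (by
        rw [hF0 0 h0m, fderiv_snd_eq_deriv h hγ hF hF0 h0m]
        linarith)
    have hlt : ∀ᶠ p : ℝ × ℝ in 𝓝 (0, 0), p.2 < L :=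
      continuous_snd.continuousAt.eventually_lt continuousAt_const hL
    filter_upwards [hev, hlt] with p hp hpL
    have hp' := hp (inner_self_of_mem_circle (hFs p.1))
    rw [mem_disk_iff_inner, mem_ball_iff_inner]
    refine ⟨⟨fun hle => ⟨?_, hpL.le⟩, fun hmem => ?_⟩, fun hmem => hp'.1 hmem.1⟩
    · by_contra! hneg
      exact (hp'.2 hneg).not_ge hle
    · rcases hmem.1.eq_or_lt with he | hlt
      · have : p = (p.1, 0) := Prod.ext rfl he.symm
        rw [this]
        exact (inner_self_of_mem_circle (hFs p.1)).le
      · exact (hp'.1 hlt).le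
  rcases hs.2.eq_or_lt with h1 | h1
  · subst h1
    have hev := eventually_sign (N := fun p => -(inner ℝ (F p) (F p) - 1)) (a := 0) (e := s)
      (Eventually.of_forall fun p => (hasDerivAt_inner_self hF p).fun_neg) hDc.neg.continuousAt (by
        rw [hF0 s hLm, fderiv_snd_eq_deriv h hγ hF hF0 hLm]
        linarith)
    have hlt : ∀ᶠ p : ℝ × ℝ in 𝓝 (0, s), 0 < p.2 :=
      continuousAt_const.eventually_lt continuous_snd.continuousAt h0
    filter_upwards [hev, hlt] with p hp hpL
    have hp' := hp (by rw [inner_self_of_mem_circle (hFe p.1), neg_zero])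
    rw [mem_disk_iff_inner, mem_ball_iff_inner]
    refine ⟨⟨fun hle => ⟨hpL.le, ?_⟩, fun hmem => ?_⟩, fun hmem => by linarith [hp'.2 hmem.2]⟩
    · by_contra! hneg
      linarith [hp'.1 hneg]
    · rcases hmem.2.eq_or_lt with he | hlt
      · have : p = (p.1, s) := Prod.ext rfl he
        rw [this]
        exact (inner_self_of_mem_circle (hFe p.1)).le
      · linarith [hp'.2 hlt]
  · have hN : inner ℝ (F (0, s)) (F (0, s)) - 1 < 0 := by
      rw [hF0 s hs]
      exact (mem_ball_iff_inner _).mp (h.interior s ⟨h0, h1⟩)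
    have hev := hNc.continuousAt.eventually_lt (continuousAt_const (y := (0 : ℝ))) hN
    have hlt : ∀ᶠ p : ℝ × ℝ in 𝓝 (0, s), 0 < p.2 :=
      continuousAt_const.eventually_lt continuous_snd.continuousAt h0
    have hlt' : ∀ᶠ p : ℝ × ℝ in 𝓝 (0, s), p.2 < L :=
      continuous_snd.continuousAt.eventually_lt continuousAt_const h1
    filter_upwards [hev, hlt, hlt'] with p hp hp0 hp1
    rw [mem_disk_iff_inner, mem_ball_iff_inner]
    exact ⟨⟨fun _ => ⟨hp0.le, hp1.le⟩, fun _ => hp.le⟩, fun _ => hp⟩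

/-- On the central leaf the first fundamental form is φ²dt² + ds² with m ≤ φ ≤ M, so the required
inequalities hold strictly, with a factor 2 to spare, and persist nearby by compactness. Injectivity
persists because γ is injective and F is an immersion along the segment. -/
theorem exists_isFoliationChart (h : g.IsFreeBoundaryGeodesic γ L) (hγ : ContDiff ℝ ∞ γ)
    (hF : ContDiff ℝ ∞ F) (hF0 : ∀ s ∈ Icc 0 L, F (0, s) = γ s)
    (hFt : ∀ s ∈ Icc 0 L, fderiv ℝ F (0, s) (1, 0) = φ s • g.unitNormal γ s)
    (hFs : ∀ t, F (t, 0) ∈ circle) (hFe : ∀ t, F (t, L) ∈ circle)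
    (hin : inner ℝ (γ 0) (deriv γ 0) < 0) (hout : 0 < inner ℝ (γ L) (deriv γ L))
    {m M : ℝ} (hm : 0 < m) (hmφ : ∀ s ∈ Icc 0 L, m ≤ φ s) (hφM : ∀ s ∈ Icc 0 L, φ s ≤ M) :
    ∃ ε > 0, g.IsFoliationChart L ε m M F := by
  have hL := h.length_pos
  have hval : ∀ s ∈ Icc 0 L,
      g.form (F (0, s)) (fderiv ℝ F (0, s) (0, 1)) (fderiv ℝ F (0, s) (0, 1)) = 1 ∧
      g.form (F (0, s)) (fderiv ℝ F (0, s) (1, 0)) (fderiv ℝ F (0, s) (1, 0)) = φ s ^ 2 ∧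
      g.form (F (0, s)) (fderiv ℝ F (0, s) (1, 0)) (fderiv ℝ F (0, s) (0, 1)) = 0 := by
    intro s hs
    rw [hF0 s hs, hFt s hs, fderiv_snd_eq_deriv h hγ hF hF0 hs]
    simp only [map_smul, smul_apply, smul_eq_mul, h.form_unitNormal_self hs,
      form_unitNormal_deriv, h.unit_speed s hs]
    refine ⟨trivial, by ring, by ring⟩
  have hE := continuous_form_fderiv (g := g) hF (0, 1) (0, 1)
  have hG := continuous_form_fderiv (g := g) hF (1, 0) (1, 0)
  have hB := continuous_form_fderiv (g := g) hF (1, 0) (0, 1)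
  have hinj : ∃ U ∈ 𝓝ˢ (({0} : Set ℝ) ×ˢ Icc 0 L), InjOn F U := by
    refine InjOn.exists_mem_nhdsSet ?_ (isCompact_singleton.prod isCompact_Icc)
      (fun _ _ => hF.continuous.continuousAt) ?_
    · rintro ⟨t, s⟩ ⟨ht, hs⟩ ⟨t', s'⟩ ⟨ht', hs'⟩ heq
      rw [mem_singleton_iff] at ht ht'
      simp only at ht ht' hs hs'
      subst ht ht'
      rw [hF0 s hs, hF0 s' hs'] at heq
      rw [h.injOn hs hs' heq]
    · rintro ⟨t, s⟩ ⟨ht, hs⟩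
      rw [mem_singleton_iff] at ht
      simp only at ht hs
      subst ht
      have hinj : Function.Injective (fderiv ℝ F (0, s)) := by
        rw [injective_iff_map_eq_zero]
        intro v hv
        obtain ⟨h1, h2, h3⟩ := hval s hs
        have e1 := congrArg (fun w => g.form (F (0, s)) w (fderiv ℝ F (0, s) (0, 1))) hv
        have e2 := congrArg (fun w => g.form (F (0, s)) (fderiv ℝ F (0, s) (1, 0)) w) hv
        rw [fderiv_eq_add F (0, s) v] at e1 e2
        simp only [map_add, map_smul, add_apply, smul_apply, smul_eq_mul, h1, h2, h3,
          map_zero, zero_apply] at e1 e2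
        have hφ0 : φ s ^ 2 ≠ 0 := pow_ne_zero 2 (hm.trans_le (hmφ s hs)).ne'
        refine Prod.ext ?_ (by simpa using e1)
        simpa [hφ0] using e2
      obtain ⟨A, -, hA⟩ := exists_equiv_of_injective hF hinj
      exact ⟨hA.toOpenPartialHomeomorph.source,
        hA.toOpenPartialHomeomorph.open_source.mem_nhds hA.mem_toOpenPartialHomeomorph_source,
        hA.toOpenPartialHomeomorph.injOn⟩
  obtain ⟨U, hU, hUinj⟩ := hinj
  obtain ⟨ε, hε, hP⟩ := exists_rectangle hL (P := fun p => p ∈ U ∧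
      ((F p ∈ disk ↔ p.2 ∈ Icc 0 L) ∧ (p.2 ∈ Ioo 0 L → F p ∈ Metric.ball (0 : Plane) 1)) ∧
      0 < g.form (F p) (fderiv ℝ F p (0, 1)) (fderiv ℝ F p (0, 1)) ∧
      m ^ 2 / 2 * g.form (F p) (fderiv ℝ F p (0, 1)) (fderiv ℝ F p (0, 1))
        < g.form (F p) (fderiv ℝ F p (0, 1)) (fderiv ℝ F p (0, 1))
            * g.form (F p) (fderiv ℝ F p (1, 0)) (fderiv ℝ F p (1, 0))
          - g.form (F p) (fderiv ℝ F p (1, 0)) (fderiv ℝ F p (0, 1)) ^ 2 ∧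
      g.form (F p) (fderiv ℝ F p (1, 0)) (fderiv ℝ F p (1, 0)) < 2 * M ^ 2) (by
    intro s hs
    obtain ⟨h1, h2, h3⟩ := hval s hs
    have hφ1 := hmφ s hs
    have hφ2 := hφM s hs
    have hU' : ∀ᶠ p in 𝓝 ((0 : ℝ), s), p ∈ U := mem_nhdsSet_iff_forall.mp hU (0, s) ⟨rfl, hs⟩
    refine hU'.and
      ((eventually_mem_disk_iff h hγ hF hF0 hFs hFe hin hout hs).and
      ((continuousAt_const.eventually_lt hE.continuousAt ?_).and
      (((continuous_const.mul hE).continuousAt.eventually_lt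
        ((hE.mul hG).sub (hB.pow 2)).continuousAt ?_).and
      (hG.continuousAt.eventually_lt continuousAt_const ?_))))
    · rw [h1]
      exact one_pos
    · simp only [Pi.mul_apply, Pi.sub_apply, Pi.pow_apply, h1, h2, h3]
      nlinarith
    · rw [h2]
      nlinarith)
  exact ⟨ε, hε, ⟨hF, fun p hp q hq => hUinj (hP p hp).1 (hP q hq).1,
    fun p hp => (hP p hp).2.1.1, fun p hp => (hP p hp).2.1.2, fun p hp => (hP p hp).2.2.1,
    fun p hp => (hP p hp).2.2.2.1, fun p hp => (hP p hp).2.2.2.2⟩⟩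

end DiskMetric

/-! ### Curvature of the leaves and the foliation -/

lemma contDiff_fderiv_apply {F : ℝ × ℝ → Plane} (hF : ContDiff ℝ ∞ F) (v : ℝ × ℝ) :
    ContDiff ℝ ∞ fun p => fderiv ℝ F p v :=
  (hF.fderiv_right (by simp)).clm_apply contDiff_const

namespace DiskMetric

variable {g : DiskMetric} {L : ℝ} {F : ℝ × ℝ → Plane} {γ X : ℝ → Plane} {φ : ℝ → ℝ}

lemma contDiffAt_christoffelForm {E : Type*} [NormedAddCommGroup E] [NormedSpace ℝ E]
    {c u v : E → Plane} {p : E} (hc : ContDiffAt ℝ ∞ c p) (hu : ContDiffAt ℝ ∞ u p)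
    (hv : ContDiffAt ℝ ∞ v p) (hx : (g.gram (c p)).det ≠ 0) :
    ContDiffAt ℝ ∞ (fun q => g.christoffelForm (c q) (u q) (v q)) p := by
  rw [contDiffAt_euclidean] at hu hv ⊢
  intro k
  have : ContDiffAt ℝ ∞
      (fun q => ∑ i, ∑ j, g.christoffel k i j (c q) * u q i * v q j) p :=
    ContDiffAt.sum fun i _ => ContDiffAt.sum fun j _ =>
      (((g.contDiffAt_christoffel hx k i j).comp p hc).mul (hu i)).mul (hv j)
  exact this

variable (g) in
/-- The covariant acceleration of the curve `F(t, ·)` of a family. -/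
def leafAcceleration (F : ℝ × ℝ → Plane) (p : ℝ × ℝ) : Plane :=
  fderiv ℝ (fun q => fderiv ℝ F q (0, 1)) p (0, 1)
    + g.christoffelForm (F p) (fderiv ℝ F p (0, 1)) (fderiv ℝ F p (0, 1))

lemma deriv_snd_of_contDiff (hF : ContDiff ℝ ∞ F) (t s : ℝ) :
    deriv (fun σ => F (t, σ)) s = fderiv ℝ F (t, s) (0, 1) :=
  (hasDerivAt_snd_of_contDiff hF (t, s)).deriv

lemma acceleration_leaf (hF : ContDiff ℝ ∞ F) (t s : ℝ) :
    g.acceleration (fun σ => F (t, σ)) s = g.leafAcceleration F (t, s) := by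
  have h1 : deriv (fun σ => F (t, σ)) = fun σ => fderiv ℝ F (t, σ) (0, 1) :=
    funext fun σ => deriv_snd_of_contDiff hF t σ
  rw [acceleration_eq, h1, deriv_snd_of_contDiff (contDiff_fderiv_apply hF (0, 1)),
    leafAcceleration]

lemma contDiffAt_leafAcceleration (hF : ContDiff ℝ ∞ F) {p : ℝ × ℝ}
    (hp : (g.gram (F p)).det ≠ 0) : ContDiffAt ℝ ∞ (g.leafAcceleration F) p :=
  (contDiff_fderiv_apply (contDiff_fderiv_apply hF _) _).contDiffAt.add
    (contDiffAt_christoffelForm hF.contDiffAt (contDiff_fderiv_apply hF _).contDiffAt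
      (contDiff_fderiv_apply hF _).contDiffAt hp)

variable (g) in
/-- The product of the curvature vector of the leaf with `∂F/∂t`, multiplied by the fourth power of
the speed of the leaf. -/
def leafCurvature (F : ℝ × ℝ → Plane) (p : ℝ × ℝ) : ℝ :=
  g.form (F p) (g.leafAcceleration F p) (fderiv ℝ F p (1, 0))
      * g.form (F p) (fderiv ℝ F p (0, 1)) (fderiv ℝ F p (0, 1))
    - g.form (F p) (g.leafAcceleration F p) (fderiv ℝ F p (0, 1))
      * g.form (F p) (fderiv ℝ F p (0, 1)) (fderiv ℝ F p (1, 0))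

/-- The two expressions differ by a positive factor, so the sign can be read off from
`leafCurvature`, which has no denominators. -/
lemma form_curvatureVector_leaf (hF : ContDiff ℝ ∞ F) (t s : ℝ)
    (hE : 0 < g.form (F (t, s)) (fderiv ℝ F (t, s) (0, 1)) (fderiv ℝ F (t, s) (0, 1))) :
    g.form (F (t, s)) (g.curvatureVector (fun σ => F (t, σ)) s) (deriv (fun τ => F (τ, s)) t)
      = g.leafCurvature F (t, s)
        / g.form (F (t, s)) (fderiv ℝ F (t, s) (0, 1)) (fderiv ℝ F (t, s) (0, 1)) ^ 2 := by
  rw [curvatureVector, acceleration_leaf hF, deriv_snd_of_contDiff hF,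
    (hasDerivAt_fst_of_contDiff hF (t, s)).deriv, leafCurvature]
  simp only [map_sub, map_smul, sub_apply, smul_apply, smul_eq_mul]
  field_simp

lemma contDiffAt_leafCurvature (hF : ContDiff ℝ ∞ F) {p : ℝ × ℝ}
    (hp : (g.gram (F p)).det ≠ 0) : ContDiffAt ℝ ∞ (g.leafCurvature F) p := by
  have hg : ContDiffAt ℝ ∞ (fun q => g.form (F q)) p := (g.smooth.comp hF).contDiffAt
  have ha := contDiffAt_leafAcceleration hF hp
  have hd : ∀ v, ContDiffAt ℝ ∞ (fun q => fderiv ℝ F q v) p :=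
    fun v => (contDiff_fderiv_apply hF v).contDiffAt
  exact (((hg.clm_apply ha).clm_apply (hd _)).mul ((hg.clm_apply (hd _)).clm_apply (hd _))).sub
    (((hg.clm_apply ha).clm_apply (hd _)).mul ((hg.clm_apply (hd _)).clm_apply (hd _)))

lemma leafAcceleration_central (h : g.IsFreeBoundaryGeodesic γ L) (hγ : ContDiff ℝ ∞ γ)
    (hF : ContDiff ℝ ∞ F) (hF0 : ∀ s ∈ Icc 0 L, F (0, s) = γ s) {s : ℝ} (hs : s ∈ Icc 0 L) :
    g.leafAcceleration F (0, s) = 0 := by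
  have h1 : fderiv ℝ (fun q => fderiv ℝ F q (0, 1)) (0, s) (0, 1) = deriv (deriv γ) s :=
    HasDerivAt.eq_of_eqOn_Icc h.length_pos hs
      (hasDerivAt_snd_of_contDiff (contDiff_fderiv_apply hF (0, 1)) (0, s))
      (hasDerivAt_of_contDiff (contDiff_deriv hγ) s)
      fun σ hσ => fderiv_snd_eq_deriv h hγ hF hF0 hσ
  rw [leafAcceleration, h1, fderiv_snd_eq_deriv h hγ hF hF0 hs, hF0 s hs]
  exact h.geodesic s hs

/-- The curvature of the leaves varies to first order by the Jacobi operator. -/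
lemma hasDerivAt_leafCurvature (h : g.IsFreeBoundaryGeodesic γ L) (hγ : ContDiff ℝ ∞ γ)
    (hφ : ContDiff ℝ ∞ φ) (hX : ContDiff ℝ ∞ X)
    (e : ∀ s ∈ Icc 0 L, X s = φ s • g.unitNormal γ s)
    (hF : ContDiff ℝ ∞ F) (hF0 : ∀ s ∈ Icc 0 L, F (0, s) = γ s)
    (hFt : ∀ s ∈ Icc 0 L, fderiv ℝ F (0, s) (1, 0) = X s) {s : ℝ} (hs : s ∈ Icc 0 L)
    (hFst : HasDerivAt (fun t => fderiv ℝ F (t, s) (0, 1)) (deriv X s) 0)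
    (hFsst : HasDerivAt (fun t => fderiv ℝ (fun q => fderiv ℝ F q (0, 1)) (t, s) (0, 1))
      (deriv (deriv X) s) 0) :
    HasDerivAt (fun t => g.leafCurvature F (t, s))
      (φ s * (deriv (deriv φ) s + g.gaussCurvature (γ s) * φ s)) 0 := by
  have hdet := (h.det_pos hs).ne'
  have hc : HasDerivAt (fun t => F (t, s)) (X s) 0 := by
    rw [← hFt s hs]
    exact hasDerivAt_fst_of_contDiff hF (0, s)
  have hdet' : (g.gram (F (0, s))).det ≠ 0 := by rwa [hF0 s hs]
  have hs' := fderiv_snd_eq_deriv h hγ hF hF0 hs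
  have hacc : HasDerivAt (fun t => g.leafAcceleration F (t, s)) (deriv (deriv X) s
      + (g.christoffelFormDeriv (γ s) (X s) (deriv γ s) (deriv γ s)
      + g.christoffelForm (γ s) (deriv X s) (deriv γ s)
      + g.christoffelForm (γ s) (deriv γ s) (deriv X s))) 0 := by
    have := hFsst.fun_add (g.hasDerivAt_christoffelForm hc hFst hFst hdet')
    rwa [hs', hF0 s hs] at this
  have hFtt : HasDerivAt (fun t => fderiv ℝ F (t, s) (1, 0))
      (fderiv ℝ (fun q => fderiv ℝ F q (1, 0)) (0, s) (1, 0)) 0 :=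
    hasDerivAt_fst_of_contDiff (contDiff_fderiv_apply hF (1, 0)) (0, s)
  -- The acceleration vanishes at t = 0, so only terms with its derivative survive. The second
  -- product drops out because γ' is orthogonal to ∂F/∂t = φν.
  have key := ((g.hasDerivAt_form hc hacc hFtt hdet').fun_mul
    (g.hasDerivAt_form hc hFst hFst hdet')).fun_sub
    ((g.hasDerivAt_form hc hacc hFst hdet').fun_mul (g.hasDerivAt_form hc hFst hFtt hdet'))
  refine key.congr_deriv ?_
  have hΓ0 : g.christoffelForm (γ s) (X s) 0 = 0 := by
    ext k
    simp [christoffelForm_apply]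
  have hνγ : g.form (γ s) (deriv γ s) (g.unitNormal γ s) = 0 := by
    rw [g.symm, form_unitNormal_deriv]
  rw [leafAcceleration_central h hγ hF hF0 hs, hs', hF0 s hs, hFt s hs, hΓ0, add_zero]
  have hj := form_linearized_acceleration h hγ hφ hX e hs
  rw [e s hs] at hj ⊢
  simp only [map_smul, map_zero, zero_apply, smul_eq_mul, hj, h.unit_speed s hs, hνγ]
  ring

/-- For a positive eigenvalue the leaves near the central one curve towards it. -/
lemma eventually_leafCurvature_sign (h : g.IsFreeBoundaryGeodesic γ L) (hγ : ContDiff ℝ ∞ γ)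
    (hF : ContDiff ℝ ∞ F) (hF0 : ∀ s ∈ Icc 0 L, F (0, s) = γ s) {s : ℝ} (hs : s ∈ Icc 0 L) {d : ℝ}
    (hd : HasDerivAt (fun t => g.leafCurvature F (t, s)) d 0) (hneg : d < 0) :
    ∀ᶠ p in 𝓝 ((0 : ℝ), s), p.2 ∈ Icc 0 L → p.1 ≠ 0 → p.1 * g.leafCurvature F p < 0 := by
  have hdet : (g.gram (F (0, s))).det ≠ 0 := by
    rw [hF0 s hs]
    exact (h.det_pos hs).ne'
  have hC := contDiffAt_leafCurvature hF hdet
  have hswap : Tendsto (Prod.swap : ℝ × ℝ → ℝ × ℝ) (𝓝 (s, 0)) (𝓝 (0, s)) :=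
    continuous_swap.tendsto (s, 0)
  have hswap' : Tendsto (Prod.swap : ℝ × ℝ → ℝ × ℝ) (𝓝 (0, s)) (𝓝 (s, 0)) :=
    continuous_swap.tendsto (0, s)
  have hfst : ∀ p : ℝ × ℝ, DifferentiableAt ℝ (g.leafCurvature F) p →
      HasDerivAt (fun t => g.leafCurvature F (t, p.2)) (fderiv ℝ (g.leafCurvature F) p (1, 0)) p.1 :=
    fun p hp => HasFDerivAt.comp_hasDerivAt (f := fun t => (t, p.2)) p.1 hp.hasFDerivAt
      ((hasDerivAt_id p.1).prodMk (hasDerivAt_const p.1 p.2))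
  have hev : ∀ᶠ p in 𝓝 ((0 : ℝ), s), DifferentiableAt ℝ (g.leafCurvature F) p :=
    ((hC.of_le (m := 1) (by simp)).eventually (by simp)).mono fun p hp =>
      hp.differentiableAt (by simp)
  have hcont : ContinuousAt (fun p => fderiv ℝ (g.leafCurvature F) p (1, 0)) ((0 : ℝ), s) :=
    (hC.fderiv_right (m := 1) (by norm_cast)).continuousAt.clm_apply continuousAt_const
  have hval : fderiv ℝ (g.leafCurvature F) (0, s) (1, 0) = d :=
    (hfst (0, s) hev.self_of_nhds).unique hd
  -- The coordinates are swapped because `eventually_sign` moves the second variable, while here t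
  -- crosses 0. The leaf t = 0 is a known geodesic only for s in [0, L], hence the restriction on s.
  have hsign := eventually_sign (N := fun p => g.leafCurvature F p.swap)
    (D := fun p => fderiv ℝ (g.leafCurvature F) p.swap (1, 0)) (a := s) (e := 0)
    ((hswap.eventually hev).mono fun p hp => hfst p.swap hp)
    (ContinuousAt.comp (f := Prod.swap) (x := (s, (0 : ℝ))) hcont continuous_swap.continuousAt)
    (by simpa [hval] using hneg)
  filter_upwards [hswap'.eventually hsign] with p hp hpI hp0
  have h0 : g.leafCurvature F (0, p.2) = 0 := by
    simp [leafCurvature, leafAcceleration_central h hγ hF hF0 hpI]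
  have := hp h0
  simp only [Prod.swap_swap, Prod.snd_swap] at this
  rcases hp0.lt_or_gt with hlt | hlt
  · exact mul_neg_of_neg_of_pos hlt (this.2 hlt)
  · exact mul_neg_of_pos_of_neg hlt (this.1 hlt)

/-- A family with variation field `φ ν` that is orthogonal to the boundary is a foliation by leaves
that curve towards the central one. -/
theorem exists_foliation_of_variation (h : g.IsFreeBoundaryGeodesic γ L) (hγ : ContDiff ℝ ∞ γ)
    (hφ : ContDiff ℝ ∞ φ) (hX : ContDiff ℝ ∞ X)
    (e : ∀ s ∈ Icc 0 L, X s = φ s • g.unitNormal γ s)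
    {lam : ℝ} (hlam : 0 < lam)
    (heq : ∀ s ∈ Icc 0 L, deriv (deriv φ) s + g.gaussCurvature (γ s) * φ s + lam * φ s = 0)
    (hF : ContDiff ℝ ∞ F) (hF0 : ∀ s ∈ Icc 0 L, F (0, s) = γ s)
    (hFt : ∀ s ∈ Icc 0 L, fderiv ℝ F (0, s) (1, 0) = X s)
    (hFst : ∀ s ∈ Icc 0 L, HasDerivAt (fun t => fderiv ℝ F (t, s) (0, 1)) (deriv X s) 0)
    (hFsst : ∀ s ∈ Icc 0 L,
      HasDerivAt (fun t => fderiv ℝ (fun q => fderiv ℝ F q (0, 1)) (t, s) (0, 1))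
      (deriv (deriv X) s) 0)
    (hbdry : ∀ t s, s = 0 ∨ s = L → F (t, s) ∈ circle)
    (horth : ∃ r > 0, ∀ t, |t| < r → ∀ s, s = 0 ∨ s = L →
      g.form (F (t, s)) (fderiv ℝ F (t, s) (0, 1)) (circleTangent (F (t, s))) = 0)
    (hin : inner ℝ (γ 0) (deriv γ 0) < 0) (hout : 0 < inner ℝ (γ L) (deriv γ L))
    {m M : ℝ} (hm : 0 < m) (hmφ : ∀ s ∈ Icc 0 L, m ≤ φ s) (hφM : ∀ s ∈ Icc 0 L, φ s ≤ M) :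
    ∃ ε > 0, g.IsFreeBoundaryFoliation γ L ε F ∧
      (∀ s ∈ Icc 0 L, deriv (fun t => F (t, s)) 0 = φ s • g.unitNormal γ s) ∧
      g.CurvatureTowardsCenter L ε F ∧
      ∀ t ∈ Icc (-ε) ε, t ≠ 0 →
        g.DistanceRatioLE γ L ((fun s => F (t, s)) '' Icc 0 L) (2 * (M / m)) := by
  have hL := h.length_pos
  obtain ⟨ε₁, hε₁, hchart₁⟩ := exists_isFoliationChart h hγ hF hF0
    (fun s hs => (hFt s hs).trans (e s hs)) (fun t => hbdry t 0 (Or.inl rfl))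
    (fun t => hbdry t L (Or.inr rfl)) hin hout hm hmφ hφM
  obtain ⟨ε₂, hε₂, hcurv⟩ := exists_rectangle hL
    (P := fun p => p.2 ∈ Icc 0 L → p.1 ≠ 0 → p.1 * g.leafCurvature F p < 0) fun s hs =>
      eventually_leafCurvature_sign h hγ hF hF0 hs
        (hasDerivAt_leafCurvature h hγ hφ hX e hF hF0 hFt hs (hFst s hs) (hFsst s hs)) (by
        have hφs : 0 < φ s := hm.trans_le (hmφ s hs)
        have : φ s * (deriv (deriv φ) s + g.gaussCurvature (γ s) * φ s) = -(lam * φ s ^ 2) := by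
          linear_combination φ s * heq s hs
        rw [this]
        have : 0 < lam * φ s ^ 2 := by positivity
        linarith)
  obtain ⟨r, hr, horth⟩ := horth
  -- The foliation uses |t| ≤ δ/2, so the closed parameter set lies inside the open chart.
  set δ := min ε₁ (min ε₂ r) with hδ
  have hδ0 : 0 < δ := lt_min hε₁ (lt_min hε₂ hr)
  have hchart : g.IsFoliationChart L δ m M F := hchart₁.mono (min_le_left _ _)
  have habs : ∀ t ∈ Icc (-(δ / 2)) (δ / 2), |t| < δ := fun t ht => by
    have := abs_le.mpr ht
    linarith
  have hrect : ∀ p ∈ Icc (-(δ / 2)) (δ / 2) ×ˢ Icc 0 L, p ∈ rectangle L δ := fun p hp =>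
    IsFoliationChart.mem_rectangle (habs p.1 hp.1) hp.2
  have hM : 0 ≤ M := by
    have h0 := left_mem_Icc.mpr hL.le
    exact (hm.le.trans (hmφ 0 h0)).trans (hφM 0 h0)
  have himg : γ '' Icc 0 L = (fun s => F (0, s)) '' Icc 0 L :=
    image_congr fun s hs => (hF0 s hs).symm
  refine ⟨δ / 2, half_pos hδ0, ⟨⟨univ, isOpen_univ, subset_univ _, hF.contDiffOn⟩, ?_, ?_, ?_, hF0,
    ?_, ?_, ?_⟩, ?_, ?_, ?_⟩
  · exact fun p hp => (hchart.mem_disk_iff p (hrect p hp)).mpr hp.2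
  · exact hchart.injOn.mono hrect
  · exact fun p hp => hchart.injective_fderiv (hrect p hp) hm
  -- A point of the disk on no leaf with |t| < δ/2 is at least this far from γ, by the lower bound
  -- on path lengths.
  · refine ⟨δ / 2 * m / Real.sqrt 2, by positivity, fun x hx hd => ?_⟩
    by_contra hcon
    refine hd.not_ge ?_
    rw [himg]
    refine hchart.le_rdistTo hm hL.le (half_pos hδ0) (half_lt_self hδ0) hx fun hmem => hcon ?_
    exact image_mono (Set.prod_mono Ioo_subset_Icc_self le_rfl) hmem
  · exact fun t ht s hs => hchart.interior _ (hrect (t, s) ⟨ht, Ioo_subset_Icc_self hs⟩) hs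
  · refine fun t ht s hs => ⟨hbdry t s hs, ?_⟩
    rw [deriv_snd_of_contDiff hF]
    exact horth t ((habs t ht).trans_le ((min_le_right _ _).trans (min_le_right _ _))) s hs
  · intro s hs
    rw [← e s hs, ← hFt s hs]
    exact (hasDerivAt_fst_of_contDiff hF (0, s)).deriv
  · intro t ht ht0 s hs
    have hp := hrect (t, s) ⟨ht, hs⟩
    have hE := hchart.speed_pos _ hp
    rw [form_curvatureVector_leaf hF t s hE, ← mul_div_assoc]
    refine div_neg_of_neg_of_pos (hcurv (t, s) (rectangle_mono ?_ hp) hs ht0) (by positivity)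
    exact (min_le_right _ _).trans (min_le_left _ _)
  · exact fun t ht ht0 => hchart.distanceRatioLE hm hM hL.le hF0 ht0 (habs t ht)

end DiskMetric

/-! ### Construction of the free boundary family -/

/-- The affine family `γ + t X` corrected by products of functions of the two variables. -/
def variation {ι : Type*} [Fintype ι] (γ X : ℝ → Plane) (h : ι → ℝ → ℝ) (r : ι → ℝ → Plane)
    (p : ℝ × ℝ) : Plane :=
  γ p.2 + p.1 • X p.2 + ∑ i, h i p.2 • r i p.1

section Variation

variable {ι : Type*} [Fintype ι] {γ X : ℝ → Plane} {h : ι → ℝ → ℝ} {r : ι → ℝ → Plane}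

lemma contDiff_variation (hγ : ContDiff ℝ ∞ γ) (hX : ContDiff ℝ ∞ X) (hh : ∀ i, ContDiff ℝ ∞ (h i))
    (hr : ∀ i, ContDiff ℝ ∞ (r i)) : ContDiff ℝ ∞ (variation γ X h r) :=
  ((hγ.comp contDiff_snd).add (contDiff_fst.smul (hX.comp contDiff_snd))).add
    (ContDiff.sum fun i _ => ((hh i).comp contDiff_snd).smul ((hr i).comp contDiff_fst))

/-- The s-derivative is again a `variation`, with γ, X and h differentiated and r unchanged. One
formula thus gives the first and second derivatives along the leaves. -/
lemma fderiv_variation_snd (hγ : ContDiff ℝ ∞ γ) (hX : ContDiff ℝ ∞ X)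
    (hh : ∀ i, ContDiff ℝ ∞ (h i)) (hr : ∀ i, ContDiff ℝ ∞ (r i)) (p : ℝ × ℝ) :
    fderiv ℝ (variation γ X h r) p (0, 1)
      = variation (deriv γ) (deriv X) (fun i => deriv (h i)) r p := by
  refine (hasDerivAt_snd_of_contDiff (contDiff_variation hγ hX hh hr) p).unique ?_
  exact ((DiskMetric.hasDerivAt_of_contDiff hγ p.2).fun_add
    ((DiskMetric.hasDerivAt_of_contDiff hX p.2).fun_const_smul p.1)).fun_add
    (HasDerivAt.fun_sum fun i _ => (DiskMetric.hasDerivAt_of_contDiff (hh i) p.2).smul_const (r i p.1))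

lemma variation_zero (hr : ∀ i, r i 0 = 0) (s : ℝ) : variation γ X h r (0, s) = γ s := by
  simp [variation, hr]

/-- The corrections vanish to first order at t = 0, so the variation field is exactly X. Applied to
the derived families, this gives X' and X''. -/
lemma hasDerivAt_variation_fst (hr : ∀ i, HasDerivAt (r i) 0 0) (s : ℝ) :
    HasDerivAt (fun t => variation γ X h r (t, s)) (X s) 0 := by
  have := (((hasDerivAt_id (0 : ℝ)).smul_const (X s)).const_add (γ s)).fun_add
    (HasDerivAt.fun_sum (u := Finset.univ) fun i _ => (hr i).fun_const_smul (h i s))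
  exact HasDerivAt.congr_deriv this (by simp)

end Variation

/-- Cubic Hermite interpolation on `[0, L]`. -/
lemma exists_hermite {L : ℝ} (hL : L ≠ 0) :
    ∃ h : Fin 4 → ℝ → ℝ, (∀ i, ContDiff ℝ ∞ (h i)) ∧
      (∀ i, h i 0 = ![1, 0, 0, 0] i) ∧ (∀ i, deriv (h i) 0 = ![0, 1, 0, 0] i) ∧
      (∀ i, h i L = ![0, 0, 1, 0] i) ∧ (∀ i, deriv (h i) L = ![0, 0, 0, 1] i) := by
  set A : Fin 4 → ℝ := ![1, 0, 0, 0] with hA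
  set B : Fin 4 → ℝ := ![0, 1, 0, 0] with hB
  set C : Fin 4 → ℝ := ![-3 / L ^ 2, -2 / L, 3 / L ^ 2, -1 / L] with hC
  set D : Fin 4 → ℝ := ![2 / L ^ 3, 1 / L ^ 2, -2 / L ^ 3, 1 / L ^ 2] with hD
  have hd : ∀ i s, deriv (fun s : ℝ => A i + B i * s + C i * s ^ 2 + D i * s ^ 3) s
      = B i + C i * (2 * s) + D i * (3 * s ^ 2) := fun i s => by
    have := ((((hasDerivAt_id s).const_mul (B i)).const_add (A i)).fun_add
      ((hasDerivAt_pow 2 s).const_mul (C i))).fun_add ((hasDerivAt_pow 3 s).const_mul (D i))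
    exact (this.congr_deriv (by simp)).deriv
  refine ⟨fun i s => A i + B i * s + C i * s ^ 2 + D i * s ^ 3, fun i => by fun_prop,
    fun i => by simp, fun i => by rw [hd]; simp, fun i => ?_, fun i => ?_⟩
  · fin_cases i <;> simp [hA, hB, hC, hD] <;> field_simp <;> ring
  · rw [hd]
    fin_cases i <;> simp [hB, hC, hD] <;> field_simp <;> ring

lemma circleTangent_rotate (p : Plane) (a : ℝ) :
    circleTangent (Real.cos a • p + Real.sin a • circleTangent p)
      = Real.cos a • circleTangent p - Real.sin a • p := by
  apply plane_ext <;> simp [circleTangent] <;> ring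

lemma rotate_mem_circle {p : Plane} (hp : p ∈ circle) (a : ℝ) :
    Real.cos a • p + Real.sin a • circleTangent p ∈ circle := by
  rw [circle, mem_sphere_zero_iff_norm, EuclideanSpace.norm_eq, Real.sqrt_eq_one] at hp ⊢
  simp [Fin.sum_univ_two, circleTangent] at hp ⊢
  linear_combination hp * (Real.sin a ^ 2 + Real.cos a ^ 2) + Real.sin_sq_add_cos_sq a

namespace DiskMetric

variable {g : DiskMetric} {L : ℝ} {γ X : ℝ → Plane} {φ : ℝ → ℝ}

/-- A second order correction of `γ + t X` at an end point makes it meet the circle orthogonally. -/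
lemma exists_boundary_correction (h : g.IsFreeBoundaryGeodesic γ L) (hγ : ContDiff ℝ ∞ γ)
    (hφ : ContDiff ℝ ∞ φ) (hX : ContDiff ℝ ∞ X)
    (e : ∀ s ∈ Icc 0 L, X s = φ s • g.unitNormal γ s) {s σ : ℝ} (hs : s ∈ Icc 0 L)
    (hp : γ s ∈ circle) (hT : g.form (γ s) (deriv γ s) (circleTangent (γ s)) = 0)
    (hn : deriv γ s = σ • g.inwardNormal (γ s))
    (hν : g.unitNormal γ s = (σ / g.norm (γ s) (circleTangent (γ s))) • circleTangent (γ s))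
    (hR : deriv φ s + σ * g.boundaryCurvature (γ s) * φ s = 0) :
    ∃ a b : ℝ → Plane, ContDiff ℝ ∞ a ∧ ContDiff ℝ ∞ b ∧ a 0 = 0 ∧ b 0 = 0 ∧
      HasDerivAt a 0 0 ∧ HasDerivAt b 0 0 ∧ ∀ t, γ s + t • X s + a t ∈ circle ∧
        g.form (γ s + t • X s + a t) (deriv γ s + t • deriv X s + b t)
          (circleTangent (γ s + t • X s + a t)) = 0 := by
  set θ := φ s * (σ / g.norm (γ s) (circleTangent (γ s))) with hθ
  have hder := hasDerivAt_form_circleTangent h hγ hφ hX e hs hp hn hν hθ hR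
  have hXs : X s = θ • circleTangent (γ s) := by rw [e s hs, hν, smul_smul]
  set p := γ s
  set T := circleTangent p
  -- The corrected end point runs along the circle, and θ is chosen so that its initial velocity is
  -- X(s). U is the tangent of the circle at P.
  set P : ℝ → Plane := fun t => Real.cos (θ * t) • p + Real.sin (θ * t) • T with hPdef
  set U : ℝ → Plane := fun t => Real.cos (θ * t) • T - Real.sin (θ * t) • p with hUdef
  have hPU : ∀ t, circleTangent (P t) = U t := fun t => circleTangent_rotate p (θ * t)
  have hPc : ∀ t, P t ∈ circle := fun t => rotate_mem_circle hp (θ * t)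
  have hUU : ∀ t, 0 < g.form (P t) (U t) (U t) := fun t => by
    rw [← hPU]
    exact g.pos _ (circle_subset_disk (hPc t)) _ (circleTangent_ne_zero (hPc t))
  have hPs : ContDiff ℝ ∞ P := by fun_prop
  have hUs : ContDiff ℝ ∞ U := by fun_prop
  have hVs : ContDiff ℝ ∞ fun t : ℝ => deriv γ s + t • deriv X s := by fun_prop
  have hgP : ContDiff ℝ ∞ fun t => g.form (P t) := g.smooth.comp hPs
  have hUUs : ContDiff ℝ ∞ fun t => g.form (P t) (U t) (U t) :=
    (hgP.clm_apply hUs).clm_apply hUs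
  -- q measures the component of the leaf's velocity along the circle, which the correction -qU
  -- removes. q(0) = 0 is the orthogonality of γ and q'(0) = 0 is the Robin condition, so the
  -- correction is of second order.
  set q : ℝ → ℝ := fun t => g.form (P t) (deriv γ s + t • deriv X s) (U t)
    / g.form (P t) (U t) (U t) with hq
  have hqs : ContDiff ℝ ∞ q :=
    ((hgP.clm_apply hVs).clm_apply hUs).div hUUs fun t => (hUU t).ne'
  have hP0 : P 0 = p := by simp [hPdef]
  have hU0 : U 0 = T := by simp [hUdef]
  have hq0 : q 0 = 0 := by simp [hq, hP0, hU0, hT]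
  have hq' : HasDerivAt q 0 0 := by
    refine (hder.fun_div (hasDerivAt_of_contDiff hUUs 0) (hUU 0).ne').congr_deriv ?_
    simp [hT]
  have hlin : HasDerivAt (fun t : ℝ => θ * t) θ 0 := by
    simpa using (hasDerivAt_id (0 : ℝ)).const_mul θ
  have hP' : HasDerivAt P (X s) 0 := by
    rw [hXs]
    have hcos : HasDerivAt (fun t => Real.cos (θ * t)) 0 0 := by simpa using hlin.cos
    have hsin : HasDerivAt (fun t => Real.sin (θ * t)) θ 0 := by simpa using hlin.sin
    simpa using (hcos.smul_const p).fun_add (hsin.smul_const T)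
  have hsum : ∀ t, p + t • X s + (P t - p - t • X s) = P t := fun t => by abel
  refine ⟨fun t => P t - p - t • X s, fun t => -(q t • U t), by fun_prop, (hqs.smul hUs).neg,
    by simp [hP0], by simp [hq0], ?_, ?_, fun t => ?_⟩
  · simpa using (hP'.sub_const p).fun_sub ((hasDerivAt_id (0 : ℝ)).smul_const (X s))
  · simpa [hq0] using (hq'.fun_smul (hasDerivAt_of_contDiff hUs 0)).fun_neg
  · simp only [hsum, hPU]
    refine ⟨hPc t, ?_⟩
    rw [map_add, map_neg, map_smul]
    simp only [add_apply, neg_apply, smul_apply, smul_eq_mul, hq]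
    field_simp [(hUU t).ne']
    ring

/-- At an end point the curve is directed into the disk. -/
lemma IsFreeBoundaryGeodesic.inner_deriv_mul_nonpos (h : g.IsFreeBoundaryGeodesic γ L)
    (hγ : ContDiff ℝ ∞ γ) {s s' : ℝ} (hs : s ∈ Icc 0 L) (hs' : s' ∈ Icc 0 L) (hp : γ s ∈ circle) :
    (s' - s) * inner ℝ (γ s) (deriv γ s) ≤ 0 := by
  have hmax : IsLocalMaxOn (fun t => inner ℝ (γ t) (γ t) - 1) (Icc 0 L) s :=
    IsMaxOn.localize fun t ht => by
      have := (mem_disk_iff_inner (γ t)).mp (h.mem_disk ht)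
      rwa [mem_ofPred_eq, inner_self_of_mem_circle hp]
  have hd := hasDerivAt_of_contDiff hγ s
  have hN := ((hd.inner ℝ hd).sub_const 1).hasFDerivAt.hasFDerivWithinAt (s := Icc 0 L)
  have := hmax.hasFDerivWithinAt_nonpos hN
    (sub_mem_posTangentConeAt_of_segment_subset ((convex_Icc 0 L).segment_subset hs hs'))
  simp [real_inner_comm (γ s) (deriv γ s)] at this
  linarith

/-- The tangent at the start of a free boundary geodesic is the inward normal, at its end the outward
normal. -/
lemma IsFreeBoundaryGeodesic.exists_frame (h : g.IsFreeBoundaryGeodesic γ L) (hγ : ContDiff ℝ ∞ γ)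
    {s s' : ℝ} (hs : s ∈ Icc 0 L) (hs' : s' ∈ Icc 0 L) (hp : γ s ∈ circle)
    (hT : g.form (γ s) (deriv γ s) (circleTangent (γ s)) = 0) {σ : ℝ} (hσ : σ ^ 2 = 1)
    (hpos : 0 < σ * (s' - s)) :
    σ * inner ℝ (γ s) (deriv γ s) < 0 ∧ deriv γ s = σ • g.inwardNormal (γ s) ∧
      g.unitNormal γ s = (σ / g.norm (γ s) (circleTangent (γ s))) • circleTangent (γ s) := by
  obtain ⟨τ, c, hτ, hc, h1, h2, h3⟩ := g.exists_eq_smul_inwardNormal hp (h.unit_speed s hs) hT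
  have hle := h.inner_deriv_mul_nonpos hγ hs hs' hp
  -- γ stays in the disk, so the first order condition at the boundary point excludes the opposite
  -- normal.
  have hτσ : τ = σ := by
    rcases sq_eq_sq_iff_eq_or_eq_neg.mp (hτ.trans hσ.symm) with heq | heq
    · exact heq
    · rw [h3, heq] at hle
      nlinarith [mul_pos hpos hc]
  subst hτσ
  refine ⟨?_, h1, h2⟩
  rw [h3]
  nlinarith

/-- A smooth free boundary family with a given normal variation field. -/
theorem exists_foliation (h : g.IsFreeBoundaryGeodesic γ L) (hγ : ContDiff ℝ ∞ γ)
    (hφ : ContDiff ℝ ∞ φ) (hX : ContDiff ℝ ∞ X)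
    (e : ∀ s ∈ Icc 0 L, X s = φ s • g.unitNormal γ s) {lam : ℝ} (hlam : 0 < lam)
    (hφe : g.IsRobinEigenfunction γ L lam φ)
    {m M : ℝ} (hm : 0 < m) (hmφ : ∀ s ∈ Icc 0 L, m ≤ φ s) (hφM : ∀ s ∈ Icc 0 L, φ s ≤ M) :
    ∃ ε > 0, ∃ F : ℝ × ℝ → Plane, g.IsFreeBoundaryFoliation γ L ε F ∧
      (∀ s ∈ Icc 0 L, deriv (fun t => F (t, s)) 0 = φ s • g.unitNormal γ s) ∧
      g.CurvatureTowardsCenter L ε F ∧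
      ∀ t ∈ Icc (-ε) ε, t ≠ 0 →
        g.DistanceRatioLE γ L ((fun s => F (t, s)) '' Icc 0 L) (2 * (M / m)) := by
  have hL := h.length_pos
  have h0 : (0 : ℝ) ∈ Icc 0 L := left_mem_Icc.mpr hL.le
  have h1 : L ∈ Icc 0 L := right_mem_Icc.mpr hL.le
  obtain ⟨hin, hn0, hν0⟩ := h.exists_frame hγ h0 h1 h.start_mem h.start_orthogonal
    (one_pow 2) (by linarith)
  -- σ = -1 at L, where γ leaves along the outward normal. The one formula φ' + σκφ = 0 then covers
  -- the Robin conditions at both ends.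
  obtain ⟨hout, hn1, hν1⟩ := h.exists_frame hγ h1 h0 h.end_mem h.end_orthogonal
    (σ := -1) (by norm_num) (by linarith)
  obtain ⟨a, b, ha, hb, ha0, hb0, ha', hb', hab⟩ := exists_boundary_correction h hγ hφ hX e h0
    h.start_mem h.start_orthogonal hn0 hν0 (by linarith [hφe.robin_start])
  obtain ⟨c, d, hc, hd, hc0, hd0, hc', hd', hcd⟩ := exists_boundary_correction h hγ hφ hX e h1
    h.end_mem h.end_orthogonal hn1 hν1 (by linarith [hφe.robin_end])
  obtain ⟨η, hη, hη0, hη0', hη1, hη1'⟩ := exists_hermite hL.ne'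
  -- The order matches the Hermite basis: value and slope at 0, then value and slope at L. So a, c
  -- correct the end points and b, d the end velocities, independently.
  set r : Fin 4 → ℝ → Plane := ![a, b, c, d] with hr
  have hrs : ∀ i, ContDiff ℝ ∞ (r i) := by
    intro i
    fin_cases i
    exacts [ha, hb, hc, hd]
  have hr0 : ∀ i, r i 0 = 0 := by
    intro i
    fin_cases i
    exacts [ha0, hb0, hc0, hd0]
  have hr' : ∀ i, HasDerivAt (r i) 0 0 := by
    intro i
    fin_cases i
    exacts [ha', hb', hc', hd']
  have hF := contDiff_variation hγ hX hη hrs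
  have hFs := fderiv_variation_snd hγ hX hη hrs
  have hFss := fderiv_variation_snd (contDiff_deriv hγ) (contDiff_deriv hX)
    (fun i => contDiff_deriv (hη i)) hrs
  have hFs' := funext hFs
  have hF_start : ∀ t, variation γ X η r (t, 0) = γ 0 + t • X 0 + a t := fun t => by
    simp [variation, Fin.sum_univ_four, hη0, hr]
  have hF_end : ∀ t, variation γ X η r (t, L) = γ L + t • X L + c t := fun t => by
    simp [variation, Fin.sum_univ_four, hη1, hr]
  have hFs_start : ∀ t, variation (deriv γ) (deriv X) (fun i => deriv (η i)) r (t, 0)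
      = deriv γ 0 + t • deriv X 0 + b t := fun t => by
    simp [variation, Fin.sum_univ_four, hη0', hr]
  have hFs_end : ∀ t, variation (deriv γ) (deriv X) (fun i => deriv (η i)) r (t, L)
      = deriv γ L + t • deriv X L + d t := fun t => by
    simp [variation, Fin.sum_univ_four, hη1', hr]
  obtain ⟨ε, hε, hfol⟩ := exists_foliation_of_variation h hγ hφ hX e hlam hφe.equation hF
    (fun s _ => variation_zero hr0 s)
    (fun s _ => (hasDerivAt_fst_of_contDiff hF (0, s)).unique (hasDerivAt_variation_fst hr' s))
    (fun s _ => by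
      simp only [hFs]
      exact hasDerivAt_variation_fst hr' s)
    (fun s _ => by
      simp only [hFs', hFss]
      exact hasDerivAt_variation_fst hr' s)
    (fun t s hs => by
      rcases hs with rfl | rfl
      · rw [hF_start]
        exact (hab t).1
      · rw [hF_end]
        exact (hcd t).1)
    ⟨1, one_pos, fun t _ s hs => by
      rw [hFs]
      rcases hs with rfl | rfl
      · rw [hF_start, hFs_start]
        exact (hab t).2
      · rw [hF_end, hFs_end]
        exact (hcd t).2⟩
    (by linarith) (by linarith) hm hmφ hφM
  exact ⟨ε, hε, variation γ X η r, hfol⟩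

end DiskMetric

/-! ### Passage to globally smooth representatives -/

lemma _root_.ContDiff.smoothOn {E F : Type*} [NormedAddCommGroup E] [NormedSpace ℝ E]
    [NormedAddCommGroup F] [NormedSpace ℝ F] {f : E → F} (h : ContDiff ℝ ∞ f) (S : Set E) :
    SmoothOn f S := ⟨univ, isOpen_univ, subset_univ _, h.contDiffOn⟩

namespace DiskMetric

variable {g : DiskMetric} {L lam : ℝ} {γ c : ℝ → Plane} {φ ψ : ℝ → ℝ}

lemma unitNormal_congr {s : ℝ} (h : c =ᶠ[𝓝 s] γ) : g.unitNormal c s = g.unitNormal γ s := by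
  rw [unitNormal, unitNormal, h.self_of_nhds, h.deriv_eq]

/-- Agreement near each point of [0, L], not just on it, is needed, because `deriv` at the end
points looks at both sides. -/
lemma IsFreeBoundaryGeodesic.congr (h : g.IsFreeBoundaryGeodesic γ L) (hc : ContDiff ℝ ∞ c)
    (e : ∀ s ∈ Icc 0 L, c =ᶠ[𝓝 s] γ) : g.IsFreeBoundaryGeodesic c L := by
  have he : EqOn c γ (Icc 0 L) := fun s hs => (e s hs).self_of_nhds
  have hd : EqOn (deriv c) (deriv γ) (Icc 0 L) := fun s hs => (e s hs).deriv_eq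
  have h0 : (0 : ℝ) ∈ Icc 0 L := left_mem_Icc.mpr h.length_pos.le
  have h1 : L ∈ Icc 0 L := right_mem_Icc.mpr h.length_pos.le
  refine ⟨h.length_pos, hc.smoothOn _, h.injOn.congr he.symm, fun s hs => ?_, fun s hs => ?_,
    fun s hs => ?_, ?_, ?_, ?_, ?_⟩
  · rw [he hs, hd hs, h.unit_speed s hs]
  · rw [acceleration_eq, (e s hs).deriv.deriv_eq, he hs, hd hs]
    exact h.geodesic s hs
  · rw [he (Ioo_subset_Icc_self hs)]
    exact h.interior s hs
  · rw [he h0]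
    exact h.start_mem
  · rw [he h1]
    exact h.end_mem
  · rw [he h0, hd h0, h.start_orthogonal]
  · rw [he h1, hd h1, h.end_orthogonal]

/-- Only the points of the curve enter, not its derivatives, so agreement on [0, L] suffices. -/
lemma secondVariation_congr (hL : 0 ≤ L) (he : EqOn c γ (Icc 0 L)) (f : ℝ → ℝ) :
    g.secondVariation c L f = g.secondVariation γ L f := by
  rw [secondVariation, secondVariation, he (left_mem_Icc.mpr hL), he (right_mem_Icc.mpr hL)]
  congr 1
  refine intervalIntegral.integral_congr fun s hs => ?_
  rw [uIcc_of_le hL] at hs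
  simp only [he hs]

lemma IsRobinEigenfunction.congr_curve (h : g.IsRobinEigenfunction γ L lam φ) (hL : 0 ≤ L)
    (he : EqOn c γ (Icc 0 L)) : g.IsRobinEigenfunction c L lam φ where
  smooth := h.smooth
  nontrivial := h.nontrivial
  equation s hs := by rw [he hs, h.equation s hs]
  robin_start := by rw [he (left_mem_Icc.mpr hL), h.robin_start]
  robin_end := by rw [he (right_mem_Icc.mpr hL), h.robin_end]

lemma IsRobinEigenfunction.congr (h : g.IsRobinEigenfunction γ L lam φ) (hL : 0 ≤ L)
    (hψ : ContDiff ℝ ∞ ψ) (e : ∀ s ∈ Icc 0 L, ψ =ᶠ[𝓝 s] φ) : g.IsRobinEigenfunction γ L lam ψ := by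
  have h0 := e 0 (left_mem_Icc.mpr hL)
  have h1 := e L (right_mem_Icc.mpr hL)
  refine ⟨hψ.smoothOn _, ?_, fun s hs => ?_, ?_, ?_⟩
  · obtain ⟨s, hs, hne⟩ := h.nontrivial
    exact ⟨s, hs, by rwa [(e s hs).self_of_nhds]⟩
  · rw [(e s hs).deriv.deriv_eq, (e s hs).self_of_nhds, h.equation s hs]
  · rw [h0.deriv_eq, h0.self_of_nhds, h.robin_start]
  · rw [h1.deriv_eq, h1.self_of_nhds, h.robin_end]

lemma IsPositiveFirstEigenfunction.congr_curve (h : g.IsPositiveFirstEigenfunction γ L lam φ)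
    (hL : 0 ≤ L) (he : EqOn c γ (Icc 0 L)) : g.IsPositiveFirstEigenfunction c L lam φ where
  eigen := h.eigen.congr_curve hL he
  least mu ψ hψ := h.least mu ψ (hψ.congr_curve hL he.symm)
  pos := h.pos
  normalized := h.normalized

lemma IsFreeBoundaryFoliation.congr_curve {ε : ℝ} {F : ℝ × ℝ → Plane}
    (h : g.IsFreeBoundaryFoliation c L ε F) (he : EqOn c γ (Icc 0 L)) :
    g.IsFreeBoundaryFoliation γ L ε F :=
  { h with
    central := fun s hs => (h.central s hs).trans (he hs)
    covers := by
      rw [← he.image_eq]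
      exact h.covers }

/-- ν is smooth where the Gram determinant is positive, an open set of parameters containing [0, L].
Off the disk the form may degenerate. -/
lemma smoothOn_normal_field (h : g.IsFreeBoundaryGeodesic γ L) (hγ : ContDiff ℝ ∞ γ)
    (hφ : ContDiff ℝ ∞ φ) : SmoothOn (fun s => φ s • g.unitNormal γ s) (Icc 0 L) :=
  ⟨{s | 0 < (g.gram (γ s)).det},
    isOpen_lt continuous_const (g.contDiff_gram_det.comp hγ).continuous, fun _ hs => h.det_pos hs,
    fun _ hs => (hφ.contDiffAt.smul (contDiffAt_unitNormal hγ hs)).contDiffWithinAt⟩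

/-- The family is built with m = min φ and M = max φ, attained by compactness, so M / m is the
Harnack constant. φ and φν are first replaced by globally smooth extensions. -/
theorem exists_foliation_of_eigenfunction (h : g.IsFreeBoundaryGeodesic γ L)
    (hγ : ContDiff ℝ ∞ γ) (hlam : 0 < lam) (hφ : g.IsRobinEigenfunction γ L lam φ)
    (hpos : ∀ s ∈ Icc 0 L, 0 < φ s) :
    ∃ ε > 0, ∃ F : ℝ × ℝ → Plane, g.IsFreeBoundaryFoliation γ L ε F ∧
      (∀ s ∈ Icc 0 L, deriv (fun t => F (t, s)) 0 = φ s • g.unitNormal γ s) ∧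
      g.CurvatureTowardsCenter L ε F ∧
      ∀ t ∈ Icc (-ε) ε, t ≠ 0 →
        g.DistanceRatioLE γ L ((fun s => F (t, s)) '' Icc 0 L) (2 * harnackConstant L φ) := by
  have hL := h.length_pos
  obtain ⟨ψ, hψ, heψ⟩ := exists_contDiff_extension hL hφ.smooth
  have he : EqOn ψ φ (Icc 0 L) := fun s hs => (heψ s hs).self_of_nhds
  obtain ⟨X, hX, heX⟩ := exists_contDiff_extension hL (smoothOn_normal_field h hγ hψ)
  have hcomp : IsCompact (φ '' Icc 0 L) := by
    rw [← he.image_eq]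
    exact isCompact_Icc.image hψ.continuous
  have hne : (φ '' Icc 0 L).Nonempty := (nonempty_Icc.mpr hL.le).image φ
  have hm : 0 < sInf (φ '' Icc 0 L) := by
    obtain ⟨s, hs, hse⟩ := hcomp.sInf_mem hne
    rw [← hse]
    exact hpos s hs
  obtain ⟨ε, hε, F, h1, h2, h3, h4⟩ := exists_foliation h hγ hψ hX
    (fun s hs => (heX s hs).self_of_nhds) hlam (hφ.congr hL.le hψ heψ) hm
    (fun s hs => by
      rw [he hs]
      exact csInf_le hcomp.bddBelow (mem_image_of_mem φ hs))
    (fun s hs => by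
      rw [he hs]
      exact le_csSup hcomp.bddAbove (mem_image_of_mem φ hs))
  exact ⟨ε, hε, F, h1, fun s hs => by rw [h2 s hs, he hs], h3, h4⟩

end DiskMetric
end FreeBoundary

end

theorem proposition6p2 (g : FreeBoundary.DiskMetric) (hconv : g.StrictlyConvexBoundary)
    (γ : ℝ → FreeBoundary.Plane) (L : ℝ) (hγ : g.IsFreeBoundaryGeodesic γ L)
    (hstable : g.IsStrictlyStable γ L)
    (hK : ∀ s ∈ Set.Icc 0 L, g.gaussCurvature (γ s) < 0) :
    (∃ (lam : ℝ) (φ : ℝ → ℝ), g.IsPositiveFirstEigenfunction γ L lam φ) ∧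
    ∀ (lam : ℝ) (φ : ℝ → ℝ), g.IsPositiveFirstEigenfunction γ L lam φ →
      0 < lam ∧
      ∃ ε > 0, ∃ F : ℝ × ℝ → FreeBoundary.Plane,
        g.IsFreeBoundaryFoliation γ L ε F ∧
        (∀ s ∈ Set.Icc 0 L, deriv (fun t => F (t, s)) 0 = φ s • g.unitNormal γ s) ∧
        g.CurvatureTowardsCenter L ε F ∧
        ∀ t ∈ Set.Icc (-ε) ε, t ≠ 0 →
          g.DistanceRatioLE γ L ((fun s => F (t, s)) '' Set.Icc 0 L)
            (2 * FreeBoundary.harnackConstant L φ) := by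
  have hL := hγ.length_pos
  -- γ is replaced by a globally smooth curve that equals it near [0, L]. Hypotheses are carried
  -- over to c and conclusions back to γ.
  obtain ⟨c, hc, ec⟩ := FreeBoundary.exists_contDiff_extension hL hγ.smooth
  have he : Set.EqOn c γ (Set.Icc 0 L) := fun s hs => (ec s hs).self_of_nhds
  have hgeo := hγ.congr hc ec
  have hdet : ∀ s ∈ Set.Icc 0 L, (g.gram (c s)).det ≠ 0 := fun s hs => (hgeo.det_pos hs).ne'
  have hst : g.IsStrictlyStable c L := fun f hf hne => by
    rw [FreeBoundary.DiskMetric.secondVariation_congr hL.le he]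
    exact hstable f hf hne
  refine ⟨?_, fun lam φ hφ => ?_⟩
  · obtain ⟨lam, φ, hφ⟩ :=
      FreeBoundary.DiskMetric.exists_isPositiveFirstEigenfunction hL hc hdet
    exact ⟨lam, φ, hφ.congr_curve hL.le he.symm⟩
  · have hφc := hφ.congr_curve hL.le he
    have hlam : 0 < lam := hφc.eigenvalue_pos hL hc hdet hst
    obtain ⟨ε, hε, F, h1, h2, h3, h4⟩ :=
      FreeBoundary.DiskMetric.exists_foliation_of_eigenfunction hgeo hc hlam hφc.eigen hφ.pos
    refine ⟨hlam, ε, hε, F, h1.congr_curve he, fun s hs => ?_, h3, fun t ht ht0 => ?_⟩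
    · rw [h2 s hs, FreeBoundary.DiskMetric.unitNormal_congr (ec s hs)]
    · have := h4 t ht ht0
      rwa [FreeBoundary.DiskMetric.DistanceRatioLE, he.image_eq] at this
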